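/- Let $\mathbb T^3=\mathbb R^3/\mathbb Z^3$, $1<\gamma<\tfrac73$, $1<q<4$ with $\gamma<1+\frac{4}{q+2}$, and $0<T^*<\infty$. Consider on $\mathbb T^3\times[0,T^*)$ the system (the compressible Navier–Stokes–Korteweg system with $P(\varrho)=\varrho^\gamma$, $\mu(\varrho)=\varrho$, $\lambda=0$, $\kappa(\varrho)=1/\varrho$, written in the effective velocity $v=u+\nabla\log\varrho$) $$\varrho_t+\operatorname{div}(\varrho v)-\Delta\varrho=0,\qquad \varrho v_t+\varrho(v-\nabla\log\varrho)\cdot\nabla v+\nabla\varrho^\gamma=\operatorname{div}(\varrho\nabla v),$$ with initial data $\varrho|_{t=0}=\varrho_0$, $v|_{t=0}=v_0:=u_0+\nabla\log\varrho_0$, where $\varrho_0\in H^3(\mathbb T^3)$ lies between two positive constants and $u_0\in H^2(\mathbb T^3)$. A strong solution on $\mathbb T^3\times[0,T^*)$ is a pair $(\varrho,v)$, identified with its continuous representative, with $\varrho>0$, satisfying the initial conditions, and the equations almost everywhere, and such that for all $0<T<T^*$: $\varrho\in C([0,T];H^3)\cap L^2(0,T;H^4)$, $\varrho_t\in C([0,T];H^1)\cap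 L^2(0,T;H^2)$, $v\in C([0,T];H^2)\cap L^2(0,T;H^3)$, $v_t\in L^\infty(0,T;L^2)\cap L^2(0,T;H^1)$. Put $$E_0=\int_{\mathbb T^3}\Big(\tfrac12\varrho_0|u_0|^2+\tfrac1{\gamma-1}\varrho_0^\gamma+2|\nabla\sqrt{\varrho_0}|^2\Big)dx .$$ **Proposition.** There is a constant $C>0$ depending only on $T^*$, $q$, $\gamma$ and on upper bounds for $E_0$, $\|\varrho_0^{1/(q+2)}v_0\|_{L^{q+2}}$, $\|\varrho_0\|_{L^\infty}$, $\|v_0\|_{L^\infty}$ and $\|\varrho_0^{-1}\|_{L^\infty}$ such that every such strong solution on $\mathbb T^3\times[0,T^*)$ satisfies, for all $0<T<T^*$, $$\sup_{0\le t\le T}\|\varrho^{-1}(t)\|_{L^\infty(\mathbb T^3)}\le C .$$ -/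

import Mathlib

open MeasureTheory Set Filter Topology
open scoped ENNReal NNReal ContDiff

noncomputable section

namespace NSK

/-- The flat torus `ℝ³ / ℤ³`, with Lebesgue measure of total mass one. -/
abbrev Torus : Type := Fin 3 → UnitAddCircle

/-- Values of vector fields: `ℝ³` with the Euclidean norm. -/
abbrev Vec : Type := EuclideanSpace ℝ (Fin 3)

/-- Space-time measure on `[0, T] × 𝕋³`, i.e. `dt dx` on `Q_T`. -/
def stMeasure (T : ℝ) : Measure (ℝ × Torus) :=
  (volume.restrict (Icc (0 : ℝ) T)).prod (volume : Measure Torus)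

/-! ### Weak derivatives on the torus -/

/-- Smooth functions on the torus: the `ℤ³`-periodic lift to `ℝ³` is smooth. -/
def IsTest (φ : Torus → ℝ) : Prop :=
  ContDiff ℝ ∞ (fun y : Fin 3 → ℝ => φ (fun i => (y i : UnitAddCircle)))

/-- Classical partial derivative in the direction of the `i`-th coordinate. -/
def classicalPartial (i : Fin 3) (φ : Torus → ℝ) (x : Torus) : ℝ :=
  deriv (fun s : ℝ => φ (x + Pi.single i (s : UnitAddCircle))) 0

/-- `g` is the weak `i`-th partial derivative of `f` on the torus. -/
def HasWeakPartial (i : Fin 3) (f g : Torus → ℝ) : Prop :=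
  Integrable f volume ∧ Integrable g volume ∧
    ∀ φ : Torus → ℝ, IsTest φ → ∫ x, f x * classicalPartial i φ x = - ∫ x, g x * φ x

open Classical in
/-- The weak `i`-th partial derivative of `f` (unique up to null sets). The value `0` is used only
if `f` has no weak derivative; it does not occur for the functions considered below. -/
def weakPartial (i : Fin 3) (f : Torus → ℝ) : Torus → ℝ :=
  if h : ∃ g, HasWeakPartial i f g then h.choose else 0

/-- The Sobolev space `H^k(𝕋³)`. -/
def MemH : ℕ → (Torus → ℝ) → Prop
  | 0, f => MemLp f 2 volume
  | k + 1, f => MemLp f 2 volume ∧ ∀ i, ∃ g, MemH k g ∧ HasWeakPartial i f g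

/-! ### Spaces of time-dependent functions -/

/-- `C([0, T]; L²(𝕋³))`. -/
def MemCL2 (T : ℝ) (f : ℝ → Torus → ℝ) : Prop :=
  AEStronglyMeasurable (Function.uncurry f) (stMeasure T) ∧
    (∀ t ∈ Icc (0 : ℝ) T, MemLp (f t) 2 volume) ∧
    ∀ s ∈ Icc (0 : ℝ) T,
      Tendsto (fun t => eLpNorm (f t - f s) 2 volume) (𝓝[Icc (0 : ℝ) T] s) (𝓝 0)

/-- `C([0, T]; H^k(𝕋³))`: all weak spatial derivatives up to order `k` are in `C([0, T]; L²)`. -/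
def MemCH (T : ℝ) : ℕ → (ℝ → Torus → ℝ) → Prop
  | 0, f => MemCL2 T f
  | k + 1, f => MemCL2 T f ∧
      ∀ i, ∃ g, MemCH T k g ∧ ∀ t ∈ Icc (0 : ℝ) T, HasWeakPartial i (f t) (g t)

/-- `L²(0, T; H^k(𝕋³))`: all weak spatial derivatives up to order `k` are in `L²(Q_T)`. -/
def MemL2H (T : ℝ) : ℕ → (ℝ → Torus → ℝ) → Prop
  | 0, f => MemLp (Function.uncurry f) 2 (stMeasure T)
  | k + 1, f => MemLp (Function.uncurry f) 2 (stMeasure T) ∧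
      ∀ i, ∃ g, MemL2H T k g ∧
        ∀ᵐ t ∂(volume.restrict (Icc (0 : ℝ) T)), HasWeakPartial i (f t) (g t)

/-- `L^∞(0, T; L²(𝕋³))`. -/
def MemLinftyL2 (T : ℝ) (f : ℝ → Torus → ℝ) : Prop :=
  AEStronglyMeasurable (Function.uncurry f) (stMeasure T) ∧
    ∃ M : ℝ≥0, ∀ᵐ t ∂(volume.restrict (Icc (0 : ℝ) T)), eLpNorm (f t) 2 volume ≤ M

/-- `g` is the time derivative of `f` on `[0, Ts)`: `f(t) - f(s) = ∫_s^t g(r) dr` in `L²(𝕋³)`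
(to be used for `g ∈ L²(0, T; L²)` for all `T < Ts`). -/
def HasTimeDeriv (Ts : ℝ) (f g : ℝ → Torus → ℝ) : Prop :=
  ∀ s t : ℝ, 0 ≤ s → s ≤ t → t < Ts → ∀ᵐ x : Torus, f t x - f s x = ∫ r in s..t, g r x

/-! ### The system -/

/-- Admissible initial data: `ϱ₀ ∈ H³` bounded between positive constants, `u₀ ∈ H²`. -/
structure IsInitialData (ϱ₀ : Torus → ℝ) (u₀ : Torus → Vec) : Prop where
  bounds : ∃ a b : ℝ, 0 < a ∧ ∀ᵐ x, a ≤ ϱ₀ x ∧ ϱ₀ x ≤ b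
  density : MemH 3 ϱ₀
  velocity : ∀ j, MemH 2 (fun x => u₀ x j)

/-- The effective velocity `u + ∇ log ϱ`. -/
def effVelocity (ϱ : Torus → ℝ) (u : Torus → Vec) : Torus → Vec := fun x =>
  WithLp.toLp 2 fun j => u x j + weakPartial j (fun y => Real.log (ϱ y)) x

/-- The initial energy `E₀ = ∫ (ϱ₀|u₀|²/2 + ϱ₀^γ/(γ-1) + 2|∇√ϱ₀|²) dx`. -/
def initialEnergy (γ : ℝ) (ϱ₀ : Torus → ℝ) (u₀ : Torus → Vec) : ℝ :=
  ∫ x, (1 / 2 * ϱ₀ x * ‖u₀ x‖ ^ 2 + 1 / (γ - 1) * ϱ₀ x ^ γ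
    + 2 * ∑ i, (weakPartial i (fun y => √(ϱ₀ y)) x) ^ 2)

/-- `ϱ_t + div (ϱ v) - Δϱ = 0` almost everywhere on `(0, Ts) × 𝕋³`. -/
def MassEq (Ts : ℝ) (ϱ ϱt : ℝ → Torus → ℝ) (v : ℝ → Torus → Vec) : Prop :=
  ∀ᵐ t ∂(volume.restrict (Ioo (0 : ℝ) Ts)), ∀ᵐ x : Torus,
    ϱt t x + ∑ i, weakPartial i (fun y => ϱ t y * v t y i) x
      - ∑ i, weakPartial i (weakPartial i (ϱ t)) x = 0

/-- `ϱ v_t + ϱ (v - ∇ log ϱ) · ∇v + ∇(ϱ^γ) = div (ϱ ∇v)`, componentwise, almost everywhere on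
`(0, Ts) × 𝕋³`. -/
def MomentumEq (γ Ts : ℝ) (ϱ : ℝ → Torus → ℝ) (v vt : ℝ → Torus → Vec) : Prop :=
  ∀ᵐ t ∂(volume.restrict (Ioo (0 : ℝ) Ts)), ∀ᵐ x : Torus, ∀ j : Fin 3,
    ϱ t x * vt t x j
      + ϱ t x * ∑ i, (v t x i - weakPartial i (fun y => Real.log (ϱ t y)) x)
          * weakPartial i (fun y => v t y j) x
      + weakPartial j (fun y => ϱ t y ^ γ) x
    = ∑ i, weakPartial i (fun y => ϱ t y * weakPartial i (fun z => v t z j) y) x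

/-- `(ϱ, v)` is a strong solution on `𝕋³ × [0, Ts)`, with positive density, of
`ϱ_t + div (ϱ v) - Δϱ = 0`, `ϱ v_t + ϱ (v - ∇ log ϱ) · ∇v + ∇(ϱ^γ) = div (ϱ ∇v)`
with `ϱ(0) = ϱ₀`, `v(0) = v₀`. Here `ϱ` and `v` are identified with their continuous
representatives (`H²(𝕋³)` embeds into `C(𝕋³)`). -/
structure IsStrongSolution (γ Ts : ℝ) (ϱ₀ : Torus → ℝ) (v₀ : Torus → Vec)
    (ϱ : ℝ → Torus → ℝ) (v : ℝ → Torus → Vec) : Prop where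
  continuousOn_density : ContinuousOn (Function.uncurry ϱ) (Ico (0 : ℝ) Ts ×ˢ univ)
  continuousOn_velocity : ContinuousOn (Function.uncurry v) (Ico (0 : ℝ) Ts ×ˢ univ)
  density_pos : ∀ t ∈ Ico (0 : ℝ) Ts, ∀ x, 0 < ϱ t x
  initial_density : ϱ 0 =ᵐ[volume] ϱ₀
  initial_velocity : v 0 =ᵐ[volume] v₀
  density_C : ∀ T, 0 < T → T < Ts → MemCH T 3 ϱ
  density_L2 : ∀ T, 0 < T → T < Ts → MemL2H T 4 ϱ
  velocity_C : ∀ T, 0 < T → T < Ts → ∀ j, MemCH T 2 (fun t x => v t x j)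
  velocity_L2 : ∀ T, 0 < T → T < Ts → ∀ j, MemL2H T 3 (fun t x => v t x j)
  equations : ∃ (ϱt : ℝ → Torus → ℝ) (vt : ℝ → Torus → Vec),
    HasTimeDeriv Ts ϱ ϱt ∧
    (∀ j, HasTimeDeriv Ts (fun t x => v t x j) (fun t x => vt t x j)) ∧
    (∀ T, 0 < T → T < Ts → MemCH T 1 ϱt ∧ MemL2H T 2 ϱt) ∧
    (∀ T, 0 < T → T < Ts → ∀ j,
      MemLinftyL2 T (fun t x => vt t x j) ∧ MemL2H T 1 (fun t x => vt t x j)) ∧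
    MassEq Ts ϱ ϱt v ∧ MomentumEq γ Ts ϱ v vt

end NSK

end

/-!
The density is bounded from above together with one moment of the velocity, and then `-log ϱ` is
bounded by a linear integral inequality, in which the velocity enters through its moments of all
orders.

*Regularity.* At each time, `ϱ`, `v` and their first weak derivatives are absolutely continuous on
almost every line (`HasWeakPartial.lineDeriv`). Products, chain rules and integrations by parts on
the torus reduce to the one-dimensional statements for `IsPrim`, and both equations may be tested
with continuous functions that are absolutely continuous on lines (`State.integral_mass`,
`State.integral_momentum`).

*Upper bound.* The transport terms of the two equations cancel in the balance of
`ϱ (δ + |v|²)^(m/2)`, and the viscosity absorbs the pressure, so that the integral of this quantity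
grows at most at the rate `m (m+1)/4 ∫ ϱ^(2γ-1) (δ + |v|²)^(m/2-1)` (`Evolution.moment_le`).
For `m = 2` the pressure terms cancel with the potential energy, and the energy inequality results,
with the dissipation `∫ ϱ^(γ-2) |∇ϱ|²` (`Evolution.energy_le`). Testing the mass equation with an explicit
supersolution `kern` of the backward heat equation gives pointwise bounds
(`Evolution.comp_density_le`), among them `sup ϱ ≤ K (1 + S)`, where `S` is the largest moment of
order `p = q + 2 > 3` (`exists_density_le`). The dissipation controls `ϱ^(γ/2)` in `L²(0, T; L⁶)` by
the Sobolev inequality, and for `γ < 1 + 4/p` this bounds the source of the moment of order `p` by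
an integrable function of time times `(1 + S)^(1-1/p)`. Hence `S`, and with it `sup ϱ`, is bounded
(`exists_moment_le`).

*Lower bound.* With `ϱ` bounded, the choice `δ = m` and a Gronwall argument give
`(∫ ϱ |v|^m)^(1/m) ≤ D √m` for all `m ≥ 2` (`Evolution.integral_density_mul_norm_rpow_le`). The function
`-log ϱ` satisfies a heat equation with drift, whose sources are estimated by `|v|²/4` and by the divergence
of `v`. If `ϱ ≥ e^(-L)` at some time, the moment of order `6 + L` shows that the mean of `|v|²`
against the kernel is at most linear in `L` (`State.integral_norm_sq_kern_le`): the loss `e^L` in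
passing from `ϱ dx` to `dx` is harmless after taking the root of order `m / 2`. So `-log ϱ`
satisfies a linear integral inequality with an integrable kernel and stays bounded up to time `Ts`
(`exists_neg_log_density_le`).
-/

noncomputable section

namespace NSK

/-! ### Primitives on an interval -/

/-- `f` is a primitive of the integrable function `g` on `[0, T]`; equivalently, `f` is absolutely
continuous there with derivative `g` almost everywhere. -/
def IsPrim (T : ℝ) (f g : ℝ → ℝ) : Prop :=
  IntervalIntegrable g volume 0 T ∧ ∀ t ∈ Icc (0 : ℝ) T, f t = f 0 + ∫ s in (0 : ℝ)..t, g s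

lemma absolutelyContinuousOnInterval_congr {f g : ℝ → ℝ} {a b : ℝ} (h : EqOn f g (uIcc a b))
    (hf : AbsolutelyContinuousOnInterval f a b) : AbsolutelyContinuousOnInterval g a b := by
  rw [absolutelyContinuousOnInterval_iff] at hf ⊢
  intro ε hε
  obtain ⟨δ, hδ, H⟩ := hf ε hε
  refine ⟨δ, hδ, fun E hE hsum => ?_⟩
  have := H E hE hsum
  convert this using 2 with i hi
  rw [h (hE.1 i hi).1, h (hE.1 i hi).2]

lemma _root_.LipschitzOnWith.comp_absolutelyContinuousOnInterval {F f : ℝ → ℝ} {K : ℝ≥0} {s : Set ℝ}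
    {a b : ℝ} (hF : LipschitzOnWith K F s) (hs : MapsTo f (uIcc a b) s)
    (hf : AbsolutelyContinuousOnInterval f a b) :
    AbsolutelyContinuousOnInterval (fun x => F (f x)) a b := by
  rw [absolutelyContinuousOnInterval_iff] at hf ⊢
  intro ε hε
  obtain ⟨δ, hδ, H⟩ := hf (ε / (K + 1)) (by positivity)
  refine ⟨δ, hδ, fun E hE hsum => ?_⟩
  have h1 := H E hE hsum
  calc _ ≤ ∑ i ∈ Finset.range E.1, (K + 1 : ℝ) * dist (f (E.2 i).1) (f (E.2 i).2) := by
        refine Finset.sum_le_sum fun i hi => ?_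
        refine (hF.dist_le_mul _ (hs (hE.1 i hi).1) _ (hs (hE.1 i hi).2)).trans ?_
        gcongr
        simp
    _ < ε := by
        rw [← Finset.mul_sum]
        rw [lt_div_iff₀' (by positivity)] at h1
        exact h1

lemma IsPrim.absolutelyContinuous {T : ℝ} (hT : 0 ≤ T) {f g : ℝ → ℝ} (h : IsPrim T f g) :
    AbsolutelyContinuousOnInterval f 0 T := by
  have h1 := h.1.absolutelyContinuousOnInterval_intervalIntegral (c := 0) (by simp)
  have h2 : AbsolutelyContinuousOnInterval (fun _ : ℝ => f 0) 0 T := by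
    rw [absolutelyContinuousOnInterval_iff]
    intro ε hε
    exact ⟨1, one_pos, fun E _ _ => by simpa using hε⟩
  refine absolutelyContinuousOnInterval_congr ?_ (h2.add h1)
  intro t ht
  rw [uIcc_of_le hT] at ht
  simp [h.2 t ht]

lemma IsPrim.continuousOn {T : ℝ} (hT : 0 ≤ T) {f g : ℝ → ℝ} (h : IsPrim T f g) :
    ContinuousOn f (Icc 0 T) := by
  simpa [uIcc_of_le hT] using (h.absolutelyContinuous hT).continuousOn

lemma IsPrim.ae_hasDerivAt {T : ℝ} (hT : 0 ≤ T) {f g : ℝ → ℝ} (h : IsPrim T f g) :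
    ∀ᵐ t, t ∈ Icc 0 T → HasDerivAt f (g t) t := by
  have h0 : ∀ᵐ t : ℝ, t ≠ 0 := by simp [ae_iff]
  have h1 : ∀ᵐ t : ℝ, t ≠ T := by simp [ae_iff]
  filter_upwards [h.1.ae_hasDerivAt_integral, h0, h1] with t ht h0 h1 htT
  have := (ht (by rwa [uIcc_of_le hT]) 0 (by simp)).const_add (f 0)
  refine this.congr_of_eventuallyEq ?_
  filter_upwards [Ioo_mem_nhds (lt_of_le_of_ne htT.1 h0.symm) (lt_of_le_of_ne htT.2 h1)] with s hs
  exact h.2 s ⟨hs.1.le, hs.2.le⟩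

lemma isPrim_of_ac {T : ℝ} (hT : 0 ≤ T) {f g : ℝ → ℝ}
    (hf : AbsolutelyContinuousOnInterval f 0 T)
    (hd : ∀ᵐ t, t ∈ Icc 0 T → HasDerivAt f (g t) t) : IsPrim T f g := by
  have hsub : uIoc 0 T ⊆ Icc 0 T := by rw [uIoc_of_le hT]; exact Ioc_subset_Icc_self
  have hae : ∀ᵐ t, t ∈ Icc 0 T → deriv f t = g t := by
    filter_upwards [hd] with t ht htT using (ht htT).deriv
  constructor
  · refine hf.intervalIntegrable_deriv.congr_ae ?_
    rw [EventuallyEq, ae_restrict_iff' measurableSet_uIoc]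
    filter_upwards [hae] with t ht htT using ht (hsub htT)
  · intro t ht
    have h1 : AbsolutelyContinuousOnInterval f 0 t := hf.mono (by
      rw [uIcc_of_le hT, uIcc_of_le ht.1]; exact Icc_subset_Icc_right ht.2)
    have h2 := h1.integral_deriv_eq_sub
    rw [← intervalIntegral.integral_congr_ae (f := deriv f), h2]
    · ring
    · filter_upwards [hae] with s hs hst
      rw [uIoc_of_le ht.1] at hst
      exact hs ⟨hst.1.le, hst.2.trans ht.2⟩

lemma IsPrim.add {T : ℝ} (hT : 0 ≤ T) {f g f' g' : ℝ → ℝ} (hf : IsPrim T f f')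
    (hg : IsPrim T g g') : IsPrim T (fun t => f t + g t) (fun t => f' t + g' t) := by
  refine isPrim_of_ac hT ((hf.absolutelyContinuous hT).add (hg.absolutelyContinuous hT)) ?_
  filter_upwards [hf.ae_hasDerivAt hT, hg.ae_hasDerivAt hT] with t h1 h2 ht
  exact (h1 ht).add (h2 ht)

lemma IsPrim.mul {T : ℝ} (hT : 0 ≤ T) {f g f' g' : ℝ → ℝ} (hf : IsPrim T f f')
    (hg : IsPrim T g g') :
    IsPrim T (fun t => f t * g t) (fun t => f' t * g t + f t * g' t) := by
  refine isPrim_of_ac hT ((hf.absolutelyContinuous hT).fun_mul (hg.absolutelyContinuous hT)) ?_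
  filter_upwards [hf.ae_hasDerivAt hT, hg.ae_hasDerivAt hT] with t h1 h2 ht
  exact (h1 ht).mul (h2 ht)

/-- Chain rule: the range of an absolutely continuous function on a compact interval is a compact
interval, on which a `C¹` function is Lipschitz. -/
lemma IsPrim.comp {T : ℝ} (hT : 0 ≤ T) {f f' F F' : ℝ → ℝ} {U : Set ℝ} (hf : IsPrim T f f')
    (hU : MapsTo f (Icc 0 T) U) (hF : ∀ y ∈ U, HasDerivAt F (F' y) y)
    (hF' : ContinuousOn F' U) :
    IsPrim T (fun t => F (f t)) (fun t => F' (f t) * f' t) := by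
  have hc := hf.continuousOn hT
  set s := f '' Icc 0 T with hs
  have hsU : s ⊆ U := by rintro _ ⟨t, ht, rfl⟩; exact hU ht
  have hsc : IsCompact s := isCompact_Icc.image_of_continuousOn hc
  have hsconv : Convex ℝ s :=
    ((isPreconnected_Icc (a := (0 : ℝ)) (b := T)).image f hc).ordConnected.convex
  obtain ⟨K, hK⟩ := hsc.exists_bound_of_continuousOn (hF'.mono hsU)
  have hlip : LipschitzOnWith K.toNNReal F s :=
    hsconv.lipschitzOnWith_of_nnnorm_hasDerivWithin_le
      (fun y hy => (hF y (hsU hy)).hasDerivWithinAt)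
      (fun y hy => by
        rw [← NNReal.coe_le_coe, coe_nnnorm]
        exact (hK y hy).trans (Real.le_coe_toNNReal K))
  refine isPrim_of_ac hT (hlip.comp_absolutelyContinuousOnInterval ?_
    (hf.absolutelyContinuous hT)) ?_
  · rw [uIcc_of_le hT]; exact mapsTo_image f _
  · filter_upwards [hf.ae_hasDerivAt hT] with t h1 ht
    exact (hF _ (hU ht)).comp t (h1 ht)

lemma isPrim_of_hasDerivAt {T : ℝ} (hT : 0 ≤ T) {f f' : ℝ → ℝ}
    (hf : ∀ t ∈ Icc 0 T, HasDerivAt f (f' t) t) (hf' : ContinuousOn f' (Icc 0 T)) :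
    IsPrim T f f' := by
  have hi : IntervalIntegrable f' volume 0 T :=
    ContinuousOn.intervalIntegrable (by rwa [uIcc_of_le hT])
  refine ⟨hi, fun t ht => ?_⟩
  rw [intervalIntegral.integral_eq_sub_of_hasDerivAt (f := f)]
  · ring
  · intro s hs
    rw [uIcc_of_le ht.1] at hs
    exact hf s ⟨hs.1, hs.2.trans ht.2⟩
  · exact hi.mono_set (by
      rw [uIcc_of_le hT, uIcc_of_le ht.1]; exact Icc_subset_Icc_right ht.2)

lemma IsPrim.congr_deriv {T : ℝ} (hT : 0 ≤ T) {f g g' : ℝ → ℝ} (hf : IsPrim T f g)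
    (h : ∀ᵐ t ∂(volume.restrict (Icc 0 T)), g t = g' t) : IsPrim T f g' := by
  refine isPrim_of_ac hT (hf.absolutelyContinuous hT) ?_
  rw [ae_restrict_iff' measurableSet_Icc] at h
  filter_upwards [hf.ae_hasDerivAt hT, h] with t h1 h2 ht
  rw [← h2 ht]; exact h1 ht

/-! ### Translations of the torus -/

instance : IsProbabilityMeasure (volume : Measure UnitAddCircle) :=
  ⟨by simp⟩

instance : IsProbabilityMeasure (volume : Measure Torus) := ⟨by
  rw [volume_pi, ← Set.pi_univ univ, Measure.pi_pi]; simp⟩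

/-- Translation of the torus by `s` in the direction of the `i`-th coordinate. -/
def shift (i : Fin 3) (s : ℝ) (x : Torus) : Torus := x + Pi.single i (s : UnitAddCircle)

lemma continuous_single_coe (i : Fin 3) :
    Continuous fun s : ℝ => (Pi.single i (s : UnitAddCircle) : Torus) :=
  (continuous_single i).comp (AddCircle.continuous_mk' 1)

@[fun_prop]
lemma continuous_shift (i : Fin 3) : Continuous fun p : ℝ × Torus => shift i p.1 p.2 :=
  continuous_snd.add ((continuous_single_coe i).comp continuous_fst)

lemma continuous_shift_left (i : Fin 3) (x : Torus) : Continuous fun s : ℝ => shift i s x :=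
  (continuous_shift i).comp (by fun_prop : Continuous fun s : ℝ => (s, x))

@[simp] lemma shift_zero (i : Fin 3) (x : Torus) : shift i 0 x = x := by
  simp [shift]

lemma shift_shift (i : Fin 3) (s r : ℝ) (x : Torus) :
    shift i s (shift i r x) = shift i (r + s) x := by
  simp only [shift, add_assoc, ← Pi.single_add, AddCircle.coe_add]

@[simp] lemma shift_one (i : Fin 3) (x : Torus) : shift i 1 x = x := by
  have : ((1 : ℝ) : UnitAddCircle) = 0 := AddCircle.coe_period 1
  simp [shift, this]

lemma measurePreserving_shift (i : Fin 3) (s : ℝ) :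
    MeasurePreserving (shift i s) (volume : Measure Torus) volume :=
  measurePreserving_add_right volume _

lemma measurePreserving_prod_shift (i : Fin 3) (μ : Measure ℝ) [SFinite μ] :
    MeasurePreserving (fun p : ℝ × Torus => (p.1, shift i p.1 p.2)) (μ.prod volume)
      (μ.prod volume) :=
  (MeasurePreserving.id μ).skew_product (g := shift i)
    (continuous_shift i).measurable
    (Eventually.of_forall fun s => (measurePreserving_shift i s).map_eq)

lemma integrable_comp_shift {f : Torus → ℝ} (hf : Integrable f) (i : Fin 3) (μ : Measure ℝ)
    [IsFiniteMeasure μ] : Integrable (fun p : ℝ × Torus => f (shift i p.1 p.2)) (μ.prod volume) :=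
  (measurePreserving_prod_shift i μ).integrable_comp_of_integrable (hf.comp_snd μ)

lemma integral_shift {E : Type*} [NormedAddCommGroup E] [NormedSpace ℝ E] (i : Fin 3) (s : ℝ)
    (f : Torus → E) : ∫ x, f (shift i s x) = ∫ x, f x :=
  integral_add_right_eq_self f _

/-! ### Functions are determined by their Fourier coefficients -/

open UnitAddTorus in
/-- Trigonometric polynomials are dense in the continuous functions, and these determine the
integrals over closed sets. -/
lemma ae_eq_zero_of_mFourier {f : Torus → ℝ} (hf : Integrable f)
    (h : ∀ n : Fin 3 → ℤ, ∫ x, (f x : ℂ) * mFourier (d := Fin 3) n x = 0) : f =ᵐ[volume] 0 := by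
  have hfc : Integrable fun x => (f x : ℂ) := hf.ofReal
  have hint : ∀ g : C(Torus, ℂ), Integrable fun x => (f x : ℂ) * g x := fun g => by
    refine hfc.mul_bdd (c := ‖g‖) g.continuous.aestronglyMeasurable ?_
    exact Eventually.of_forall fun x => g.norm_coe_le_norm x
  let Λ : C(Torus, ℂ) →ₗ[ℂ] ℂ :=
    { toFun := fun g => ∫ x, (f x : ℂ) * g x
      map_add' := fun g k => by
        rw [← integral_add (hint g) (hint k)]
        congr 1; ext x; simp [mul_add]
      map_smul' := fun c g => by
        simp only [RingHom.id_apply, smul_eq_mul, ← integral_const_mul]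
        congr 1; ext x; simp; ring }
  have hΛ : Continuous Λ := by
    refine AddMonoidHomClass.continuous_of_bound Λ (∫ x, ‖(f x : ℂ)‖) fun g => ?_
    rw [← integral_mul_const]
    refine (norm_integral_le_integral_norm _).trans (integral_mono (hint g).norm
      (hfc.norm.mul_const _) fun x => ?_)
    rw [norm_mul]
    exact mul_le_mul_of_nonneg_left (g.norm_coe_le_norm x) (norm_nonneg _)
  have hker : (LinearMap.ker Λ) = ⊤ := by
    rw [eq_top_iff, ← span_mFourier_closure_eq_top (d := Fin 3)]
    refine Submodule.topologicalClosure_minimal _ ?_ ?_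
    · rw [Submodule.span_le]
      rintro _ ⟨n, rfl⟩
      exact h n
    · exact isClosed_singleton.preimage hΛ
  have hΛ0 : ∀ g : C(Torus, ℂ), ∫ x, (f x : ℂ) * g x = 0 := fun g => by
    have : g ∈ LinearMap.ker Λ := hker ▸ Submodule.mem_top
    exact this
  refine ae_eq_zero_of_forall_setIntegral_isClosed_eq_zero hf fun s hs => ?_
  have hpos : ∀ n : ℕ, (0 : ℝ) < 1 / ((n : ℝ) + 1) := fun n => by positivity
  have hlim := thickenedIndicator_tendsto_indicator_closure hpos
    tendsto_one_div_add_atTop_nhds_zero_nat s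
  rw [hs.closure_eq, tendsto_pi_nhds] at hlim
  have h1 : Tendsto (fun n : ℕ => ∫ x, f x * (thickenedIndicator (hpos n) s x : ℝ)) atTop
      (𝓝 (∫ x, f x * ((s.indicator (fun _ => (1 : ℝ≥0)) x : ℝ≥0) : ℝ))) := by
    refine tendsto_integral_of_dominated_convergence (fun x => ‖f x‖) (fun n => ?_) hf.norm
      (fun n => Eventually.of_forall fun x => ?_) (Eventually.of_forall fun x => ?_)
    · refine hf.aestronglyMeasurable.mul (Continuous.aestronglyMeasurable ?_)
      exact NNReal.continuous_coe.comp (thickenedIndicator (hpos n) s).continuous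
    · rw [norm_mul]
      refine mul_le_of_le_one_right (norm_nonneg _) ?_
      rw [NNReal.norm_eq]
      exact_mod_cast thickenedIndicator_le_one (hpos n) s x
    · exact ((NNReal.continuous_coe.tendsto _).comp (hlim x)).const_mul _
  have h2 : ∀ n : ℕ, ∫ x, f x * (thickenedIndicator (hpos n) s x : ℝ) = 0 := fun n => by
    have := hΛ0 ⟨fun x => ((thickenedIndicator (hpos n) s x : ℝ) : ℂ), by
      exact Complex.continuous_ofReal.comp
        (NNReal.continuous_coe.comp (thickenedIndicator (hpos n) s).continuous)⟩
    simp only [ContinuousMap.coe_mk, ← Complex.ofReal_mul] at this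
    rw [integral_complex_ofReal] at this
    exact_mod_cast this
  simp only [h2] at h1
  rw [← tendsto_nhds_unique h1 tendsto_const_nhds, ← integral_indicator hs.measurableSet]
  congr 1; ext x
  by_cases hx : x ∈ s <;> simp [hx]

open UnitAddTorus in
lemma mFourier_shift (n : Fin 3 → ℤ) (i : Fin 3) (s : ℝ) (x : Torus) :
    mFourier (d := Fin 3) n (shift i s x)
      = mFourier (d := Fin 3) n x * Complex.exp (2 * Real.pi * Complex.I * n i * s) := by
  have h : ∀ j, fourier (n j) (shift i s x j) = fourier (n j) (x j)
      * (if j = i then Complex.exp (2 * Real.pi * Complex.I * n i * s) else 1) := by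
    intro j
    by_cases hj : j = i
    · subst hj
      simp only [shift, Pi.add_apply, Pi.single_eq_same, if_true]
      rw [fourier_apply, fourier_apply, smul_add, AddCircle.toCircle_add, Circle.coe_mul]
      congr 1
      rw [← fourier_apply, fourier_coe_apply]
      congr 1; simp
    · simp [shift, hj]
  have h' : ∀ y : Torus, mFourier (d := Fin 3) n y = ∏ j, fourier (n j) (y j) := fun y => rfl
  rw [h', h', Finset.prod_congr rfl fun j _ => h j, Finset.prod_mul_distrib]
  simp

/-! ### Smooth functions on the torus -/

/-- The projection `ℝ³ → 𝕋³`. -/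
def toTorus (y : Fin 3 → ℝ) : Torus := fun i => (y i : UnitAddCircle)

lemma isOpenQuotientMap_toTorus : IsOpenQuotientMap toTorus :=
  IsOpenQuotientMap.piMap fun _ => QuotientAddGroup.isOpenQuotientMap_mk

lemma toTorus_surjective : Function.Surjective toTorus := isOpenQuotientMap_toTorus.surjective

lemma shift_toTorus (i : Fin 3) (s : ℝ) (y : Fin 3 → ℝ) :
    shift i s (toTorus y) = toTorus (y + s • Pi.single i 1) := by
  ext j
  by_cases hj : j = i
  · subst hj; simp [shift, toTorus]
  · simp [shift, toTorus, hj]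

lemma IsTest.continuous {φ : Torus → ℝ} (h : IsTest φ) : Continuous φ := by
  rw [isOpenQuotientMap_toTorus.isQuotientMap.continuous_iff]
  exact ContDiff.continuous h

lemma IsTest.hasDerivAt_toTorus {φ : Torus → ℝ} (h : IsTest φ) (i : Fin 3) (y : Fin 3 → ℝ) (s : ℝ) :
    HasDerivAt (fun r => φ (shift i r (toTorus y)))
      (fderiv ℝ (φ ∘ toTorus) (y + s • Pi.single i 1) (Pi.single i 1)) s := by
  have h1 : Differentiable ℝ (φ ∘ toTorus) := ContDiff.differentiable h (by simp)
  have h2 : HasDerivAt (fun r : ℝ => y + r • (Pi.single i 1 : Fin 3 → ℝ)) (Pi.single i 1) s := by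
    simpa using ((hasDerivAt_id s).smul_const (Pi.single i 1 : Fin 3 → ℝ)).const_add y
  have h3 := (h1 (y + s • Pi.single i 1)).hasFDerivAt.comp_hasDerivAt s h2
  refine h3.congr_of_eventuallyEq (Eventually.of_forall fun r => ?_)
  simp [shift_toTorus]

lemma IsTest.classicalPartial_toTorus {φ : Torus → ℝ} (h : IsTest φ) (i : Fin 3)
    (y : Fin 3 → ℝ) :
    classicalPartial i φ (toTorus y) = fderiv ℝ (φ ∘ toTorus) y (Pi.single i 1) := by
  have := (h.hasDerivAt_toTorus i y 0).deriv
  simp only [zero_smul, add_zero] at this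
  exact this

lemma IsTest.continuous_classicalPartial {φ : Torus → ℝ} (h : IsTest φ) (i : Fin 3) :
    Continuous (classicalPartial i φ) := by
  rw [isOpenQuotientMap_toTorus.isQuotientMap.continuous_iff]
  have : classicalPartial i φ ∘ toTorus
      = fun y => fderiv ℝ (φ ∘ toTorus) y (Pi.single i 1) := by
    ext y; exact h.classicalPartial_toTorus i y
  rw [this]
  exact (ContDiff.continuous_fderiv h (by simp)).clm_apply continuous_const

lemma IsTest.hasDerivAt {φ : Torus → ℝ} (h : IsTest φ) (i : Fin 3) (x : Torus) (s : ℝ) :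
    HasDerivAt (fun r => φ (shift i r x)) (classicalPartial i φ (shift i s x)) s := by
  obtain ⟨y, rfl⟩ := toTorus_surjective x
  rw [shift_toTorus, h.classicalPartial_toTorus]
  exact h.hasDerivAt_toTorus i y s

lemma contDiff_mFourier (n : Fin 3 → ℤ) :
    ContDiff ℝ ∞ fun y : Fin 3 → ℝ => UnitAddTorus.mFourier (d := Fin 3) n (toTorus y) := by
  have h' : ∀ y : Torus, UnitAddTorus.mFourier (d := Fin 3) n y = ∏ j, fourier (n j) (y j) :=
    fun y => rfl
  simp only [h', toTorus, fourier_coe_apply]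
  refine contDiff_prod fun j _ => ?_
  have : ContDiff ℝ ∞ fun y : Fin 3 → ℝ => ((y j : ℝ) : ℂ) :=
    Complex.ofRealCLM.contDiff.comp (contDiff_apply ℝ ℝ j)
  refine ContDiff.cexp ?_
  exact (contDiff_const.mul this).div_const _

lemma isTest_re_mFourier (n : Fin 3 → ℤ) :
    IsTest fun x => (UnitAddTorus.mFourier (d := Fin 3) n x).re :=
  Complex.reCLM.contDiff.comp (contDiff_mFourier n)

lemma isTest_im_mFourier (n : Fin 3 → ℤ) :
    IsTest fun x => (UnitAddTorus.mFourier (d := Fin 3) n x).im :=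
  Complex.imCLM.contDiff.comp (contDiff_mFourier n)

/-! ### Weak derivatives and absolute continuity on lines -/

/-- `f` is, on almost every line in the `i`-th direction, almost everywhere equal to an absolutely
continuous function with derivative `g`. Segments of length two are used, so that the periodicity
of `f` passes to the absolutely continuous representative. -/
def LineDeriv (i : Fin 3) (f g : Torus → ℝ) : Prop :=
  ∀ᵐ x : Torus, ∃ φ : ℝ → ℝ, IsPrim 2 φ (fun s => g (shift i s x)) ∧
    ∀ᵐ s ∂(volume.restrict (Icc (0 : ℝ) 2)), f (shift i s x) = φ s

/-- For an integrable `g`, almost every line restriction is integrable. -/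
lemma ae_integrable_line {g : Torus → ℝ} (hg : Integrable g) (i : Fin 3) (μ : Measure ℝ)
    [IsFiniteMeasure μ] : ∀ᵐ x : Torus, Integrable (fun s => g (shift i s x)) μ :=
  (integrable_comp_shift hg i μ).prod_left_ae

/-- The mean over the torus of the integrals along lines. -/
lemma integral_line_average {g : Torus → ℝ} (hg : Integrable g) (i : Fin 3) :
    ∫ x : Torus, ∫ s in (0 : ℝ)..1, g (shift i s x) = ∫ x, g x := by
  rw [← intervalIntegral_integral_swap]
  · simp [integral_shift]
  · rw [uIoc_of_le zero_le_one]
    exact integrable_comp_shift hg i _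

lemma LineDeriv.integral_eq_zero {i : Fin 3} {f g : Torus → ℝ} (h : LineDeriv i f g)
    (hg : Integrable g) : ∫ x, g x = 0 := by
  rw [← integral_line_average hg i]
  refine integral_eq_zero_of_ae ?_
  filter_upwards [h] with x ⟨φ, hφ, hfφ⟩
  have hc := hφ.continuousOn zero_le_two
  -- the continuous representative inherits the period of `f`
  have hper : EqOn (fun s => φ s) (fun s => φ (s + 1)) (Icc 0 1) := by
    have hc1 : ContinuousOn (fun s : ℝ => φ (s + 1)) (Icc 0 1) :=
      hc.comp (by fun_prop) fun s hs => ⟨by linarith [hs.1], by linarith [hs.2]⟩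
    refine Measure.eqOn_Icc_of_ae_eq volume zero_ne_one ?_
      (hc.mono (Icc_subset_Icc_right (by norm_num))) hc1
    rw [ae_restrict_iff' measurableSet_Icc] at hfφ
    have h1 : ∀ᵐ s : ℝ, s + 1 ∈ Icc (0 : ℝ) 2 → f (shift i (s + 1) x) = φ (s + 1) :=
      (measurePreserving_add_right volume (1 : ℝ)).quasiMeasurePreserving.ae hfφ
    rw [EventuallyEq, ae_restrict_iff' measurableSet_Icc]
    filter_upwards [hfφ, h1] with s hs hs1 hs01
    rw [← hs ⟨hs01.1, by linarith [hs01.2]⟩, ← hs1 ⟨by linarith [hs01.1], by linarith [hs01.2]⟩,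
      ← shift_shift, shift_one]
  have h0 := hper (left_mem_Icc.2 zero_le_one)
  have h1 := hφ.2 1 ⟨zero_le_one, one_le_two⟩
  simp only [zero_add] at h0
  simp only [Pi.zero_apply]
  linarith

lemma LineDeriv.mul {i : Fin 3} {f g f' g' : Torus → ℝ} (hf : LineDeriv i f f')
    (hg : LineDeriv i g g') :
    LineDeriv i (fun x => f x * g x) (fun x => f' x * g x + f x * g' x) := by
  filter_upwards [hf, hg] with x ⟨φ, hφ, hfφ⟩ ⟨ψ, hψ, hgψ⟩
  refine ⟨fun s => φ s * ψ s, (hφ.mul zero_le_two hψ).congr_deriv zero_le_two ?_, ?_⟩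
  · filter_upwards [hfφ, hgψ] with s h1 h2
    rw [h1, h2]
  · filter_upwards [hfφ, hgψ] with s h1 h2
    rw [h1, h2]

lemma LineDeriv.add {i : Fin 3} {f g f' g' : Torus → ℝ} (hf : LineDeriv i f f')
    (hg : LineDeriv i g g') : LineDeriv i (fun x => f x + g x) (fun x => f' x + g' x) := by
  filter_upwards [hf, hg] with x ⟨φ, hφ, hfφ⟩ ⟨ψ, hψ, hgψ⟩
  refine ⟨fun s => φ s + ψ s, hφ.add zero_le_two hψ, ?_⟩
  filter_upwards [hfφ, hgψ] with s h1 h2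
  rw [h1, h2]

/-- A continuous function is absolutely continuous itself on almost every line. -/
lemma LineDeriv.isPrim_line {i : Fin 3} {f g : Torus → ℝ} (hf : LineDeriv i f g)
    (hc : Continuous f) :
    ∀ᵐ x : Torus, IsPrim 2 (fun s => f (shift i s x)) (fun s => g (shift i s x)) := by
  filter_upwards [hf] with x ⟨φ, hφ, hfφ⟩
  have h : EqOn (fun s => f (shift i s x)) φ (Icc 0 2) :=
    Measure.eqOn_Icc_of_ae_eq volume (by norm_num) hfφ
      (hc.comp (continuous_shift_left i x)).continuousOn (hφ.continuousOn zero_le_two)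
  refine ⟨hφ.1, fun t ht => ?_⟩
  have h0 := h (left_mem_Icc.2 zero_le_two)
  have h1 := h ht
  simp only at h0 h1 ⊢
  rw [h0, h1, hφ.2 t ht]

lemma lineDeriv_of_isPrim {i : Fin 3} {f g : Torus → ℝ}
    (h : ∀ᵐ x : Torus, IsPrim 2 (fun s => f (shift i s x)) (fun s => g (shift i s x))) :
    LineDeriv i f g := by
  filter_upwards [h] with x hx
  exact ⟨_, hx, Eventually.of_forall fun _ => rfl⟩

lemma LineDeriv.comp {i : Fin 3} {f f' : Torus → ℝ} {F F' : ℝ → ℝ} {U : Set ℝ}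
    (hf : LineDeriv i f f') (hc : Continuous f) (hU : ∀ x, f x ∈ U)
    (hF : ∀ y ∈ U, HasDerivAt F (F' y) y) (hF' : ContinuousOn F' U) :
    LineDeriv i (fun x => F (f x)) (fun x => F' (f x) * f' x) := by
  refine lineDeriv_of_isPrim ?_
  filter_upwards [hf.isPrim_line hc] with x hx
  exact hx.comp zero_le_two (fun s _ => hU _) hF hF'

lemma lineDeriv_of_hasDerivAt {i : Fin 3} {f f' : Torus → ℝ}
    (h : ∀ x s, HasDerivAt (fun r => f (shift i r x)) (f' (shift i s x)) s) (hc : Continuous f') :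
    LineDeriv i f f' :=
  lineDeriv_of_isPrim <| Eventually.of_forall fun x =>
    isPrim_of_hasDerivAt zero_le_two (fun s _ => h x s)
      (hc.comp (continuous_shift_left i x)).continuousOn

lemma lineDeriv_const (i : Fin 3) (c : ℝ) : LineDeriv i (fun _ => c) (fun _ => 0) :=
  lineDeriv_of_hasDerivAt (fun _ s => hasDerivAt_const s c) continuous_const

lemma LineDeriv.congr {i : Fin 3} {f f' g : Torus → ℝ} (hf : LineDeriv i f f') (h : f' = g) :
    LineDeriv i f g := h ▸ hf

lemma IsTest.lineDeriv {φ : Torus → ℝ} (h : IsTest φ) (i : Fin 3) :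
    LineDeriv i φ (classicalPartial i φ) :=
  lineDeriv_of_hasDerivAt (fun x s => h.hasDerivAt i x s) (h.continuous_classicalPartial i)

/-- Integration by parts for functions that are absolutely continuous on lines. -/
lemma LineDeriv.integral_mul {i : Fin 3} {f g f' g' : Torus → ℝ} (hf : LineDeriv i f f')
    (hg : LineDeriv i g g') (h1 : Integrable fun x => f' x * g x)
    (h2 : Integrable fun x => f x * g' x) : ∫ x, f' x * g x = - ∫ x, f x * g' x := by
  have := (hf.mul hg).integral_eq_zero (h1.add h2)
  rw [integral_add h1 h2] at this
  linarith

lemma integrable_mul_continuous {f g : Torus → ℝ} (hf : Integrable f) (hg : Continuous g) :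
    Integrable fun x => f x * g x := by
  obtain ⟨c, hc⟩ := isCompact_univ.exists_bound_of_continuousOn hg.continuousOn
  exact hf.mul_bdd hg.aestronglyMeasurable (Eventually.of_forall fun x => hc x (mem_univ x))

lemma LineDeriv.hasWeakPartial {i : Fin 3} {f g : Torus → ℝ} (h : LineDeriv i f g)
    (hf : Integrable f) (hg : Integrable g) : HasWeakPartial i f g := by
  refine ⟨hf, hg, fun φ hφ => ?_⟩
  rw [h.integral_mul (hφ.lineDeriv i) (integrable_mul_continuous hg hφ.continuous)
    (integrable_mul_continuous hf (hφ.continuous_classicalPartial i)), neg_neg]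

/-- Uniqueness of weak derivatives, by testing with the Fourier modes. -/
lemma HasWeakPartial.unique {i : Fin 3} {f g g' : Torus → ℝ} (h : HasWeakPartial i f g)
    (h' : HasWeakPartial i f g') : g =ᵐ[volume] g' := by
  have key : ∀ φ, IsTest φ → ∫ x, (g x - g' x) * φ x = 0 := fun φ hφ => by
    simp only [sub_mul]
    rw [integral_sub (integrable_mul_continuous h.2.1 hφ.continuous)
      (integrable_mul_continuous h'.2.1 hφ.continuous)]
    have h1 := h.2.2 φ hφ
    have h2 := h'.2.2 φ hφ
    linarith
  have hi : Integrable fun x => g x - g' x := h.2.1.sub h'.2.1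
  have := ae_eq_zero_of_mFourier hi fun n => by
    have hint : Integrable fun x =>
        ((g x - g' x : ℝ) : ℂ) * UnitAddTorus.mFourier (d := Fin 3) n x := by
      refine hi.ofReal.mul_bdd (c := 1)
        (UnitAddTorus.mFourier (d := Fin 3) n).continuous.aestronglyMeasurable ?_
      refine Eventually.of_forall fun x => ?_
      exact ((UnitAddTorus.mFourier (d := Fin 3) n).norm_coe_le_norm x).trans
        UnitAddTorus.mFourier_norm.le
    have hre := key _ (isTest_re_mFourier n)
    have him := key _ (isTest_im_mFourier n)
    rw [← integral_re_add_im hint]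
    simp only [RCLike.re_to_complex, RCLike.im_to_complex, Complex.re_ofReal_mul,
      Complex.im_ofReal_mul]
    rw [hre, him]; simp
  filter_upwards [this] with x hx
  exact sub_eq_zero.1 hx

lemma HasWeakPartial.weakPartial_ae_eq {i : Fin 3} {f g : Torus → ℝ} (h : HasWeakPartial i f g) :
    weakPartial i f =ᵐ[volume] g := by
  have hex : ∃ g, HasWeakPartial i f g := ⟨g, h⟩
  rw [weakPartial, dif_pos hex]
  exact hex.choose_spec.unique h

lemma HasWeakPartial.integral_mFourier {i : Fin 3} {f g : Torus → ℝ} (h : HasWeakPartial i f g)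
    (n : Fin 3 → ℤ) :
    ∫ x, (g x : ℂ) * UnitAddTorus.mFourier (d := Fin 3) n x
      = -(2 * Real.pi * Complex.I * n i) *
        ∫ x, (f x : ℂ) * UnitAddTorus.mFourier (d := Fin 3) n x := by
  set e := UnitAddTorus.mFourier (d := Fin 3) n with he
  set w : ℂ := 2 * Real.pi * Complex.I * n i with hw
  have hd : ∀ x, HasDerivAt (fun s : ℝ => e (shift i s x)) (w * e x) 0 := fun x => by
    have h1 : HasDerivAt (fun s : ℝ => w * (s : ℂ)) w 0 := by
      simpa using (Complex.ofRealCLM.hasDerivAt (x := (0 : ℝ))).const_mul w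
    have h2 := (h1.cexp).const_mul (e x)
    simp only [Complex.ofReal_zero, mul_zero, Complex.exp_zero, one_mul] at h2
    rw [mul_comm] at h2
    refine h2.congr_of_eventuallyEq (Eventually.of_forall fun s => ?_)
    exact mFourier_shift n i s x
  have hre : ∀ x, classicalPartial i (fun x => (e x).re) x = (w * e x).re := fun x => by
    exact (Complex.reCLM.hasFDerivAt.comp_hasDerivAt (0 : ℝ) (hd x)).deriv
  have him : ∀ x, classicalPartial i (fun x => (e x).im) x = (w * e x).im := fun x => by
    exact (Complex.imCLM.hasFDerivAt.comp_hasDerivAt (0 : ℝ) (hd x)).deriv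
  have hint : ∀ k : Torus → ℝ, Integrable k → ∀ c : ℂ,
      Integrable fun x => (k x : ℂ) * (c * e x) := by
    intro k hk c
    refine hk.ofReal.mul_bdd (c := ‖c‖)
      (continuous_const.mul e.continuous).aestronglyMeasurable ?_
    refine Eventually.of_forall fun x => ?_
    rw [norm_mul]
    refine mul_le_of_le_one_right (norm_nonneg _) ?_
    exact (e.norm_coe_le_norm x).trans UnitAddTorus.mFourier_norm.le
  have key : ∫ x, (f x : ℂ) * (w * e x) = - ∫ x, (g x : ℂ) * (1 * e x) := by
    rw [← integral_re_add_im (hint f h.1 w), ← integral_re_add_im (hint g h.2.1 1)]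
    simp only [RCLike.re_to_complex, RCLike.im_to_complex, Complex.re_ofReal_mul,
      Complex.im_ofReal_mul, ← hre, ← him, one_mul]
    rw [h.2.2 _ (isTest_re_mFourier n), h.2.2 _ (isTest_im_mFourier n)]
    push_cast
    ring
  have h3 : ∫ x, (f x : ℂ) * (w * e x) = w * ∫ x, (f x : ℂ) * e x := by
    rw [← integral_const_mul]
    congr 1; ext x; ring
  rw [h3] at key
  simp only [one_mul] at key
  rw [neg_mul, key, neg_neg]

/-- A weak derivative integrates, along almost every translation, to the increment: the two sides
have the same Fourier coefficients. -/
lemma HasWeakPartial.ae_shift_sub_eq {i : Fin 3} {f g : Torus → ℝ} (h : HasWeakPartial i f g)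
    {t : ℝ} (ht : 0 ≤ t) :
    ∀ᵐ x : Torus, f (shift i t x) - f x = ∫ s in (0 : ℝ)..t, g (shift i s x) := by
  have hft : Integrable fun x => f (shift i t x) :=
    (measurePreserving_shift i t).integrable_comp_of_integrable h.1
  have hgs : ∀ s, Integrable fun x => g (shift i s x) := fun s =>
    (measurePreserving_shift i s).integrable_comp_of_integrable h.2.1
  have hgp : Integrable (Function.uncurry fun (s : ℝ) x => g (shift i s x))
      ((volume.restrict (uIoc 0 t)).prod volume) := by
    rw [uIoc_of_le ht]; exact integrable_comp_shift h.2.1 i _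
  have hG : Integrable fun x => ∫ s in (0 : ℝ)..t, g (shift i s x) := by
    simp only [intervalIntegral.integral_of_le ht]
    rw [uIoc_of_le ht] at hgp
    exact hgp.integral_prod_right
  have key := ae_eq_zero_of_mFourier ((hft.sub h.1).sub hG) fun n => by
    set e := UnitAddTorus.mFourier (d := Fin 3) n with he
    set w : ℂ := 2 * Real.pi * Complex.I * n i with hw
    have hb : ∀ x, ‖e x‖ ≤ 1 := fun x =>
      (e.norm_coe_le_norm x).trans UnitAddTorus.mFourier_norm.le
    have hint : ∀ k : Torus → ℝ, Integrable k → Integrable fun x => (k x : ℂ) * e x :=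
      fun k hk => hk.ofReal.mul_bdd e.continuous.aestronglyMeasurable (Eventually.of_forall hb)
    -- the effect of a translation on a Fourier coefficient
    have hshift : ∀ (k : Torus → ℝ) (s : ℝ), ∫ x, (k (shift i s x) : ℂ) * e x
        = Complex.exp (-(w * s)) * ∫ x, (k x : ℂ) * e x := fun k s => by
      rw [← integral_const_mul, ← integral_shift i s fun x =>
        Complex.exp (-(w * s)) * ((k x : ℂ) * e x)]
      congr 1; ext x
      rw [he, mFourier_shift, ← hw]
      have : Complex.exp (-(w * s)) * Complex.exp (w * s) = 1 := by
        rw [← Complex.exp_add]; simp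
      linear_combination -(k (shift i s x) : ℂ) * UnitAddTorus.mFourier (d := Fin 3) n x * this
    have hGF : ∫ x, ((∫ s in (0 : ℝ)..t, g (shift i s x) : ℝ) : ℂ) * e x
        = ∫ s in (0 : ℝ)..t, Complex.exp (-(w * s)) * ∫ x, (g x : ℂ) * e x := by
      simp_rw [← hshift g]
      rw [intervalIntegral_integral_swap]
      · congr 1; ext x
        rw [← intervalIntegral.integral_ofReal, ← intervalIntegral.integral_mul_const]
      · exact hgp.ofReal.mul_bdd (c := 1) (g := fun p : ℝ × Torus => e p.2)
          (e.continuous.comp continuous_snd).aestronglyMeasurable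
          (Eventually.of_forall fun p => hb p.2)
    have hexp : ∀ s : ℝ, HasDerivAt (fun s : ℝ => Complex.exp (-(w * s)))
        (Complex.exp (-(w * s)) * -w) s := fun s => by
      have h1 : HasDerivAt (fun s : ℝ => -(w * (s : ℂ))) (-w) s := by
        have := ((Complex.ofRealCLM.hasDerivAt (x := s)).const_mul w).neg
        simp only [Complex.ofRealCLM_apply, Complex.ofReal_one, mul_one] at this
        exact this
      exact h1.cexp
    have hftc : ∫ s in (0 : ℝ)..t, Complex.exp (-(w * s)) * -w = Complex.exp (-(w * t)) - 1 := by
      rw [intervalIntegral.integral_eq_sub_of_hasDerivAt (fun s _ => hexp s)]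
      · simp
      · exact Continuous.intervalIntegrable (by fun_prop) _ _
    have hsplit : ∀ x,
        (((f (shift i t x) - f x) - ∫ s in (0 : ℝ)..t, g (shift i s x) : ℝ) : ℂ) * e x
        = ((f (shift i t x) : ℂ) * e x - (f x : ℂ) * e x)
          - ((∫ s in (0 : ℝ)..t, g (shift i s x) : ℝ) : ℂ) * e x := fun x => by
      push_cast; ring
    simp only [Pi.sub_apply]
    simp_rw [hsplit]
    have h1 := hint _ hft
    have h2 := hint _ h.1
    have h3 := hint _ hG
    have h12 : Integrable fun x => (f (shift i t x) : ℂ) * e x - (f x : ℂ) * e x := h1.sub h2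
    rw [integral_sub h12 h3, integral_sub h1 h2, hshift, hGF,
      h.integral_mFourier n, ← hw, ← he]
    have : ∀ s : ℝ, Complex.exp (-(w * s)) * (-w * ∫ x, (f x : ℂ) * e x)
        = (Complex.exp (-(w * s)) * -w) * ∫ x, (f x : ℂ) * e x := fun s => by ring
    simp_rw [this]
    rw [intervalIntegral.integral_mul_const, hftc]
    ring
  filter_upwards [key] with x hx
  exact sub_eq_zero.1 hx

/-- The classical characterisation of weak differentiability by absolute continuity on lines. -/
lemma HasWeakPartial.lineDeriv {i : Fin 3} {f g : Torus → ℝ} (h : HasWeakPartial i f g) :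
    LineDeriv i f g := by
  set μ : Measure ℝ := volume.restrict (Icc (0 : ℝ) 2) with hμ
  have hgp := integrable_comp_shift h.2.1 i μ
  have hfp := integrable_comp_shift h.1 i μ
  -- the relation holds for almost every `x` at each length `s`, hence for almost every `s` on
  -- almost every line
  have hm2 : AEStronglyMeasurable
      (fun p : ℝ × Torus => ∫ r in (0 : ℝ)..p.1, g (shift i r p.2)) (μ.prod volume) := by
    have h1 : AEStronglyMeasurable
        (fun z : (ℝ × Torus) × ℝ => {z : (ℝ × Torus) × ℝ | z.2 ∈ Ioc 0 z.1.1}.indicator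
          (fun z => g (shift i z.2 z.1.2)) z) ((μ.prod volume).prod μ) := by
      refine AEStronglyMeasurable.indicator ?_ ?_
      · have hq : Measure.QuasiMeasurePreserving
            (fun z : (ℝ × Torus) × ℝ => (z.2, z.1.2)) ((μ.prod volume).prod μ) (μ.prod volume) := by
          have ha :=
            (measurePreserving_prodAssoc μ (volume : Measure Torus) μ).quasiMeasurePreserving
          exact (Measure.measurePreserving_swap.quasiMeasurePreserving.comp
            Measure.quasiMeasurePreserving_snd).comp ha
        exact hgp.aestronglyMeasurable.comp_quasiMeasurePreserving hq
      · exact (measurableSet_lt measurable_const measurable_snd).inter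
          (measurableSet_le measurable_snd (measurable_fst.comp measurable_fst))
    refine h1.integral_prod_right'.congr ?_
    have h2 : ∀ᵐ s ∂μ, s ∈ Icc (0 : ℝ) 2 := ae_restrict_mem measurableSet_Icc
    filter_upwards [Measure.quasiMeasurePreserving_fst.ae h2] with p hp
    rw [intervalIntegral.integral_of_le hp.1, hμ]
    rw [← integral_indicator measurableSet_Ioc, ← integral_indicator measurableSet_Icc]
    congr 1; ext r
    simp only [indicator_apply, mem_ofPred_eq]
    by_cases hr : r ∈ Ioc 0 p.1
    · simp [hr, (show r ∈ Icc (0 : ℝ) 2 from ⟨hr.1.le, hr.2.trans hp.2⟩)]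
    · simp [hr]
  have hm1 : AEStronglyMeasurable (fun p : ℝ × Torus => f (shift i p.1 p.2) - f p.2)
      (μ.prod volume) :=
    hfp.aestronglyMeasurable.sub (h.1.comp_snd μ).aestronglyMeasurable
  have hm12 : AEStronglyMeasurable (fun p : ℝ × Torus => (f (shift i p.1 p.2) - f p.2)
      - ∫ r in (0 : ℝ)..p.1, g (shift i r p.2)) (μ.prod volume) := hm1.sub hm2
  have hae : ∀ᵐ p ∂(μ.prod (volume : Measure Torus)),
      f (shift i p.1 p.2) - f p.2 = ∫ r in (0 : ℝ)..p.1, g (shift i r p.2) := by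
    have h0 : ∫⁻ p, ‖(f (shift i p.1 p.2) - f p.2) - ∫ r in (0 : ℝ)..p.1, g (shift i r p.2)‖ₑ
        ∂(μ.prod (volume : Measure Torus)) = 0 := by
      rw [lintegral_prod _ hm12.enorm]
      rw [lintegral_eq_zero_iff' hm12.enorm.lintegral_prod_right']
      filter_upwards [ae_restrict_mem measurableSet_Icc] with s hs
      refine lintegral_eq_zero_of_ae_eq_zero ?_
      filter_upwards [h.ae_shift_sub_eq hs.1] with x hx
      simp [hx]
    rw [lintegral_eq_zero_iff' hm12.enorm] at h0
    filter_upwards [h0] with p hp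
    simpa [sub_eq_zero] using hp
  have hae' := Measure.ae_ae_of_ae_prod
    ((Measure.measurePreserving_swap (μ := (volume : Measure Torus))
      (ν := μ)).quasiMeasurePreserving.ae hae)
  filter_upwards [hae', ae_integrable_line h.2.1 i μ] with x hx hxi
  have hgi : IntervalIntegrable (fun s => g (shift i s x)) volume 0 2 := by
    rw [intervalIntegrable_iff_integrableOn_Icc_of_le zero_le_two]; exact hxi
  refine ⟨fun s => f x + ∫ r in (0 : ℝ)..s, g (shift i r x), ⟨hgi, fun t _ => by simp⟩, ?_⟩
  filter_upwards [hx] with s hs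
  simp only [Prod.fst_swap, Prod.snd_swap] at hs
  linarith

section

/-! ### The equations at a fixed time, tested with functions of low regularity -/

lemma continuous_memLp {f : Torus → ℝ} (hf : Continuous f) (p : ℝ≥0∞) :
    MemLp f p (volume : Measure Torus) := by
  obtain ⟨c, hc⟩ := isCompact_univ.exists_bound_of_continuousOn hf.continuousOn
  exact MemLp.of_bound hf.aestronglyMeasurable c (Eventually.of_forall fun x => hc x (mem_univ x))

lemma continuous_integrable {f : Torus → ℝ} (hf : Continuous f) :
    Integrable f (volume : Measure Torus) :=
  memLp_one_iff_integrable.1 (continuous_memLp hf 1)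

lemma MemLp.mul_continuous {f g : Torus → ℝ} (hf : MemLp f 2 volume) (hg : Continuous g) :
    MemLp (fun x => f x * g x) 2 volume := by
  obtain ⟨c, hc⟩ := isCompact_univ.exists_bound_of_continuousOn hg.continuousOn
  refine MemLp.of_le_mul (c := c) hf (hf.1.mul hg.aestronglyMeasurable)
    (Eventually.of_forall fun x => ?_)
  rw [norm_mul, mul_comm]
  exact mul_le_mul_of_nonneg_right (hc x (mem_univ x)) (norm_nonneg _)

lemma MemLp.continuous_mul {f g : Torus → ℝ} (hf : MemLp f 2 volume) (hg : Continuous g) :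
    MemLp (fun x => g x * f x) 2 volume := by
  simpa only [mul_comm] using NSK.MemLp.mul_continuous hf hg

lemma integrable_mul_of_memLp_two {f g : Torus → ℝ} (hf : MemLp f 2 volume)
    (hg : MemLp g 2 volume) :
    Integrable (fun x => f x * g x) volume :=
  MemLp.integrable_mul hf hg

lemma integrable_continuous_mul {f g : Torus → ℝ} (hg : Continuous g) (hf : Integrable f) :
    Integrable fun x => g x * f x := by
  simpa only [mul_comm] using integrable_mul_continuous hf hg

lemma memLp_two_integrable {f : Torus → ℝ} (hf : MemLp f 2 volume) : Integrable f volume :=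
  hf.integrable one_le_two

lemma HasWeakPartial.congr_left {i : Fin 3} {f f' g : Torus → ℝ} (h : HasWeakPartial i f g)
    (hf : f =ᵐ[volume] f') : HasWeakPartial i f' g := by
  refine ⟨h.1.congr hf, h.2.1, fun φ hφ => ?_⟩
  rw [← h.2.2 φ hφ]
  refine integral_congr_ae ?_
  filter_upwards [hf] with x hx
  rw [hx]

/-- The state of the fluid at a fixed time: `ϱ > 0` and `v` are continuous, `a i = ∂ᵢ ϱ` and
`b i j = ∂ᵢ vⱼ` are square integrable, and `∂ᵢ aᵢ`, `∂ᵢ bᵢⱼ` exist. -/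
structure State (ϱ : Torus → ℝ) (v : Torus → Vec) (a : Fin 3 → Torus → ℝ)
    (b : Fin 3 → Fin 3 → Torus → ℝ) : Prop where
  cont : Continuous ϱ
  pos : ∀ x, 0 < ϱ x
  contv : Continuous v
  da : ∀ i, HasWeakPartial i ϱ (a i)
  a2 : ∀ i, MemLp (a i) 2 volume
  daa : ∀ i, ∃ g, HasWeakPartial i (a i) g
  db : ∀ i j, HasWeakPartial i (fun x => v x j) (b i j)
  b2 : ∀ i j, MemLp (b i j) 2 volume
  dbb : ∀ i j, ∃ g, MemLp g 2 volume ∧ HasWeakPartial i (b i j) g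

variable {ϱ : Torus → ℝ} {v : Torus → Vec} {a : Fin 3 → Torus → ℝ}
  {b : Fin 3 → Fin 3 → Torus → ℝ}

lemma State.contv_apply (h : State ϱ v a b) (j : Fin 3) : Continuous fun x => v x j :=
  (EuclideanSpace.proj (𝕜 := ℝ) j).continuous.comp h.contv

lemma State.cont_comp (h : State ϱ v a b) {F : ℝ → ℝ} (hF : ContinuousOn F (Ioi 0)) :
    Continuous fun x => F (ϱ x) :=
  hF.comp_continuous h.cont fun x => h.pos x

/-- The mass equation at a fixed time. -/
def MassAt (ϱ ϱt : Torus → ℝ) (v : Torus → Vec) : Prop :=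
  ∀ᵐ x : Torus, ϱt x + ∑ i, weakPartial i (fun y => ϱ y * v y i) x
      - ∑ i, weakPartial i (weakPartial i ϱ) x = 0

/-- The momentum equation at a fixed time. -/
def MomentumAt (γ : ℝ) (ϱ : Torus → ℝ) (v vt : Torus → Vec) : Prop :=
  ∀ᵐ x : Torus, ∀ j : Fin 3, ϱ x * vt x j
      + ϱ x * ∑ i, (v x i - weakPartial i (fun y => Real.log (ϱ y)) x)
          * weakPartial i (fun y => v y j) x
      + weakPartial j (fun y => ϱ y ^ γ) x
    = ∑ i, weakPartial i (fun y => ϱ y * weakPartial i (fun z => v z j) y) x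

lemma State.lineDeriv_comp (h : State ϱ v a b) (i : Fin 3) {F F' : ℝ → ℝ}
    (hF : ∀ y ∈ Ioi (0 : ℝ), HasDerivAt F (F' y) y) (hF' : ContinuousOn F' (Ioi 0)) :
    LineDeriv i (fun x => F (ϱ x)) (fun x => F' (ϱ x) * a i x) :=
  (h.da i).lineDeriv.comp h.cont h.pos hF hF'

lemma State.weakPartial_comp (h : State ϱ v a b) (i : Fin 3) {F F' : ℝ → ℝ}
    (hF : ∀ y ∈ Ioi (0 : ℝ), HasDerivAt F (F' y) y) (hF' : ContinuousOn F' (Ioi 0)) :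
    weakPartial i (fun x => F (ϱ x)) =ᵐ[volume] fun x => F' (ϱ x) * a i x := by
  refine ((h.lineDeriv_comp i hF hF').hasWeakPartial ?_ ?_).weakPartial_ae_eq
  · exact continuous_integrable (h.cont_comp fun y hy => (hF y hy).continuousAt.continuousWithinAt)
  · exact memLp_two_integrable (MemLp.continuous_mul (h.a2 i) (h.cont_comp hF'))

/-- The mass equation, tested with a function that need not be smooth. -/
lemma State.integral_mass (h : State ϱ v a b) {ϱt : Torus → ℝ} (hm : MassAt ϱ ϱt v)
    {ζ : Torus → ℝ} {z : Fin 3 → Torus → ℝ} (hζ : Continuous ζ) (hz : ∀ i, LineDeriv i ζ (z i))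
    (hz2 : ∀ i, MemLp (z i) 2 volume) :
    ∫ x, ϱt x * ζ x = ∫ x, ∑ i, (ϱ x * v x i - a i x) * z i x := by
  choose g hg using h.daa
  have hc : ∀ i, Continuous fun x => ϱ x * v x i := fun i => h.cont.mul (h.contv_apply i)
  have hD : ∀ i, LineDeriv i (fun x => ϱ x * v x i) (fun x => a i x * v x i + ϱ x * b i i x) :=
    fun i => (h.da i).lineDeriv.mul (h.db i i).lineDeriv
  have hDi : ∀ i, Integrable (fun x => a i x * v x i + ϱ x * b i i x) := fun i =>
    (memLp_two_integrable (MemLp.mul_continuous (h.a2 i) (h.contv_apply i))).add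
      (memLp_two_integrable (MemLp.continuous_mul (h.b2 i i) h.cont))
  have h1 : ∀ i, weakPartial i (fun y => ϱ y * v y i) =ᵐ[volume]
      fun x => a i x * v x i + ϱ x * b i i x := fun i =>
    ((hD i).hasWeakPartial (continuous_integrable (hc i)) (hDi i)).weakPartial_ae_eq
  have h2 : ∀ i, weakPartial i (weakPartial i ϱ) =ᵐ[volume] g i := fun i =>
    ((hg i).congr_left ((h.da i).weakPartial_ae_eq).symm).weakPartial_ae_eq
  have hi1 : ∀ i, Integrable fun x => (a i x * v x i + ϱ x * b i i x) * ζ x := fun i =>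
    integrable_mul_continuous (hDi i) hζ
  have hi2 : ∀ i, Integrable fun x => g i x * ζ x := fun i =>
    integrable_mul_continuous (hg i).2.1 hζ
  have hi3 : ∀ i, Integrable fun x => ϱ x * v x i * z i x := fun i =>
    memLp_two_integrable (MemLp.continuous_mul (hz2 i) (hc i))
  have hi4 : ∀ i, Integrable fun x => a i x * z i x := fun i =>
    integrable_mul_of_memLp_two (h.a2 i) (hz2 i)
  have key : ∀ i, ∫ x, (g i x * ζ x - (a i x * v x i + ϱ x * b i i x) * ζ x)
      = ∫ x, (ϱ x * v x i - a i x) * z i x := fun i => by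
    simp only [sub_mul]
    rw [integral_sub (hi2 i) (hi1 i), integral_sub (hi3 i) (hi4 i),
      (hD i).integral_mul (hz i) (hi1 i) (hi3 i),
      (hg i).lineDeriv.integral_mul (hz i) (hi2 i) (hi4 i)]
    ring
  have hi5 : ∀ i, Integrable fun x => g i x * ζ x - (a i x * v x i + ϱ x * b i i x) * ζ x :=
    fun i => (hi2 i).sub (hi1 i)
  have hi6 : ∀ i, Integrable fun x => (ϱ x * v x i - a i x) * z i x := fun i => by
    simp only [sub_mul]; exact (hi3 i).sub (hi4 i)
  rw [integral_finsetSum _ fun i _ => hi6 i, ← Finset.sum_congr rfl fun i _ => key i,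
    ← integral_finsetSum _ fun i _ => hi5 i]
  refine integral_congr_ae ?_
  filter_upwards [hm, ae_all_iff.2 h1, ae_all_iff.2 h2] with x hx hx1 hx2
  simp only [hx1, hx2] at hx
  simp only [← sub_mul, ← Finset.sum_mul, Finset.sum_sub_distrib]
  congr 1; linarith

/-- The `j`-th component of the momentum equation, tested with a function that need not be smooth.
The coefficient `ϱ (v - ∇ log ϱ)` becomes the flux `ϱ v - ∇ϱ` of the mass equation. -/
lemma State.integral_momentum (h : State ϱ v a b) {γ : ℝ} {vt : Torus → Vec}
    (hm : MomentumAt γ ϱ v vt) (j : Fin 3)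
    {ζ : Torus → ℝ} {z : Fin 3 → Torus → ℝ} (hζ : Continuous ζ) (hz : ∀ i, LineDeriv i ζ (z i))
    (hz2 : ∀ i, MemLp (z i) 2 volume) :
    ∫ x, ϱ x * vt x j * ζ x = ∫ x, (ϱ x ^ γ * z j x
      - ∑ i, (ϱ x * v x i - a i x) * (b i j x * ζ x) - ∑ i, ϱ x * b i j x * z i x) := by
  choose g hg2 hg using fun i => h.dbb i j
  have hrp : ∀ c : ℝ, ContinuousOn (fun y : ℝ => y ^ c) (Ioi 0) := fun c y hy =>
    (Real.continuousAt_rpow_const y c (Or.inl hy.ne')).continuousWithinAt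
  have hpow : ∀ y ∈ Ioi (0 : ℝ), HasDerivAt (fun y : ℝ => y ^ γ) (γ * y ^ (γ - 1)) y :=
    fun y hy => Real.hasDerivAt_rpow_const (Or.inl hy.ne')
  have hpow' : ContinuousOn (fun y : ℝ => γ * y ^ (γ - 1)) (Ioi 0) :=
    continuousOn_const.mul (hrp _)
  have hlog : ∀ i, weakPartial i (fun x => Real.log (ϱ x)) =ᵐ[volume]
      fun x => (ϱ x)⁻¹ * a i x := fun i =>
    h.weakPartial_comp i (F := Real.log) (F' := fun y => y⁻¹)
      (fun y hy => Real.hasDerivAt_log (ne_of_gt hy))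
      (continuousOn_inv₀.mono fun y hy => ne_of_gt hy)
  have hpr : weakPartial j (fun x => ϱ x ^ γ) =ᵐ[volume]
      fun x => γ * ϱ x ^ (γ - 1) * a j x := h.weakPartial_comp j hpow hpow'
  have hwb : ∀ i, weakPartial i (fun y => v y j) =ᵐ[volume] b i j := fun i =>
    (h.db i j).weakPartial_ae_eq
  have hD : ∀ i, LineDeriv i (fun x => ϱ x * b i j x) (fun x => a i x * b i j x + ϱ x * g i x) :=
    fun i => (h.da i).lineDeriv.mul (hg i).lineDeriv
  have hDi : ∀ i, Integrable (fun x => a i x * b i j x + ϱ x * g i x) := fun i =>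
    (integrable_mul_of_memLp_two (h.a2 i) (h.b2 i j)).add
      (memLp_two_integrable (MemLp.continuous_mul (hg2 i) h.cont))
  have hb2 : ∀ i, MemLp (fun x => ϱ x * b i j x) 2 volume := fun i =>
    MemLp.continuous_mul (h.b2 i j) h.cont
  have hvis : ∀ i, weakPartial i (fun y => ϱ y * weakPartial i (fun z => v z j) y) =ᵐ[volume]
      fun x => a i x * b i j x + ϱ x * g i x := fun i => by
    refine (((hD i).hasWeakPartial (memLp_two_integrable (hb2 i)) (hDi i)).congr_left
      ?_).weakPartial_ae_eq
    filter_upwards [hwb i] with x hx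
    rw [hx]
  have hc : ∀ i, Continuous fun x => ϱ x * v x i := fun i => h.cont.mul (h.contv_apply i)
  have hi1 : ∀ i, Integrable fun x => (a i x * b i j x + ϱ x * g i x) * ζ x := fun i =>
    integrable_mul_continuous (hDi i) hζ
  have hi2 : ∀ i, Integrable fun x => ϱ x * b i j x * z i x := fun i =>
    integrable_mul_of_memLp_two (hb2 i) (hz2 i)
  have hi3 : Integrable fun x => γ * ϱ x ^ (γ - 1) * a j x * ζ x :=
    integrable_mul_continuous (memLp_two_integrable
      (MemLp.continuous_mul (h.a2 j) (h.cont_comp hpow'))) hζ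
  have hi4 : Integrable fun x => ϱ x ^ γ * z j x :=
    memLp_two_integrable (MemLp.continuous_mul (hz2 j) (h.cont_comp (hrp γ)))
  have hi5 : ∀ i, Integrable fun x => (ϱ x * v x i - a i x) * (b i j x * ζ x) := fun i =>
    integrable_mul_of_memLp_two ((continuous_memLp (hc i) 2).sub (h.a2 i))
      (MemLp.mul_continuous (h.b2 i j) hζ)
  have hs1 : Integrable fun x => ∑ i, (a i x * b i j x + ϱ x * g i x) * ζ x :=
    integrable_finsetSum _ fun i _ => hi1 i
  have hs2 : Integrable fun x => ∑ i, ϱ x * b i j x * z i x :=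
    integrable_finsetSum _ fun i _ => hi2 i
  have hs5 : Integrable fun x => ∑ i, (ϱ x * v x i - a i x) * (b i j x * ζ x) :=
    integrable_finsetSum _ fun i _ => hi5 i
  have e1 : ∫ x, ∑ i, (a i x * b i j x + ϱ x * g i x) * ζ x
      = - ∫ x, ∑ i, ϱ x * b i j x * z i x := by
    rw [integral_finsetSum _ fun i _ => hi1 i, integral_finsetSum _ fun i _ => hi2 i,
      ← Finset.sum_neg_distrib]
    exact Finset.sum_congr rfl fun i _ => (hD i).integral_mul (hz i) (hi1 i) (hi2 i)
  have e2 : ∫ x, γ * ϱ x ^ (γ - 1) * a j x * ζ x = - ∫ x, ϱ x ^ γ * z j x :=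
    (h.lineDeriv_comp j hpow hpow').integral_mul (hz j) hi3 hi4
  have e3 : ∫ x, ϱ x * vt x j * ζ x = ∫ x, (∑ i, (a i x * b i j x + ϱ x * g i x) * ζ x
      - γ * ϱ x ^ (γ - 1) * a j x * ζ x - ∑ i, (ϱ x * v x i - a i x) * (b i j x * ζ x)) := by
    refine integral_congr_ae ?_
    filter_upwards [hm, ae_all_iff.2 hlog, hpr, ae_all_iff.2 hwb, ae_all_iff.2 hvis]
      with x hx hx1 hx2 hx3 hx4
    have hxj := hx j
    simp only [hx1, hx2, hx3, hx4] at hxj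
    have hne := (h.pos x).ne'
    have e : ϱ x * ∑ i, (v x i - (ϱ x)⁻¹ * a i x) * b i j x
        = ∑ i, (ϱ x * v x i - a i x) * b i j x := by
      rw [Finset.mul_sum]
      refine Finset.sum_congr rfl fun i _ => ?_
      field_simp
    rw [e] at hxj
    have e' : ∑ i, (ϱ x * v x i - a i x) * (b i j x * ζ x)
        = (∑ i, (ϱ x * v x i - a i x) * b i j x) * ζ x := by
      rw [Finset.sum_mul]
      exact Finset.sum_congr rfl fun i _ => by ring
    rw [e', ← Finset.sum_mul]
    linear_combination ζ x * hxj
  have h13 : Integrable fun x => ∑ i, (a i x * b i j x + ϱ x * g i x) * ζ x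
      - γ * ϱ x ^ (γ - 1) * a j x * ζ x := hs1.sub hi3
  have h45 : Integrable fun x => ϱ x ^ γ * z j x
      - ∑ i, (ϱ x * v x i - a i x) * (b i j x * ζ x) := hi4.sub hs5
  rw [e3, integral_sub h13 hs5, integral_sub hs1 hi3, integral_sub h45 hs2, integral_sub hi4 hs5,
    e1, e2]
  ring

/-- The rate of change of `∫ G(ϱ) ψ`, up to the term with the time derivative of `ψ`. The
diffusion terms that contain `∇ϱ · ∇ψ` cancel after a second integration by parts. -/
lemma State.integral_renormalized (h : State ϱ v a b) {ϱt : Torus → ℝ} (hm : MassAt ϱ ϱt v)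
    {G G' G'' : ℝ → ℝ} (hG : ∀ y ∈ Ioi (0 : ℝ), HasDerivAt G (G' y) y)
    (hG' : ∀ y ∈ Ioi (0 : ℝ), HasDerivAt G' (G'' y) y) (hG'' : ContinuousOn G'' (Ioi 0))
    {ψ : Torus → ℝ} {ψ₁ ψ₂ : Fin 3 → Torus → ℝ} (hψ : Continuous ψ)
    (hψ₁ : ∀ i, Continuous (ψ₁ i)) (hψ₂ : ∀ i, Continuous (ψ₂ i))
    (hd₁ : ∀ i, LineDeriv i ψ (ψ₁ i)) (hd₂ : ∀ i, LineDeriv i (ψ₁ i) (ψ₂ i)) :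
    ∫ x, ϱt x * (G' (ϱ x) * ψ x) = ∫ x, ∑ i, (G'' (ϱ x) * ψ x * (a i x * (ϱ x * v x i - a i x))
      + G' (ϱ x) * (ϱ x * v x i) * ψ₁ i x + G (ϱ x) * ψ₂ i x) := by
  have cG : ContinuousOn G (Ioi 0) := fun y hy => (hG y hy).continuousAt.continuousWithinAt
  have cG' : ContinuousOn G' (Ioi 0) := fun y hy => (hG' y hy).continuousAt.continuousWithinAt
  have hc : ∀ i, Continuous fun x => ϱ x * v x i := fun i => h.cont.mul (h.contv_apply i)
  have hz : ∀ i, LineDeriv i (fun x => G' (ϱ x) * ψ x)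
      (fun x => G'' (ϱ x) * a i x * ψ x + G' (ϱ x) * ψ₁ i x) := fun i =>
    (h.lineDeriv_comp i hG' hG'').mul (hd₁ i)
  have hz2 : ∀ i, MemLp (fun x => G'' (ϱ x) * a i x * ψ x + G' (ϱ x) * ψ₁ i x) 2 volume := fun i =>
    (MemLp.mul_continuous (MemLp.continuous_mul (h.a2 i) (h.cont_comp hG'')) hψ).add
      (continuous_memLp ((h.cont_comp cG').mul (hψ₁ i)) 2)
  have hcζ : Continuous fun x => G' (ϱ x) * ψ x := (h.cont_comp cG').mul hψ
  rw [h.integral_mass hm hcζ hz hz2]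
  have hw2 : ∀ i, MemLp (fun x => ϱ x * v x i - a i x) 2 volume := fun i =>
    (continuous_memLp (hc i) 2).sub (h.a2 i)
  have i1 : ∀ i, Integrable fun x => (ϱ x * v x i - a i x) *
      (G'' (ϱ x) * a i x * ψ x + G' (ϱ x) * ψ₁ i x) := fun i =>
    integrable_mul_of_memLp_two (hw2 i) (hz2 i)
  have i2 : ∀ i, Integrable fun x => G' (ϱ x) * a i x * ψ₁ i x := fun i =>
    memLp_two_integrable (MemLp.mul_continuous (MemLp.continuous_mul (h.a2 i) (h.cont_comp cG'))
      (hψ₁ i))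
  have i3 : ∀ i, Integrable fun x => G (ϱ x) * ψ₂ i x := fun i =>
    continuous_integrable ((h.cont_comp cG).mul (hψ₂ i))
  -- the identity `Σ ∫ (∂ᵢ G(ϱ) ψ₁ᵢ + G(ϱ) ψ₂ᵢ) = 0` exchanges the diffusion terms
  have ibp : ∀ i, ∫ x, (G' (ϱ x) * a i x * ψ₁ i x + G (ϱ x) * ψ₂ i x) = 0 := fun i => by
    rw [integral_add (i2 i) (i3 i),
      (h.lineDeriv_comp i hG cG').integral_mul (hd₂ i) (i2 i) (i3 i)]
    ring
  have i23 : ∀ i, Integrable fun x => G' (ϱ x) * a i x * ψ₁ i x + G (ϱ x) * ψ₂ i x := fun i =>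
    (i2 i).add (i3 i)
  have hsum : ∀ i, ∫ x, (ϱ x * v x i - a i x) *
      (G'' (ϱ x) * a i x * ψ x + G' (ϱ x) * ψ₁ i x) =
      ∫ x, (G'' (ϱ x) * ψ x * (a i x * (ϱ x * v x i - a i x))
      + G' (ϱ x) * (ϱ x * v x i) * ψ₁ i x + G (ϱ x) * ψ₂ i x) := fun i => by
    rw [← add_zero (∫ x, (ϱ x * v x i - a i x) * _), ← ibp i, ← integral_add (i1 i) (i23 i)]
    congr 1; ext x; ring
  have i4 : ∀ i, Integrable fun x => (G'' (ϱ x) * ψ x * (a i x * (ϱ x * v x i - a i x))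
      + G' (ϱ x) * (ϱ x * v x i) * ψ₁ i x + G (ϱ x) * ψ₂ i x) := fun i => by
    refine ((i1 i).add (i23 i)).congr (Eventually.of_forall fun x => ?_)
    simp only [Pi.add_apply]; ring
  rw [integral_finsetSum _ fun i _ => i1 i, integral_finsetSum _ fun i _ => i4 i]
  exact Finset.sum_congr rfl fun i _ => hsum i

end

/-! ### Moments of the velocity at a fixed time -/

section Moments

variable {ϱ : Torus → ℝ} {v : Torus → Vec} {a : Fin 3 → Torus → ℝ}
  {b : Fin 3 → Fin 3 → Torus → ℝ}

/-- The regularised square `δ + |v|²` of the speed. -/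
def sqSpeed (δ : ℝ) (v : Vec) : ℝ := δ + ∑ k, v k ^ 2

lemma sqSpeed_eq (δ : ℝ) (v : Vec) : sqSpeed δ v = δ + ‖v‖ ^ 2 := by
  simp [sqSpeed, EuclideanSpace.norm_sq_eq]

lemma le_sqSpeed (δ : ℝ) (v : Vec) : δ ≤ sqSpeed δ v := by
  rw [sqSpeed_eq]; nlinarith [sq_nonneg ‖v‖]

lemma continuous_sqSpeed (δ : ℝ) : Continuous (sqSpeed δ) := by
  simp only [funext (sqSpeed_eq δ)]; fun_prop

lemma continuous_sqSpeed_rpow {δ : ℝ} (hδ : 0 < δ) (c : ℝ) :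
    Continuous fun v : Vec => sqSpeed δ v ^ c :=
  (continuous_sqSpeed δ).rpow_const fun v => Or.inl (hδ.trans_le (le_sqSpeed δ v)).ne'

lemma hasDerivAt_rpow_of_pos (c : ℝ) : ∀ y ∈ Ioi (0 : ℝ),
    HasDerivAt (fun y : ℝ => y ^ c) (c * y ^ (c - 1)) y :=
  fun _ hy => Real.hasDerivAt_rpow_const (Or.inl (ne_of_gt hy))

lemma continuousOn_rpow_Ioi (c : ℝ) : ContinuousOn (fun y : ℝ => y ^ c) (Ioi 0) :=
  fun y hy => (Real.continuousAt_rpow_const y c (Or.inl (ne_of_gt hy))).continuousWithinAt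

lemma State.cont_sqSpeed (h : State ϱ v a b) (δ : ℝ) : Continuous fun x => sqSpeed δ (v x) :=
  (continuous_sqSpeed δ).comp h.contv

lemma State.cont_sqSpeed_rpow (h : State ϱ v a b) {δ : ℝ} (hδ : 0 < δ) (c : ℝ) :
    Continuous fun x => sqSpeed δ (v x) ^ c :=
  (continuous_sqSpeed_rpow hδ c).comp h.contv

lemma State.lineDeriv_sqSpeed (h : State ϱ v a b) (i : Fin 3) (δ : ℝ) :
    LineDeriv i (fun x => sqSpeed δ (v x)) (fun x => 2 * ∑ k, v x k * b i k x) := by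
  have hk : ∀ k, LineDeriv i (fun x => v x k * v x k)
      (fun x => b i k x * v x k + v x k * b i k x) := fun k =>
    (h.db i k).lineDeriv.mul (h.db i k).lineDeriv
  have := (lineDeriv_const i δ).add (((hk 0).add (hk 1)).add (hk 2))
  convert this using 2
  · simp only [sqSpeed, Fin.sum_univ_three]; ring
  · simp only [Fin.sum_univ_three]; ring

lemma State.lineDeriv_sqSpeed_rpow (h : State ϱ v a b) (i : Fin 3) {δ : ℝ} (hδ : 0 < δ) (c : ℝ) :
    LineDeriv i (fun x => sqSpeed δ (v x) ^ c)
      (fun x => c * sqSpeed δ (v x) ^ (c - 1) * (2 * ∑ k, v x k * b i k x)) :=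
  LineDeriv.comp (F := fun y => y ^ c) (F' := fun y => c * y ^ (c - 1)) (U := Ioi 0)
    (h.lineDeriv_sqSpeed i δ) (h.cont_sqSpeed δ)
    (fun x => hδ.trans_le (le_sqSpeed δ _)) (hasDerivAt_rpow_of_pos c)
    (continuousOn_const.mul (continuousOn_rpow_Ioi (c - 1)))

/-- The derivative in the `i`-th direction of the `j`-th component of the gradient of
`(δ + |v|²) ^ (m / 2)`. -/
def momentHess (m δ : ℝ) (v : Vec) (B : Fin 3 → Fin 3 → ℝ) (i j : Fin 3) : ℝ :=
  m * (B i j * sqSpeed δ v ^ (m / 2 - 1)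
    + v j * ((m / 2 - 1) * sqSpeed δ v ^ (m / 2 - 1 - 1) * (2 * ∑ k, v k * B i k)))

lemma State.memLp_dot (h : State ϱ v a b) (i : Fin 3) :
    MemLp (fun x => ∑ k, v x k * b i k x) 2 volume :=
  memLp_finsetSum _ fun k _ => MemLp.continuous_mul (h.b2 i k) (h.contv_apply k)

lemma State.memLp_momentHess (h : State ϱ v a b) (m : ℝ) {δ : ℝ} (hδ : 0 < δ) (i j : Fin 3) :
    MemLp (fun x => momentHess m δ (v x) (fun i j => b i j x) i j) 2 volume := by
  have hcw := h.cont_sqSpeed_rpow hδ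
  have h1 : MemLp (fun x => b i j x * sqSpeed δ (v x) ^ (m / 2 - 1)) 2 volume :=
    MemLp.mul_continuous (h.b2 i j) (hcw _)
  have hc : Continuous fun x => (m / 2 - 1) * sqSpeed δ (v x) ^ (m / 2 - 1 - 1) :=
    continuous_const.mul (hcw _)
  have h2 : MemLp (fun x => (m / 2 - 1) * sqSpeed δ (v x) ^ (m / 2 - 1 - 1) *
      (2 * ∑ k, v x k * b i k x)) 2 volume :=
    MemLp.continuous_mul ((h.memLp_dot i).const_mul 2) hc
  have h3 : MemLp (fun x => v x j * ((m / 2 - 1) * sqSpeed δ (v x) ^ (m / 2 - 1 - 1) *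
      (2 * ∑ k, v x k * b i k x))) 2 volume := MemLp.continuous_mul h2 (h.contv_apply j)
  exact (h1.add h3).const_mul m

/-- The rate of change of `∫ ϱ (δ + |v|²) ^ (m / 2)`. The transport terms of the two equations
cancel. -/
lemma State.integral_moment (h : State ϱ v a b) {γ : ℝ} {ϱt : Torus → ℝ} {vt : Torus → Vec}
    (hm : MassAt ϱ ϱt v) (hmo : MomentumAt γ ϱ v vt) (hϱt : Integrable ϱt)
    (hvt : ∀ j, Integrable fun x => vt x j) (m : ℝ) {δ : ℝ} (hδ : 0 < δ) :
    ∫ x, (ϱt x * sqSpeed δ (v x) ^ (m / 2)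
        + ϱ x * (∑ j, m * sqSpeed δ (v x) ^ (m / 2 - 1) * (v x j * vt x j)))
      = ∫ x, (ϱ x ^ γ * ∑ j, momentHess m δ (v x) (fun i j => b i j x) j j
        - ϱ x * ∑ i, ∑ j, b i j x * momentHess m δ (v x) (fun i j => b i j x) i j) := by
  set z : Fin 3 → Fin 3 → Torus → ℝ :=
    fun i j x => momentHess m δ (v x) (fun i j => b i j x) i j with hz
  have hcw := h.cont_sqSpeed_rpow hδ
  have hζc : ∀ j, Continuous fun x => m * (v x j * sqSpeed δ (v x) ^ (m / 2 - 1)) := fun j =>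
    continuous_const.mul ((h.contv_apply j).mul (hcw _))
  have hzd : ∀ i j, LineDeriv i (fun x => m * (v x j * sqSpeed δ (v x) ^ (m / 2 - 1))) (z i j) := by
    intro i j
    refine ((lineDeriv_const i m).mul
      ((h.db i j).lineDeriv.mul (h.lineDeriv_sqSpeed_rpow i hδ (m / 2 - 1)))).congr ?_
    ext x; simp only [hz, momentHess]; ring
  have hz2 : ∀ i j, MemLp (z i j) 2 volume := fun i j => h.memLp_momentHess m hδ i j
  have hy2 : ∀ i, MemLp (fun x => m / 2 * sqSpeed δ (v x) ^ (m / 2 - 1) *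
      (2 * ∑ k, v x k * b i k x)) 2 volume := fun i =>
    MemLp.continuous_mul ((h.memLp_dot i).const_mul 2) (continuous_const.mul (hcw _))
  have e1 := h.integral_mass hm (hcw (m / 2)) (fun i => h.lineDeriv_sqSpeed_rpow i hδ (m / 2)) hy2
  have e2 := fun j => h.integral_momentum hmo j (hζc j) (fun i => hzd i j) (fun i => hz2 i j)
  have hw2 : ∀ i, MemLp (fun x => ϱ x * v x i - a i x) 2 volume := fun i =>
    (continuous_memLp (h.cont.mul (h.contv_apply i)) 2).sub (h.a2 i)
  have i1 : Integrable fun x => ϱt x * sqSpeed δ (v x) ^ (m / 2) :=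
    integrable_mul_continuous hϱt (hcw _)
  have i2 : ∀ j, Integrable fun x =>
      ϱ x * vt x j * (m * (v x j * sqSpeed δ (v x) ^ (m / 2 - 1))) := fun j =>
    integrable_mul_continuous (by
      simpa only [mul_comm] using integrable_mul_continuous (hvt j) h.cont) (hζc j)
  have i3 : Integrable fun x => ∑ i, (ϱ x * v x i - a i x) *
      (m / 2 * sqSpeed δ (v x) ^ (m / 2 - 1) * (2 * ∑ k, v x k * b i k x)) :=
    integrable_finsetSum _ fun i _ => integrable_mul_of_memLp_two (hw2 i) (hy2 i)
  have i4 : ∀ j, Integrable fun x => ϱ x ^ γ * z j j x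
      - ∑ i, (ϱ x * v x i - a i x) * (b i j x * (m * (v x j * sqSpeed δ (v x) ^ (m / 2 - 1))))
      - ∑ i, ϱ x * b i j x * z i j x := fun j => by
    refine ((memLp_two_integrable (MemLp.continuous_mul (hz2 j j)
      (h.cont_comp (continuousOn_rpow_Ioi γ)))).sub
      (integrable_finsetSum _ fun i _ => integrable_mul_of_memLp_two (hw2 i)
        (MemLp.mul_continuous (h.b2 i j) (hζc j)))).sub
      (integrable_finsetSum _ fun i _ => integrable_mul_of_memLp_two
        (MemLp.continuous_mul (h.b2 i j) h.cont) (hz2 i j))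
  have i2s : Integrable fun x => ∑ j,
      ϱ x * vt x j * (m * (v x j * sqSpeed δ (v x) ^ (m / 2 - 1))) :=
    integrable_finsetSum _ fun j _ => i2 j
  have i4s := integrable_finsetSum Finset.univ fun j _ => i4 j
  have lhs : ∀ x, ϱt x * sqSpeed δ (v x) ^ (m / 2)
        + ϱ x * (∑ j, m * sqSpeed δ (v x) ^ (m / 2 - 1) * (v x j * vt x j))
      = ϱt x * sqSpeed δ (v x) ^ (m / 2)
        + ∑ j, ϱ x * vt x j * (m * (v x j * sqSpeed δ (v x) ^ (m / 2 - 1))) := fun x => by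
    rw [Finset.mul_sum]
    congr 1
    exact Finset.sum_congr rfl fun j _ => by ring
  simp_rw [lhs]
  rw [integral_add i1 i2s, integral_finsetSum _ fun j _ => i2 j, e1,
    Finset.sum_congr rfl fun j _ => e2 j, ← integral_finsetSum _ fun j _ => i4 j,
    ← integral_add i3 i4s]
  congr 1; ext x
  simp only [Fin.sum_univ_three]
  ring

/-- The convexity of `(δ + |v|²) ^ (m / 2)` lets the viscous term absorb the pressure term. -/
lemma momentHess_bound {m δ : ℝ} (hm : 2 ≤ m) (hδ : 0 < δ) (v : Vec) (B : Fin 3 → Fin 3 → ℝ)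
    {r P : ℝ} (hr : 0 < r) :
    P * ∑ j, momentHess m δ v B j j - r * ∑ i, ∑ j, B i j * momentHess m δ v B i j
      ≤ m * (m + 1) / 4 * (P ^ 2 / r) * sqSpeed δ v ^ (m / 2 - 1) := by
  set w := sqSpeed δ v with hw
  have hw0 : 0 < w := hδ.trans_le (le_sqSpeed δ v)
  set q := w ^ (m / 2 - 1 - 1) with hq
  have hq0 : 0 ≤ q := Real.rpow_nonneg hw0.le _
  have hwq : w ^ (m / 2 - 1) = w * q := by
    rw [hq, Real.rpow_sub_one hw0.ne' (m / 2 - 1), mul_div_cancel₀ _ hw0.ne']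
  have hsq : ∀ t : ℝ, P * t - r * t ^ 2 ≤ P ^ 2 / r / 4 := fun t => by
    rw [div_div, le_div_iff₀ (by positivity)]
    nlinarith [sq_nonneg (P - 2 * r * t)]
  have hsq' : ∀ s t : ℝ, P * (s * t) - r * t ^ 2 ≤ P ^ 2 / r / 4 * s ^ 2 := fun s t => by
    have : P ^ 2 / r / 4 * s ^ 2 - (P * (s * t) - r * t ^ 2)
        = (P * s - 2 * r * t) ^ 2 / (4 * r) := by
      field_simp; ring
    have h2 : 0 ≤ (P * s - 2 * r * t) ^ 2 / (4 * r) := by positivity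
    linarith
  -- the two parts of the Hessian are estimated separately, each by completing squares
  set X : Fin 3 → ℝ := fun i => ∑ k, v k * B i k with hX
  have hA : P * ∑ j, B j j - r * ∑ i, ∑ j, B i j ^ 2 ≤ 3 * (P ^ 2 / r / 4) := by
    have h0 := hsq (B 0 0); have h1 := hsq (B 1 1); have h2 := hsq (B 2 2)
    simp only [Fin.sum_univ_three]
    have n1 := mul_nonneg hr.le (sq_nonneg (B 0 1)); have n2 := mul_nonneg hr.le (sq_nonneg (B 0 2))
    have n3 := mul_nonneg hr.le (sq_nonneg (B 1 0)); have n4 := mul_nonneg hr.le (sq_nonneg (B 1 2))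
    have n5 := mul_nonneg hr.le (sq_nonneg (B 2 0)); have n6 := mul_nonneg hr.le (sq_nonneg (B 2 1))
    linarith
  have hB : P * ∑ j, v j * X j - r * ∑ i, X i ^ 2 ≤ P ^ 2 / r / 4 * ∑ k, v k ^ 2 := by
    rw [Finset.mul_sum, Finset.mul_sum, Finset.mul_sum, ← Finset.sum_sub_distrib]
    exact Finset.sum_le_sum fun i _ => hsq' _ _
  have e : P * ∑ j, momentHess m δ v B j j - r * ∑ i, ∑ j, B i j * momentHess m δ v B i j
      = m * (w * q) * (P * ∑ j, B j j - r * ∑ i, ∑ j, B i j ^ 2)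
        + m * (m - 2) * q * (P * ∑ j, v j * X j - r * ∑ i, X i ^ 2) := by
    simp only [momentHess, ← hw, ← hq, hwq, hX, Fin.sum_univ_three]
    ring
  have hv2 : ∑ k, v k ^ 2 ≤ w := by rw [hw, sqSpeed]; linarith
  have hP : 0 ≤ P ^ 2 / r / 4 := by positivity
  rw [e, hwq]
  have h1 := mul_le_mul_of_nonneg_left hA (show 0 ≤ m * (w * q) by positivity)
  have h2 := mul_le_mul_of_nonneg_left (hB.trans (mul_le_mul_of_nonneg_left hv2 hP))
    (show 0 ≤ m * (m - 2) * q from mul_nonneg (mul_nonneg (by linarith) (by linarith)) hq0)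
  calc _ ≤ _ := add_le_add h1 h2
    _ = m * (m + 1) / 4 * (P ^ 2 / r) * (w * q) := by ring

lemma State.integrable_moment (h : State ϱ v a b) (γ m : ℝ) {δ : ℝ} (hδ : 0 < δ) :
    Integrable fun x => ϱ x ^ γ * ∑ j, momentHess m δ (v x) (fun i j => b i j x) j j
        - ϱ x * ∑ i, ∑ j, b i j x * momentHess m δ (v x) (fun i j => b i j x) i j := by
  have h2 := h.memLp_momentHess m hδ
  refine (memLp_two_integrable (MemLp.continuous_mul (memLp_finsetSum _ fun j _ => h2 j j)
    (h.cont_comp (continuousOn_rpow_Ioi γ)))).sub ?_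
  have : Integrable fun x => ∑ i, ∑ j, b i j x * momentHess m δ (v x) (fun i j => b i j x) i j :=
    integrable_finsetSum _ fun i _ => integrable_finsetSum _ fun j _ =>
      integrable_mul_of_memLp_two (h.b2 i j) (h2 i j)
  simpa only [mul_comm] using integrable_mul_continuous this h.cont

/-- The growth rate of `∫ ϱ (δ + |v|²) ^ (m / 2)` after absorption of the pressure term. -/
lemma State.integral_moment_le (h : State ϱ v a b) {γ : ℝ} {ϱt : Torus → ℝ} {vt : Torus → Vec}
    (hm : MassAt ϱ ϱt v) (hmo : MomentumAt γ ϱ v vt) (hϱt : Integrable ϱt)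
    (hvt : ∀ j, Integrable fun x => vt x j) {m δ : ℝ} (h2m : 2 ≤ m) (hδ : 0 < δ) :
    ∫ x, (ϱt x * sqSpeed δ (v x) ^ (m / 2)
        + ϱ x * (∑ j, m * sqSpeed δ (v x) ^ (m / 2 - 1) * (v x j * vt x j)))
      ≤ m * (m + 1) / 4 * ∫ x, ϱ x ^ (2 * γ - 1) * sqSpeed δ (v x) ^ (m / 2 - 1) := by
  rw [h.integral_moment hm hmo hϱt hvt m hδ, ← integral_const_mul]
  refine integral_mono (h.integrable_moment γ m hδ) ?_ fun x => ?_
  · exact continuous_integrable (continuous_const.mul ((h.cont_comp (continuousOn_rpow_Ioi _)).mul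
      (h.cont_sqSpeed_rpow hδ _)))
  · refine (momentHess_bound h2m hδ _ _ (h.pos x)).trans_eq ?_
    have : (ϱ x ^ γ) ^ 2 / ϱ x = ϱ x ^ (2 * γ - 1) := by
      rw [Real.rpow_sub_one (h.pos x).ne', ← Real.rpow_natCast, ← Real.rpow_mul (h.pos x).le]
      congr 2; push_cast; ring
    rw [this]; ring

/-- The dissipation of the energy of the effective velocity at a fixed time. -/
lemma State.integral_energy_le (h : State ϱ v a b) {γ : ℝ} (hγ : 1 < γ) {ϱt : Torus → ℝ}
    {vt : Torus → Vec} (hm : MassAt ϱ ϱt v) (hmo : MomentumAt γ ϱ v vt) (hϱt : Integrable ϱt)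
    (hvt : ∀ j, Integrable fun x => vt x j) :
    (∫ x, (ϱt x * sqSpeed 1 (v x) ^ ((2 : ℝ) / 2)
        + ϱ x * (∑ j, 2 * sqSpeed 1 (v x) ^ ((2 : ℝ) / 2 - 1) * (v x j * vt x j))))
      + 2 / (γ - 1) * ∫ x, ϱt x * (γ * ϱ x ^ (γ - 1))
      ≤ - (2 * γ) * ∫ x, ϱ x ^ (γ - 2) * ∑ i, a i x ^ 2 := by
  have hγ1 : γ - 1 ≠ 0 := by linarith
  have hint := h.integrable_moment γ 2 one_pos
  have hren := h.integral_renormalized hm (G := fun y => y ^ γ) (G' := fun y => γ * y ^ (γ - 1))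
    (G'' := fun y => γ * ((γ - 1) * y ^ (γ - 1 - 1))) (hasDerivAt_rpow_of_pos γ)
    (fun y hy => (hasDerivAt_rpow_of_pos (γ - 1) y hy).const_mul γ)
    (continuousOn_const.mul (continuousOn_const.mul (continuousOn_rpow_Ioi _)))
    (ψ := fun _ => 1) (ψ₁ := fun _ _ => 0) (ψ₂ := fun _ _ => 0) continuous_const
    (fun _ => continuous_const) (fun _ => continuous_const) (fun i => lineDeriv_const i 1)
    (fun i => lineDeriv_const i 0)
  simp only [mul_one, mul_zero, add_zero] at hren
  rw [h.integral_moment hm hmo hϱt hvt 2 one_pos, hren]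
  -- the work of the pressure has opposite signs in the two balances
  have ip1 : ∀ i, Integrable fun x => γ * ϱ x ^ (γ - 1) * a i x * v x i := fun i =>
    memLp_two_integrable (MemLp.mul_continuous (MemLp.continuous_mul (h.a2 i)
      (continuous_const.mul (h.cont_comp (continuousOn_rpow_Ioi _)))) (h.contv_apply i))
  have ip2 : ∀ i, Integrable fun x => ϱ x ^ γ * b i i x := fun i =>
    memLp_two_integrable (MemLp.continuous_mul (h.b2 i i) (h.cont_comp (continuousOn_rpow_Ioi _)))
  have ip12 : ∀ i, Integrable fun x => γ * ϱ x ^ (γ - 1) * a i x * v x i + ϱ x ^ γ * b i i x :=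
    fun i => (ip1 i).add (ip2 i)
  have hwork : ∫ x, ∑ i, (γ * ϱ x ^ (γ - 1) * a i x * v x i + ϱ x ^ γ * b i i x) = 0 := by
    rw [integral_finsetSum _ fun i _ => ip12 i]
    refine Finset.sum_eq_zero fun i _ => ?_
    rw [integral_add (ip1 i) (ip2 i), (h.lineDeriv_comp i (hasDerivAt_rpow_of_pos γ)
      (continuousOn_const.mul (continuousOn_rpow_Ioi _))).integral_mul (h.db i i).lineDeriv
      (ip1 i) (ip2 i)]
    ring
  have hD : Integrable fun x => ϱ x ^ (γ - 2) * ∑ i, a i x ^ 2 := by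
    have : Integrable fun x => ∑ i, a i x * a i x :=
      integrable_finsetSum _ fun i _ => integrable_mul_of_memLp_two (h.a2 i) (h.a2 i)
    simp only [← pow_two] at this
    simpa only [mul_comm] using
      integrable_mul_continuous this (h.cont_comp (continuousOn_rpow_Ioi (γ - 2)))
  have hR : Integrable fun x =>
      ∑ i, γ * ((γ - 1) * ϱ x ^ (γ - 1 - 1)) * (a i x * (ϱ x * v x i - a i x)) :=
    integrable_finsetSum _ fun i _ => integrable_continuous_mul
      (continuous_const.mul (continuous_const.mul
        (h.cont_comp (continuousOn_rpow_Ioi (γ - 1 - 1)))))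
      (integrable_mul_of_memLp_two (h.a2 i)
        ((continuous_memLp (h.cont.mul (h.contv_apply i)) 2).sub (h.a2 i)))
  have hW := integrable_finsetSum Finset.univ fun i _ => ip12 i
  have hRc : Integrable fun x => 2 / (γ - 1) *
      ∑ i, γ * ((γ - 1) * ϱ x ^ (γ - 1 - 1)) * (a i x * (ϱ x * v x i - a i x)) := hR.const_mul _
  have hWc : Integrable fun x =>
      2 * ∑ i, (γ * ϱ x ^ (γ - 1) * a i x * v x i + ϱ x ^ γ * b i i x) := hW.const_mul _
  have hL := hint.add hRc
  rw [← integral_const_mul, ← integral_const_mul]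
  have h0 : ∫ x, 2 * ∑ i, (γ * ϱ x ^ (γ - 1) * a i x * v x i + ϱ x ^ γ * b i i x) = 0 := by
    rw [integral_const_mul, hwork, mul_zero]
  have step := integral_mono (hL.sub hWc) (hD.const_mul (-(2 * γ))) ?_
  · rw [integral_sub' hL hWc, integral_add' hint hRc, h0, sub_zero] at step
    exact step
  intro x
  have hp := h.pos x
  have e1 : ϱ x ^ (γ - 1 - 1) = ϱ x ^ (γ - 2) := by congr 1; ring
  have e2 : ϱ x ^ (γ - 1) = ϱ x ^ (γ - 2) * ϱ x := by
    rw [← Real.rpow_add_one hp.ne']; congr 1; ring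
  have hb : 0 ≤ ϱ x * ∑ i, ∑ j, b i j x ^ 2 := by positivity
  simp only [momentHess, e1, e2, Pi.add_apply, Pi.sub_apply]
  norm_num
  simp only [Fin.sum_univ_three] at hb ⊢
  have key : ∀ P r A0 A1 A2 V0 V1 V2 g : ℝ, 2 / (γ - 1) *
      (γ * ((γ - 1) * P) * (A0 * (r * V0 - A0)) + γ * ((γ - 1) * P) * (A1 * (r * V1 - A1))
        + γ * ((γ - 1) * P) * (A2 * (r * V2 - A2)))
      = 2 * γ * P * (A0 * (r * V0 - A0) + A1 * (r * V1 - A1) + A2 * (r * V2 - A2)) := by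
    intros; field_simp
  rw [key _ _ _ _ _ _ _ _ 0]
  linarith

end Moments

section

/-! ### Evolution of integral functionals -/

lemma stMeasure_eq (T : ℝ) : stMeasure T
    = ((volume : Measure ℝ).prod (volume : Measure Torus)).restrict (Icc (0 : ℝ) T ×ˢ univ) := by
  rw [stMeasure, ← Measure.prod_restrict, Measure.restrict_univ]

instance (T : ℝ) : IsFiniteMeasure (stMeasure T) := by
  rw [stMeasure]; infer_instance

lemma exists_bound_of_continuousOn_strip {T : ℝ} {c : ℝ → Torus → ℝ}
    (hc : ContinuousOn (Function.uncurry c) (Icc (0 : ℝ) T ×ˢ univ)) :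
    ∃ M : ℝ, ∀ t ∈ Icc (0 : ℝ) T, ∀ x, ‖c t x‖ ≤ M := by
  obtain ⟨M, hM⟩ := (isCompact_Icc.prod isCompact_univ).exists_bound_of_continuousOn hc
  exact ⟨M, fun t ht x => hM (t, x) ⟨ht, mem_univ x⟩⟩

lemma ae_stMeasure_mem (T : ℝ) : ∀ᵐ p ∂(stMeasure T), p ∈ Icc (0 : ℝ) T ×ˢ (univ : Set Torus) := by
  rw [stMeasure_eq]
  exact ae_restrict_mem (measurableSet_Icc.prod MeasurableSet.univ)

lemma integrable_continuousOn_mul {T : ℝ} {c f : ℝ → Torus → ℝ}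
    (hc : ContinuousOn (Function.uncurry c) (Icc (0 : ℝ) T ×ˢ univ))
    (hf : Integrable (Function.uncurry f) (stMeasure T)) :
    Integrable (Function.uncurry fun t x => c t x * f t x) (stMeasure T) := by
  obtain ⟨M, hM⟩ := exists_bound_of_continuousOn_strip hc
  have hcm : AEStronglyMeasurable (Function.uncurry c) (stMeasure T) := by
    rw [stMeasure_eq]
    exact hc.aestronglyMeasurable (measurableSet_Icc.prod MeasurableSet.univ)
  refine hf.bdd_mul (c := M) hcm ?_
  filter_upwards [ae_stMeasure_mem T] with p hp
  exact hM p.1 hp.1 p.2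

lemma integrable_of_continuousOn_strip {T : ℝ} {c : ℝ → Torus → ℝ}
    (hc : ContinuousOn (Function.uncurry c) (Icc (0 : ℝ) T ×ˢ univ)) :
    Integrable (Function.uncurry c) (stMeasure T) := by
  have := integrable_continuousOn_mul (f := fun _ _ => (1 : ℝ)) hc (integrable_const (1 : ℝ))
  simpa using this

lemma integrable_slice_integral {T : ℝ} {f : ℝ → Torus → ℝ}
    (hf : Integrable (Function.uncurry f) (stMeasure T)) :
    IntegrableOn (fun t => ∫ x, f t x) (Icc 0 T) volume :=
  Integrable.integral_prod_left hf

lemma IntegrableOn.intervalIntegrable_of_le {T t : ℝ} {f : ℝ → ℝ} (hf : IntegrableOn f (Icc 0 T))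
    (ht : t ∈ Icc 0 T) : IntervalIntegrable f volume 0 t := by
  rw [intervalIntegrable_iff_integrableOn_Icc_of_le ht.1]
  exact hf.mono_set (Icc_subset_Icc_right ht.2)

/-- Fubini's theorem for the increment of `∫ Θ(t, x) dx`, where `Θ(·, x)` is absolutely continuous
for almost every `x`. -/
lemma integral_sub_eq_of_isPrim {T : ℝ} {Θ θ : ℝ → Torus → ℝ}
    (hΘ : ∀ᵐ x : Torus, IsPrim T (fun t => Θ t x) (fun t => θ t x))
    (hc : ∀ t ∈ Icc (0 : ℝ) T, Continuous (Θ t))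
    (hθ : Integrable (Function.uncurry θ) (stMeasure T)) {t : ℝ} (ht : t ∈ Icc 0 T) :
    (∫ x, Θ t x) - ∫ x, Θ 0 x = ∫ r in (0 : ℝ)..t, ∫ x, θ r x := by
  have h0 : (0 : ℝ) ∈ Icc 0 T := ⟨le_rfl, ht.1.trans ht.2⟩
  rw [← integral_sub (continuous_integrable (hc t ht)) (continuous_integrable (hc 0 h0)),
    intervalIntegral_integral_swap]
  · refine integral_congr_ae ?_
    filter_upwards [hΘ] with x hx
    have := hx.2 t ht
    simp only at this
    linarith
  · rw [stMeasure] at hθ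
    refine hθ.mono_measure (Measure.prod_mono ?_ le_rfl)
    rw [uIoc_of_le ht.1]
    exact Measure.restrict_mono (Ioc_subset_Icc_self.trans (Icc_subset_Icc_right ht.2)) le_rfl

/-- A strong solution on the closed time interval `[0, T]`, with its time derivatives `ϱt`, `vt` and
its weak spatial derivatives `a t i = ∂ᵢ ϱ(t)`, `b t i j = ∂ᵢ vⱼ(t)`. -/
structure Evolution (γ T : ℝ) (ϱ : ℝ → Torus → ℝ) (v : ℝ → Torus → Vec) (ϱt : ℝ → Torus → ℝ)
    (vt : ℝ → Torus → Vec) (a : ℝ → Fin 3 → Torus → ℝ) (b : ℝ → Fin 3 → Fin 3 → Torus → ℝ) :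
    Prop where
  contϱ : ContinuousOn (Function.uncurry ϱ) (Icc (0 : ℝ) T ×ˢ univ)
  contv : ContinuousOn (Function.uncurry v) (Icc (0 : ℝ) T ×ˢ univ)
  state : ∀ t ∈ Icc (0 : ℝ) T, State (ϱ t) (v t) (a t) (b t)
  aesm : ∀ i, AEStronglyMeasurable (Function.uncurry fun t x => a t i x) (stMeasure T)
  mass : ∀ᵐ t ∂(volume.restrict (Icc (0 : ℝ) T)), MassAt (ϱ t) (ϱt t) (v t)
  momentum : ∀ᵐ t ∂(volume.restrict (Icc (0 : ℝ) T)), MomentumAt γ (ϱ t) (v t) (vt t)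
  intϱ : Integrable (Function.uncurry ϱt) (stMeasure T)
  intv : ∀ j, Integrable (Function.uncurry fun t x => vt t x j) (stMeasure T)
  primϱ : ∀ᵐ x : Torus, IsPrim T (fun t => ϱ t x) (fun t => ϱt t x)
  primv : ∀ᵐ x : Torus, ∀ j, IsPrim T (fun t => v t x j) (fun t => vt t x j)

/-- The increments are known for rational times at almost every point, hence by continuity for all
times. -/
lemma ae_isPrim_of_hasTimeDeriv {Ts T : ℝ} (hT : 0 < T) (hTs : T < Ts) {f g : ℝ → Torus → ℝ}
    (hf : HasTimeDeriv Ts f g) (hc : ContinuousOn (Function.uncurry f) (Icc (0 : ℝ) T ×ˢ univ))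
    (hg : Integrable (Function.uncurry g) (stMeasure T)) :
    ∀ᵐ x : Torus, IsPrim T (fun t => f t x) (fun t => g t x) := by
  have h1 : ∀ᵐ x : Torus, Integrable (fun t => g t x) (volume.restrict (Icc 0 T)) :=
    Integrable.prod_left_ae hg
  have h2 : ∀ᵐ x : Torus, ∀ r : ℚ, (r : ℝ) ∈ Ioo 0 T →
      f r x - f 0 x = ∫ s in (0 : ℝ)..r, g s x := by
    rw [ae_all_iff]
    intro r
    by_cases hr : (r : ℝ) ∈ Ioo 0 T
    · filter_upwards [hf 0 r le_rfl hr.1.le (hr.2.trans hTs)] with x hx _ using hx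
    · exact Eventually.of_forall fun x h => absurd h hr
  filter_upwards [h1, h2] with x hx1 hx2
  have hi : IntervalIntegrable (fun t => g t x) volume 0 T := by
    rw [intervalIntegrable_iff_integrableOn_Icc_of_le hT.le]; exact hx1
  have hcx : ContinuousOn (fun t => f t x) (Icc 0 T) :=
    hc.comp (f := fun t : ℝ => (t, x)) (by fun_prop) fun t ht => ⟨ht, mem_univ x⟩
  have hcp : ContinuousOn (fun t => f 0 x + ∫ s in (0 : ℝ)..t, g s x) (Icc 0 T) := by
    have := intervalIntegral.continuousOn_primitive_interval (a := 0) (b := T) (μ := volume)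
      (f := fun t => g t x) (by rw [uIcc_of_le hT.le]; exact hx1)
    rw [uIcc_of_le hT.le] at this
    exact continuousOn_const.add this
  refine ⟨hi, fun t ht => ?_⟩
  have heq : EqOn (fun t => f t x) (fun t => f 0 x + ∫ s in (0 : ℝ)..t, g s x)
      (Ioo 0 T ∩ range ((↑) : ℚ → ℝ)) := by
    rintro _ ⟨hr, r, rfl⟩
    have := hx2 r hr
    simp only
    linarith
  refine heq.of_subset_closure hcx hcp (inter_subset_left.trans Ioo_subset_Icc_self) ?_ ht
  rw [← closure_Ioo hT.ne]
  refine closure_minimal ?_ isClosed_closure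
  exact Rat.denseRange_cast.open_subset_closure_inter isOpen_Ioo

lemma MemL2H.memLp {T : ℝ} {k : ℕ} {f : ℝ → Torus → ℝ} (h : MemL2H T k f) :
    MemLp (Function.uncurry f) 2 (stMeasure T) := by
  cases k with
  | zero => exact h
  | succ k => exact h.1

lemma MemCH.memCL2 {T : ℝ} {k : ℕ} {f : ℝ → Torus → ℝ} (h : MemCH T k f) : MemCL2 T f := by
  cases k with
  | zero => exact h
  | succ k => exact h.1

/-- A strong solution on `[0, Ts)`, restricted to a compact interval. The spatial derivatives are
those of the `C([0, T]; H^k)` regularity, which exist at every time. -/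
lemma IsStrongSolution.exists_evolution {γ Ts : ℝ} {ϱ₀ : Torus → ℝ} {v₀ : Torus → Vec}
    {ϱ : ℝ → Torus → ℝ} {v : ℝ → Torus → Vec} (h : IsStrongSolution γ Ts ϱ₀ v₀ ϱ v) {T : ℝ}
    (hT : 0 < T) (hTs : T < Ts) : ∃ ϱt vt a b, Evolution γ T ϱ v ϱt vt a b := by
  obtain ⟨ϱt, vt, h1, h2, h3, h4, h5, h6⟩ := h.equations
  have hsub : Icc (0 : ℝ) T ×ˢ (univ : Set Torus) ⊆ Ico 0 Ts ×ˢ univ :=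
    prod_mono (fun t ht => ⟨ht.1, ht.2.trans_lt hTs⟩) le_rfl
  have cϱ := h.continuousOn_density.mono hsub
  have cv := h.continuousOn_velocity.mono hsub
  choose a ha1 ha2 using (h.density_C T hT hTs).2
  choose aa haa1 haa2 using fun i => (ha1 i).2
  choose b hb1 hb2 using fun j => (h.velocity_C T hT hTs j).2
  choose bb hbb1 hbb2 using fun j i => (hb1 j i).2
  have iϱ : Integrable (Function.uncurry ϱt) (stMeasure T) :=
    (h3 T hT hTs).2.memLp.integrable one_le_two
  have iv : ∀ j, Integrable (Function.uncurry fun t x => vt t x j) (stMeasure T) := fun j =>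
    (h4 T hT hTs j).2.memLp.integrable one_le_two
  have hae : ∀ P : ℝ → Prop, (∀ᵐ t ∂(volume.restrict (Ioo (0 : ℝ) Ts)), P t) →
      ∀ᵐ t ∂(volume.restrict (Icc (0 : ℝ) T)), P t := fun P hP => by
    rw [Measure.restrict_congr_set Ioo_ae_eq_Icc.symm]
    exact ae_restrict_of_ae_restrict_of_subset (Ioo_subset_Ioo_right hTs.le) hP
  refine ⟨ϱt, vt, fun t i => a i t, fun t i j => b j i t, cϱ, cv, fun t ht => ?_,
    fun i => (ha1 i).memCL2.1, hae _ h5, hae _ h6, iϱ, iv,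
    ae_isPrim_of_hasTimeDeriv hT hTs h1 cϱ iϱ, ?_⟩
  · exact
      { cont := cϱ.comp_continuous (f := fun x => (t, x)) (by fun_prop) fun x => ⟨ht, mem_univ x⟩
        pos := h.density_pos t ⟨ht.1, ht.2.trans_lt hTs⟩
        contv := cv.comp_continuous (f := fun x => (t, x)) (by fun_prop) fun x => ⟨ht, mem_univ x⟩
        da := fun i => ha2 i t ht
        a2 := fun i => (ha1 i).memCL2.2.1 t ht
        daa := fun i => ⟨aa i i t, haa2 i i t ht⟩
        db := fun i j => hb2 j i t ht
        b2 := fun i j => (hb1 j i).memCL2.2.1 t ht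
        dbb := fun i j => ⟨bb j i i t, (hbb1 j i i).memCL2.2.1 t ht, hbb2 j i i t ht⟩ }
  · rw [ae_all_iff]
    exact fun j => ae_isPrim_of_hasTimeDeriv hT hTs (h2 j)
      ((EuclideanSpace.proj (𝕜 := ℝ) j).continuous.comp_continuousOn cv) (iv j)

variable {γ T : ℝ} {ϱ : ℝ → Torus → ℝ} {v : ℝ → Torus → Vec} {ϱt : ℝ → Torus → ℝ}
  {vt : ℝ → Torus → Vec} {a : ℝ → Fin 3 → Torus → ℝ} {b : ℝ → Fin 3 → Fin 3 → Torus → ℝ}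

lemma Evolution.continuousOn_comp (h : Evolution γ T ϱ v ϱt vt a b) {F : ℝ → ℝ}
    (hF : ContinuousOn F (Ioi 0)) :
    ContinuousOn (Function.uncurry fun t x => F (ϱ t x)) (Icc (0 : ℝ) T ×ˢ univ) :=
  hF.comp h.contϱ fun p hp => (h.state p.1 hp.1).pos p.2

lemma Evolution.continuousOn_comp_velocity (h : Evolution γ T ϱ v ϱt vt a b) {F : Vec → ℝ}
    (hF : Continuous F) :
    ContinuousOn (Function.uncurry fun t x => F (v t x)) (Icc (0 : ℝ) T ×ˢ univ) :=
  hF.comp_continuousOn h.contv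

lemma Evolution.ae_integrable_slices (h : Evolution γ T ϱ v ϱt vt a b) :
    ∀ᵐ t ∂(volume.restrict (Icc (0 : ℝ) T)), Integrable (ϱt t) ∧
      ∀ j, Integrable fun x => vt t x j := by
  have h1 := Integrable.prod_right_ae h.intϱ
  have h2 := ae_all_iff.2 fun j => Integrable.prod_right_ae (h.intv j)
  filter_upwards [h1, h2] with t ht1 ht2 using ⟨ht1, ht2⟩

/-- The time derivative of `ϱ (δ + |v|²) ^ (m / 2)`. -/
def momentRate (m δ : ℝ) (ϱ : Torus → ℝ) (v : Torus → Vec) (ϱt : Torus → ℝ) (vt : Torus → Vec)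
    (x : Torus) : ℝ :=
  ϱt x * sqSpeed δ (v x) ^ (m / 2)
    + ϱ x * (∑ j, m * sqSpeed δ (v x) ^ (m / 2 - 1) * (v x j * vt x j))

lemma Evolution.isPrim_moment (h : Evolution γ T ϱ v ϱt vt a b) (hT : 0 ≤ T) (m : ℝ) {δ : ℝ}
    (hδ : 0 < δ) :
    ∀ᵐ x : Torus, IsPrim T (fun t => ϱ t x * sqSpeed δ (v t x) ^ (m / 2))
      (fun t => momentRate m δ (ϱ t) (v t) (ϱt t) (vt t) x) := by
  filter_upwards [h.primϱ, h.primv] with x h1 h2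
  have hw : IsPrim T (fun t => sqSpeed δ (v t x)) (fun t => 2 * ∑ j, v t x j * vt t x j) := by
    have hk := fun k => (h2 k).mul hT (h2 k)
    have hc : IsPrim T (fun _ => δ) (fun _ => 0) :=
      isPrim_of_hasDerivAt hT (fun t _ => hasDerivAt_const t δ) continuousOn_const
    have := hc.add hT (((hk 0).add hT (hk 1)).add hT (hk 2))
    convert this using 2 with t t
    · simp only [sqSpeed, Fin.sum_univ_three]; ring
    · simp only [Fin.sum_univ_three]; ring
  have hp := IsPrim.comp hT (F := fun y => y ^ (m / 2)) (F' := fun y => m / 2 * y ^ (m / 2 - 1))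
    (U := Ioi 0) hw (fun t _ => hδ.trans_le (le_sqSpeed δ _)) (hasDerivAt_rpow_of_pos _)
    (continuousOn_const.mul (continuousOn_rpow_Ioi _))
  refine (h1.mul hT hp).congr_deriv hT (Eventually.of_forall fun t => ?_)
  simp only [momentRate, Fin.sum_univ_three]
  ring

lemma Evolution.integrable_momentRate (h : Evolution γ T ϱ v ϱt vt a b) (m : ℝ) {δ : ℝ}
    (hδ : 0 < δ) :
    Integrable (Function.uncurry fun t x => momentRate m δ (ϱ t) (v t) (ϱt t) (vt t) x)
      (stMeasure T) := by
  have hw := fun c => h.continuousOn_comp_velocity (continuous_sqSpeed_rpow hδ c)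
  have h1 := integrable_continuousOn_mul (hw (m / 2)) h.intϱ
  have h2 : ∀ j, Integrable (Function.uncurry fun t x =>
      (ϱ t x * (m * sqSpeed δ (v t x) ^ (m / 2 - 1) * v t x j)) * vt t x j) (stMeasure T) :=
    fun j => integrable_continuousOn_mul (c := fun t x =>
      ϱ t x * (m * sqSpeed δ (v t x) ^ (m / 2 - 1) * v t x j)) (h.contϱ.mul
      ((continuousOn_const.mul (hw (m / 2 - 1))).mul (h.continuousOn_comp_velocity
        (EuclideanSpace.proj (𝕜 := ℝ) j).continuous))) (h.intv j)
  refine (h1.add (integrable_finsetSum Finset.univ fun j _ => h2 j)).congr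
    (Eventually.of_forall fun p => ?_)
  simp only [momentRate, Function.uncurry, Pi.add_apply, Finset.mul_sum]
  congr 1
  · ring
  · exact Finset.sum_congr rfl fun j _ => by ring

lemma Evolution.continuous_moment (h : Evolution γ T ϱ v ϱt vt a b) (m : ℝ) {δ : ℝ}
    (hδ : 0 < δ) : ∀ t ∈ Icc (0 : ℝ) T, Continuous fun x => ϱ t x * sqSpeed δ (v t x) ^ (m / 2) :=
  fun t ht => (h.state t ht).cont.mul ((h.state t ht).cont_sqSpeed_rpow hδ _)

/-- The moment `∫ ϱ (δ + |v|²) ^ (m / 2)`. -/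
def moment (m δ : ℝ) (ϱ : Torus → ℝ) (v : Torus → Vec) : ℝ :=
  ∫ x, ϱ x * sqSpeed δ (v x) ^ (m / 2)

/-- The dissipation `∫ ϱ ^ (γ - 2) |∇ϱ|²`, where `a` is the gradient of `ϱ`. -/
def dissipation (γ : ℝ) (ϱ : Torus → ℝ) (a : Fin 3 → Torus → ℝ) : ℝ :=
  ∫ x, ϱ x ^ (γ - 2) * ∑ i, a i x ^ 2

lemma Evolution.moment_sub_eq (h : Evolution γ T ϱ v ϱt vt a b) (m : ℝ) {δ : ℝ} (hδ : 0 < δ)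
    {t : ℝ} (ht : t ∈ Icc 0 T) :
    moment m δ (ϱ t) (v t) - moment m δ (ϱ 0) (v 0)
      = ∫ r in (0 : ℝ)..t, ∫ x, momentRate m δ (ϱ r) (v r) (ϱt r) (vt r) x :=
  integral_sub_eq_of_isPrim (h.isPrim_moment (ht.1.trans ht.2) m hδ) (h.continuous_moment m hδ)
    (h.integrable_momentRate m hδ) ht

/-- The term that drives the growth of the moments is integrable in time. -/
lemma Evolution.integrableOn_source (h : Evolution γ T ϱ v ϱt vt a b) (c d : ℝ) {δ : ℝ}
    (hδ : 0 < δ) :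
    IntegrableOn (fun r => ∫ x, ϱ r x ^ c * sqSpeed δ (v r x) ^ d) (Icc 0 T) :=
  integrable_slice_integral (integrable_of_continuousOn_strip
    ((h.continuousOn_comp (continuousOn_rpow_Ioi c)).mul
      (h.continuousOn_comp_velocity (continuous_sqSpeed_rpow hδ d))))

/-- The moments grow only through the pressure. -/
lemma Evolution.moment_le (h : Evolution γ T ϱ v ϱt vt a b) {m δ : ℝ} (hm : 2 ≤ m) (hδ : 0 < δ)
    {t : ℝ} (ht : t ∈ Icc 0 T) :
    moment m δ (ϱ t) (v t) ≤ moment m δ (ϱ 0) (v 0) + ∫ r in (0 : ℝ)..t, m * (m + 1) / 4 *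
        ∫ x, ϱ r x ^ (2 * γ - 1) * sqSpeed δ (v r x) ^ (m / 2 - 1) := by
  have key := h.moment_sub_eq m hδ ht
  have hle := intervalIntegral.integral_mono_ae_restrict ht.1
    (IntegrableOn.intervalIntegrable_of_le
      (integrable_slice_integral (h.integrable_momentRate m hδ)) ht)
    ((IntegrableOn.intervalIntegrable_of_le (h.integrableOn_source (2 * γ - 1) (m / 2 - 1) hδ)
      ht).const_mul (m * (m + 1) / 4)) ?_
  · linarith
  · refine ae_restrict_of_ae_restrict_of_subset (Icc_subset_Icc_right ht.2) ?_
    filter_upwards [h.mass, h.momentum, h.ae_integrable_slices, ae_restrict_mem measurableSet_Icc]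
      with r h1 h2 h3 hr
    exact (h.state r hr).integral_moment_le h1 h2 h3.1 h3.2 hm hδ

/-- Decay of the energy of the effective velocity (the Bresch–Desjardins entropy). -/
lemma Evolution.energy_le (h : Evolution γ T ϱ v ϱt vt a b) (hγ : 1 < γ) (hT : 0 ≤ T) :
    IntegrableOn (fun r => dissipation γ (ϱ r) (a r)) (Icc 0 T) ∧
    ∀ t ∈ Icc (0 : ℝ) T, moment 2 1 (ϱ t) (v t) + 2 / (γ - 1) * (∫ x, ϱ t x ^ γ)
      + 2 * γ * (∫ r in (0 : ℝ)..t, dissipation γ (ϱ r) (a r))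
      ≤ moment 2 1 (ϱ 0) (v 0) + 2 / (γ - 1) * ∫ x, ϱ 0 x ^ γ := by
  have hi1 := h.integrable_momentRate 2 one_pos
  have hi2 : Integrable (Function.uncurry fun t x => (γ * ϱ t x ^ (γ - 1)) * ϱt t x)
      (stMeasure T) :=
    integrable_continuousOn_mul (continuousOn_const.mul
      (h.continuousOn_comp (continuousOn_rpow_Ioi (γ - 1)))) h.intϱ
  have hs1 := integrable_slice_integral hi1
  have hs2 := integrable_slice_integral hi2
  have hs : IntegrableOn (fun r => (∫ x, momentRate 2 1 (ϱ r) (v r) (ϱt r) (vt r) x)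
      + 2 / (γ - 1) * ∫ x, (γ * ϱ r x ^ (γ - 1)) * ϱt r x) (Icc 0 T) := hs1.add (hs2.const_mul _)
  have hrate : ∀ᵐ r ∂(volume.restrict (Icc (0 : ℝ) T)),
      (∫ x, momentRate 2 1 (ϱ r) (v r) (ϱt r) (vt r) x)
      + 2 / (γ - 1) * (∫ x, (γ * ϱ r x ^ (γ - 1)) * ϱt r x)
      ≤ - (2 * γ) * dissipation γ (ϱ r) (a r) := by
    filter_upwards [h.mass, h.momentum, h.ae_integrable_slices, ae_restrict_mem measurableSet_Icc]
      with r h1 h2 h3 hr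
    have := (h.state r hr).integral_energy_le hγ h1 h2 h3.1 h3.2
    simpa only [mul_comm (ϱt r _), momentRate, dissipation] using this
  have hD0 : ∀ r ∈ Icc (0 : ℝ) T, 0 ≤ dissipation γ (ϱ r) (a r) := fun r hr =>
    integral_nonneg fun x => mul_nonneg (Real.rpow_nonneg ((h.state r hr).pos x).le _)
      (Finset.sum_nonneg fun i _ => sq_nonneg _)
  have hDm : AEStronglyMeasurable (fun r => dissipation γ (ϱ r) (a r))
      (volume.restrict (Icc (0 : ℝ) T)) := by
    have h1 : AEStronglyMeasurable
        (Function.uncurry fun r x => ϱ r x ^ (γ - 2) * ∑ i, a r i x ^ 2) (stMeasure T) := by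
      refine AEStronglyMeasurable.mul (integrable_of_continuousOn_strip
        (h.continuousOn_comp (continuousOn_rpow_Ioi (γ - 2)))).aestronglyMeasurable ?_
      exact Finset.aestronglyMeasurable_fun_sum _ fun i _ => (h.aesm i).pow 2
    exact h1.integral_prod_right'
  have hDi : IntegrableOn (fun r => dissipation γ (ϱ r) (a r)) (Icc 0 T) := by
    refine Integrable.mono' hs.norm hDm ?_
    filter_upwards [hrate, ae_restrict_mem measurableSet_Icc] with r hr hrm
    have h0 := hD0 r hrm
    rw [Real.norm_of_nonneg h0]
    refine le_trans ?_ (neg_le_abs _)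
    nlinarith
  refine ⟨hDi, fun t ht => ?_⟩
  have e1 := h.moment_sub_eq 2 one_pos ht
  have e2 := integral_sub_eq_of_isPrim (Θ := fun t x => ϱ t x ^ γ)
    (θ := fun t x => (γ * ϱ t x ^ (γ - 1)) * ϱt t x) ?_ (fun s hs =>
      (h.state s hs).cont_comp (continuousOn_rpow_Ioi γ)) hi2 ht
  · have e3 := intervalIntegral.integral_mono_ae_restrict ht.1
      (IntegrableOn.intervalIntegrable_of_le hs ht)
      ((IntegrableOn.intervalIntegrable_of_le hDi ht).const_mul (-(2 * γ)))
      (ae_restrict_of_ae_restrict_of_subset (Icc_subset_Icc_right ht.2) hrate)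
    rw [intervalIntegral.integral_add (IntegrableOn.intervalIntegrable_of_le hs1 ht)
      ((IntegrableOn.intervalIntegrable_of_le hs2 ht).const_mul _),
      intervalIntegral.integral_const_mul, intervalIntegral.integral_const_mul, ← e1, ← e2] at e3
    linarith
  · filter_upwards [h.primϱ] with x hx
    exact hx.comp hT (U := Ioi 0) (fun s hs => (h.state s hs).pos x)
      (hasDerivAt_rpow_of_pos γ) (continuousOn_const.mul (continuousOn_rpow_Ioi _))

/-- Evolution of `∫ G(ϱ) ψ` for a smooth function `ψ` of time and space. -/
lemma Evolution.renormalized_sub_eq (h : Evolution γ T ϱ v ϱt vt a b)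
    {G G' G'' : ℝ → ℝ} (hG : ∀ y ∈ Ioi (0 : ℝ), HasDerivAt G (G' y) y)
    (hG' : ∀ y ∈ Ioi (0 : ℝ), HasDerivAt G' (G'' y) y) (hG'' : ContinuousOn G'' (Ioi 0))
    {ψ ψt : ℝ → Torus → ℝ} {ψ₁ ψ₂ : ℝ → Fin 3 → Torus → ℝ}
    (hψ : ContinuousOn (Function.uncurry ψ) (Icc (0 : ℝ) T ×ˢ univ))
    (hψt : ContinuousOn (Function.uncurry ψt) (Icc (0 : ℝ) T ×ˢ univ))
    (hd : ∀ x, ∀ s ∈ Icc (0 : ℝ) T, HasDerivAt (fun s => ψ s x) (ψt s x) s)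
    (hψ₁ : ∀ s ∈ Icc (0 : ℝ) T, ∀ i, Continuous (ψ₁ s i))
    (hψ₂ : ∀ s ∈ Icc (0 : ℝ) T, ∀ i, Continuous (ψ₂ s i))
    (hd₁ : ∀ s ∈ Icc (0 : ℝ) T, ∀ i, LineDeriv i (ψ s) (ψ₁ s i))
    (hd₂ : ∀ s ∈ Icc (0 : ℝ) T, ∀ i, LineDeriv i (ψ₁ s i) (ψ₂ s i)) {t : ℝ} (ht : t ∈ Icc 0 T) :
    ∃ F : ℝ → ℝ, IntervalIntegrable F volume 0 t ∧
      (∫ x, G (ϱ t x) * ψ t x) - (∫ x, G (ϱ 0 x) * ψ 0 x) = (∫ r in (0 : ℝ)..t, F r) ∧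
      ∀ᵐ r ∂(volume.restrict (Icc (0 : ℝ) t)), F r = (∫ x, ∑ i, (G'' (ϱ r x) * ψ r x *
        (a r i x * (ϱ r x * v r x i - a r i x)) + G' (ϱ r x) * (ϱ r x * v r x i) * ψ₁ r i x
        + G (ϱ r x) * ψ₂ r i x)) + ∫ x, G (ϱ r x) * ψt r x := by
  have hT : 0 ≤ T := ht.1.trans ht.2
  have cG : ContinuousOn G (Ioi 0) := fun y hy => (hG y hy).continuousAt.continuousWithinAt
  have cG' : ContinuousOn G' (Ioi 0) := fun y hy => (hG' y hy).continuousAt.continuousWithinAt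
  have hψs : ∀ s ∈ Icc (0 : ℝ) T, Continuous (ψ s) := fun s hs =>
    hψ.comp_continuous (f := fun x => (s, x)) (by fun_prop) fun x => ⟨hs, mem_univ x⟩
  have hi1 : Integrable (Function.uncurry fun r x => (G' (ϱ r x) * ψ r x) * ϱt r x)
      (stMeasure T) :=
    integrable_continuousOn_mul ((h.continuousOn_comp cG').mul hψ) h.intϱ
  have hi2 : Integrable (Function.uncurry fun r x => G (ϱ r x) * ψt r x) (stMeasure T) :=
    integrable_of_continuousOn_strip ((h.continuousOn_comp cG).mul hψt)
  have hi : Integrable (Function.uncurry fun r x => (G' (ϱ r x) * ψ r x) * ϱt r x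
      + G (ϱ r x) * ψt r x) (stMeasure T) := hi1.add hi2
  refine ⟨_, IntegrableOn.intervalIntegrable_of_le (integrable_slice_integral hi) ht,
    integral_sub_eq_of_isPrim (Θ := fun r x => G (ϱ r x) * ψ r x) ?_ ?_ hi ht, ?_⟩
  · filter_upwards [h.primϱ] with x hx
    have h1 : IsPrim T (fun t => G (ϱ t x)) (fun t => G' (ϱ t x) * ϱt t x) :=
      hx.comp hT (U := Ioi 0) (fun s hs => (h.state s hs).pos x) hG cG'
    have h2 : IsPrim T (fun t => ψ t x) (fun t => ψt t x) :=
      isPrim_of_hasDerivAt hT (hd x) (hψt.comp (f := fun t : ℝ => (t, x)) (by fun_prop)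
        fun t ht => ⟨ht, mem_univ x⟩)
    refine (h1.mul hT h2).congr_deriv hT (Eventually.of_forall fun t => ?_)
    ring
  · exact fun s hs => ((h.state s hs).cont_comp cG).mul (hψs s hs)
  · refine ae_restrict_of_ae_restrict_of_subset (Icc_subset_Icc_right ht.2) ?_
    have hr1 := Integrable.prod_right_ae hi1
    have hr2 := Integrable.prod_right_ae hi2
    filter_upwards [h.mass, hr1, hr2, ae_restrict_mem measurableSet_Icc] with r h1 h2 h3 hr
    have e := (h.state r hr).integral_renormalized h1 hG hG' hG'' (hψs r hr) (hψ₁ r hr) (hψ₂ r hr)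
      (hd₁ r hr) (hd₂ r hr)
    simp only [Function.uncurry] at h2 h3
    rw [← e, integral_add h2 h3]
    simp only [mul_comm (ϱt r _)]

end

/-! ### A supersolution of the heat equation on the torus -/

/-- `cos (2 π z)` on the circle `ℝ / ℤ`. -/
def circCos (z : UnitAddCircle) : ℝ := (AddCircle.toCircle z : ℂ).re

/-- `sin (2 π z)` on the circle `ℝ / ℤ`. -/
def circSin (z : UnitAddCircle) : ℝ := (AddCircle.toCircle z : ℂ).im

lemma circCos_coe (r : ℝ) : circCos (r : UnitAddCircle) = Real.cos (2 * Real.pi * r) := by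
  rw [circCos, AddCircle.toCircle_apply_mk, Circle.coe_exp]
  rw [Complex.exp_ofReal_mul_I_re, div_one]

lemma circSin_coe (r : ℝ) : circSin (r : UnitAddCircle) = Real.sin (2 * Real.pi * r) := by
  rw [circSin, AddCircle.toCircle_apply_mk, Circle.coe_exp]
  rw [Complex.exp_ofReal_mul_I_im, div_one]

lemma continuous_circCos : Continuous circCos :=
  Complex.continuous_re.comp (continuous_subtype_val.comp AddCircle.continuous_toCircle)

lemma continuous_circSin : Continuous circSin :=
  Complex.continuous_im.comp (continuous_subtype_val.comp AddCircle.continuous_toCircle)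

lemma circCos_le_one (z : UnitAddCircle) : circCos z ≤ 1 := by
  induction z using QuotientAddGroup.induction_on with
  | _ r => exact (circCos_coe r).trans_le (Real.cos_le_one _)

lemma circSin_sq (z : UnitAddCircle) : circSin z ^ 2 = (1 - circCos z) * (1 + circCos z) := by
  induction z using QuotientAddGroup.induction_on with
  | _ r =>
    have h1 := circCos_coe r
    have h2 := circSin_coe r
    change circSin (r : UnitAddCircle) ^ 2
      = (1 - circCos (r : UnitAddCircle)) * (1 + circCos (r : UnitAddCircle))
    rw [h1, h2]
    have := Real.sin_sq_add_cos_sq (2 * Real.pi * r)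
    linarith

lemma circCos_ge (z : UnitAddCircle) : 1 - circCos z ≤ 2 * Real.pi ^ 2 * ‖z‖ ^ 2 := by
  induction z using QuotientAddGroup.induction_on with
  | _ r =>
    have h0 : ((r - round r : ℝ) : UnitAddCircle) = (r : UnitAddCircle) := by
      rw [AddCircle.coe_sub, sub_eq_self]
      exact_mod_cast AddCircle.coe_eq_zero_iff 1 |>.2 ⟨round r, by simp⟩
    have h1 := circCos_coe (r - round r)
    rw [h0] at h1
    have h2 := Real.one_sub_sq_div_two_le_cos (x := 2 * Real.pi * (r - round r))
    have h3 : ‖(r : UnitAddCircle)‖ = |r - round r| := UnitAddCircle.norm_eq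
    change 1 - circCos (r : UnitAddCircle) ≤ 2 * Real.pi ^ 2 * ‖(r : UnitAddCircle)‖ ^ 2
    rw [h3, sq_abs, h1]
    nlinarith

lemma hasDerivAt_circCos_shift (i j : Fin 3) (x : Torus) (s : ℝ) :
    HasDerivAt (fun r => circCos (shift i r x j))
      (if j = i then -(2 * Real.pi) * circSin (shift i s x j) else 0) s := by
  by_cases hj : j = i
  · subst hj
    obtain ⟨y, hy⟩ := QuotientAddGroup.mk_surjective (x j)
    have e : ∀ r : ℝ, shift j r x j = ((y + r : ℝ) : UnitAddCircle) := fun r => by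
      simp only [shift, Pi.add_apply, Pi.single_eq_same, AddCircle.coe_add]
      rw [← hy]
    simp only [e, circCos_coe, circSin_coe, if_true]
    have h := (((hasDerivAt_id s).const_add y).const_mul (2 * Real.pi)).cos
    refine h.congr_deriv ?_
    simp only [id]
    ring
  · simp only [hj, if_false]
    have e : ∀ r : ℝ, shift i r x j = x j := fun r => by simp [shift, hj]
    simp only [e]
    exact hasDerivAt_const _ _

lemma hasDerivAt_circSin_shift (i : Fin 3) (x : Torus) (s : ℝ) :
    HasDerivAt (fun r => circSin (shift i r x i)) (2 * Real.pi * circCos (shift i s x i)) s := by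
  obtain ⟨y, hy⟩ := QuotientAddGroup.mk_surjective (x i)
  have e : ∀ r : ℝ, shift i r x i = ((y + r : ℝ) : UnitAddCircle) := fun r => by
    simp only [shift, Pi.add_apply, Pi.single_eq_same, AddCircle.coe_add]
    rw [← hy]
  simp only [e, circCos_coe, circSin_coe]
  have h := (((hasDerivAt_id s).const_add y).const_mul (2 * Real.pi)).sin
  refine h.congr_deriv ?_
  simp only [id]; ring

/-- The smooth periodic function `Σ (1 - cos 2πxᵢ)`, comparable to the squared distance to `0`. -/
def torusWeight (x : Torus) : ℝ := ∑ i, (1 - circCos (x i))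

lemma torusWeight_nonneg (x : Torus) : 0 ≤ torusWeight x :=
  Finset.sum_nonneg fun _ _ => sub_nonneg.2 (circCos_le_one _)

@[fun_prop]
lemma continuous_torusWeight : Continuous torusWeight :=
  continuous_finsetSum _ fun i _ =>
    continuous_const.sub (continuous_circCos.comp (continuous_apply i))

lemma hasDerivAt_torusWeight_shift (i : Fin 3) (x : Torus) (s : ℝ) :
    HasDerivAt (fun r => torusWeight (shift i r x)) (2 * Real.pi * circSin (shift i s x i)) s := by
  have h : HasDerivAt (fun r => ∑ j, (1 - circCos (shift i r x j)))
      (∑ j, -(if j = i then -(2 * Real.pi) * circSin (shift i s x j) else 0)) s :=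
    HasDerivAt.fun_sum fun j _ => (hasDerivAt_circCos_shift i j x s).const_sub 1
  refine h.congr_deriv ?_
  rw [Finset.sum_eq_single i] <;> simp +contextual

/-- The kernel `τ^(-3/2) exp (-α W / τ)`, where `W` is `torusWeight`. For `α = 1 / (8 π²)` it agrees
with the heat kernel to leading order. -/
def kern (α τ : ℝ) (x : Torus) : ℝ := τ ^ (-(3 / 2) : ℝ) * Real.exp (-(α / τ * torusWeight x))

/-- The exponent `1 / (8 π²)` of the heat kernel. -/
def heatExp : ℝ := 1 / (8 * Real.pi ^ 2)

lemma heatExp_pos : 0 < heatExp := by unfold heatExp; positivity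

lemma heatExp_mul : 4 * Real.pi ^ 2 * heatExp = 1 / 2 := by
  unfold heatExp
  have := Real.pi_pos.ne'
  field_simp; norm_num

lemma kern_pos (α : ℝ) {τ : ℝ} (hτ : 0 < τ) (x : Torus) : 0 < kern α τ x :=
  mul_pos (Real.rpow_pos_of_pos hτ _) (Real.exp_pos _)

lemma kern_le {α τ : ℝ} (hα : 0 ≤ α) (hτ : 0 < τ) (x : Torus) :
    kern α τ x ≤ τ ^ (-(3 / 2) : ℝ) := by
  refine mul_le_of_le_one_right (Real.rpow_nonneg hτ.le _) ?_
  rw [Real.exp_le_one_iff]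
  have := torusWeight_nonneg x
  have : 0 ≤ α / τ * torusWeight x := by positivity
  linarith

lemma kern_mono {α β τ : ℝ} (h : α ≤ β) (hτ : 0 < τ) (x : Torus) : kern β τ x ≤ kern α τ x := by
  unfold kern
  have := torusWeight_nonneg x
  gcongr

lemma continuousOn_kern (α : ℝ) :
    ContinuousOn (fun p : ℝ × Torus => kern α p.1 p.2) (Ioi 0 ×ˢ univ) := by
  unfold kern
  intro p hp
  have hp0 : p.1 ≠ 0 := ne_of_gt hp.1
  refine ContinuousAt.continuousWithinAt ?_
  refine ContinuousAt.mul (continuousAt_fst.rpow_const (Or.inl hp0)) ?_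
  refine ContinuousAt.rexp (ContinuousAt.neg (ContinuousAt.mul ?_ (by fun_prop)))
  exact continuousAt_const.div continuousAt_fst hp0

lemma continuous_kern (α τ : ℝ) : Continuous (kern α τ) := by
  unfold kern
  fun_prop

/-- The `i`-th partial derivative of the kernel. -/
def kern₁ (α τ : ℝ) (i : Fin 3) (x : Torus) : ℝ :=
  -(α / τ * (2 * Real.pi * circSin (x i))) * kern α τ x

/-- The second partial derivative of the kernel in the `i`-th direction. -/
def kern₂ (α τ : ℝ) (i : Fin 3) (x : Torus) : ℝ :=
  ((α / τ * (2 * Real.pi * circSin (x i))) ^ 2 - α / τ * (4 * Real.pi ^ 2 * circCos (x i)))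
    * kern α τ x

/-- The derivative of the kernel in `τ`. -/
def kernTime (α τ : ℝ) (x : Torus) : ℝ :=
  (-(3 / (2 * τ)) + α / τ ^ 2 * torusWeight x) * kern α τ x

lemma hasDerivAt_kern (α τ : ℝ) (i : Fin 3) (x : Torus) (s : ℝ) :
    HasDerivAt (fun r => kern α τ (shift i r x)) (kern₁ α τ i (shift i s x)) s := by
  have h := ((((hasDerivAt_torusWeight_shift i x s).const_mul (α / τ)).neg).exp).const_mul
    (τ ^ (-(3 / 2) : ℝ))
  refine h.congr_deriv ?_
  simp only [kern₁, kern, Pi.neg_apply]; ring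

lemma hasDerivAt_kern₁ (α τ : ℝ) (i : Fin 3) (x : Torus) (s : ℝ) :
    HasDerivAt (fun r => kern₁ α τ i (shift i r x)) (kern₂ α τ i (shift i s x)) s := by
  have h := ((((hasDerivAt_circSin_shift i x s).const_mul (2 * Real.pi)).const_mul (α / τ)).neg).mul
    (hasDerivAt_kern α τ i x s)
  refine h.congr_deriv ?_
  simp only [kern₁, kern₂, Pi.neg_apply]; ring

lemma hasDerivAt_kern_time (α : ℝ) {τ : ℝ} (hτ : 0 < τ) (x : Torus) :
    HasDerivAt (fun τ => kern α τ x) (kernTime α τ x) τ := by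
  have h1 : HasDerivAt (fun τ : ℝ => τ ^ (-(3 / 2) : ℝ))
      (-(3 / 2) * τ ^ (-(3 / 2) - 1 : ℝ)) τ := Real.hasDerivAt_rpow_const (Or.inl hτ.ne')
  have h2 : HasDerivAt (fun τ : ℝ => -(α / τ * torusWeight x)) (α / τ ^ 2 * torusWeight x) τ := by
    have := (((hasDerivAt_inv hτ.ne').const_mul α).mul_const (torusWeight x)).neg
    simp only [← div_eq_mul_inv] at this
    exact this.congr_deriv (by ring)
  refine (h1.mul h2.exp).congr_deriv ?_
  rw [Real.rpow_sub_one hτ.ne']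
  simp only [kernTime, kern]
  field_simp

lemma continuous_kern₁ (α τ : ℝ) (i : Fin 3) : Continuous (kern₁ α τ i) :=
  ((continuous_const.mul (continuous_const.mul
    (continuous_circSin.comp (continuous_apply i)))).neg).mul (continuous_kern α τ)

lemma continuous_kern₂ (α τ : ℝ) (i : Fin 3) : Continuous (kern₂ α τ i) :=
  (((continuous_const.mul (continuous_const.mul
    (continuous_circSin.comp (continuous_apply i)))).pow 2).sub (continuous_const.mul
      (continuous_const.mul (continuous_circCos.comp (continuous_apply i))))).mul
    (continuous_kern α τ)

lemma continuousOn_kernTime (α : ℝ) :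
    ContinuousOn (fun p : ℝ × Torus => kernTime α p.1 p.2) (Ioi 0 ×ˢ univ) := by
  unfold kernTime
  refine ContinuousOn.mul ?_ (continuousOn_kern α)
  intro p hp
  have hp0 : p.1 ≠ 0 := ne_of_gt hp.1
  refine ContinuousAt.continuousWithinAt (ContinuousAt.add ?_ (ContinuousAt.mul ?_ (by fun_prop)))
  · exact (continuousAt_const.div (continuousAt_const.mul continuousAt_fst)
      (mul_ne_zero two_ne_zero hp0)).neg
  · exact continuousAt_const.div (continuousAt_fst.pow 2) (pow_ne_zero 2 hp0)

/-- The kernel is a supersolution of the heat equation with a bounded zeroth order term. -/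
lemma sum_kern₂_le {τ : ℝ} (hτ : 0 < τ) (x : Torus) :
    ∑ i, kern₂ heatExp τ i x - kernTime heatExp τ x ≤ 3 * Real.pi ^ 2 * kern heatExp τ x := by
  have hk := kern_pos heatExp hτ x
  -- in each variable the difference of the two sides is a square
  have key : ∀ i : Fin 3, (heatExp / τ * (2 * Real.pi * circSin (x i))) ^ 2
      - heatExp / τ * (4 * Real.pi ^ 2 * circCos (x i))
      - (-(1 / (2 * τ)) + heatExp / τ ^ 2 * (1 - circCos (x i))) ≤ Real.pi ^ 2 := by
    intro i
    set c := circCos (x i) with hc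
    have hs := circSin_sq (x i)
    have e1 : (heatExp / τ * (2 * Real.pi * circSin (x i))) ^ 2
        = (4 * Real.pi ^ 2 * heatExp) * heatExp / τ ^ 2 * circSin (x i) ^ 2 := by ring
    have e2 : heatExp / τ * (4 * Real.pi ^ 2 * c) = (4 * Real.pi ^ 2 * heatExp) * c / τ := by ring
    rw [e1, e2, heatExp_mul, hs]
    have hpi : Real.pi ^ 2 = 1 / (8 * heatExp) := by
      unfold heatExp
      have := Real.pi_pos.ne'
      field_simp
    have ha := heatExp_pos
    have e3 : 1 / (8 * heatExp) - (1 / 2 * heatExp / τ ^ 2 * ((1 - c) * (1 + c)) - 1 / 2 * c / τ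
        - (-(1 / (2 * τ)) + heatExp / τ ^ 2 * (1 - c)))
        = (2 * heatExp * ((1 - c) / τ) - 1) ^ 2 / (8 * heatExp) := by
      field_simp; ring
    have e4 : 0 ≤ (2 * heatExp * ((1 - c) / τ) - 1) ^ 2 / (8 * heatExp) := by positivity
    rw [hpi]; linarith
  have h0 := mul_le_mul_of_nonneg_right (key 0) hk.le
  have h1 := mul_le_mul_of_nonneg_right (key 1) hk.le
  have h2 := mul_le_mul_of_nonneg_right (key 2) hk.le
  have e : (-(3 / (2 * τ)) + heatExp / τ ^ 2 * torusWeight x)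
      = ∑ i : Fin 3, (-(1 / (2 * τ)) + heatExp / τ ^ 2 * (1 - circCos (x i))) := by
    rw [torusWeight, Fin.sum_univ_three, Fin.sum_univ_three]
    field_simp; ring
  simp only [kern₂, kernTime, e, Fin.sum_univ_three]
  linarith

/-- The gradient of the kernel is bounded by a wider kernel, because `y e^{-y} ≤ 1`. -/
lemma abs_kern₁_le {τ : ℝ} (hτ : 0 < τ) (i : Fin 3) (x : Torus) :
    |kern₁ heatExp τ i x| ≤ τ ^ (-(1 / 2) : ℝ) * kern (heatExp / 2) τ x := by
  have hk := kern_pos (heatExp / 2) hτ x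
  have ha := heatExp_pos
  have hW := torusWeight_nonneg x
  refine abs_le_of_sq_le_sq ?_ (by positivity)
  set y := heatExp / τ * torusWeight x with hy
  have hy0 : 0 ≤ y := by positivity
  have e1 : kern heatExp τ x ^ 2 = kern (heatExp / 2) τ x ^ 2 * Real.exp (-y) := by
    simp only [kern, mul_pow, ← Real.exp_nat_mul, mul_assoc, ← Real.exp_add, ← hy]
    congr 2
    rw [hy]; push_cast; ring
  have e2 : (τ ^ (-(1 / 2) : ℝ)) ^ 2 = τ⁻¹ := by
    rw [← Real.rpow_natCast, ← Real.rpow_mul hτ.le, ← Real.rpow_neg_one]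
    norm_num
  have hs : circSin (x i) ^ 2 ≤ 2 * torusWeight x := by
    have h1 : 1 - circCos (x i) ≤ torusWeight x :=
      Finset.single_le_sum (f := fun i => 1 - circCos (x i))
        (fun j _ => sub_nonneg.2 (circCos_le_one _)) (Finset.mem_univ i)
    rw [circSin_sq]
    nlinarith [circCos_le_one (x i)]
  have hexp : y * Real.exp (-y) ≤ 1 := by
    rw [Real.exp_neg, ← div_eq_mul_inv, div_le_one (Real.exp_pos y)]
    linarith [Real.add_one_le_exp y]
  have e3 : kern₁ heatExp τ i x ^ 2
      = (4 * Real.pi ^ 2 * heatExp) * (heatExp / τ ^ 2 * circSin (x i) ^ 2)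
        * kern heatExp τ x ^ 2 := by
    simp only [kern₁]; ring
  rw [e3, heatExp_mul, mul_pow, e2, e1]
  calc 1 / 2 * (heatExp / τ ^ 2 * circSin (x i) ^ 2)
        * (kern (heatExp / 2) τ x ^ 2 * Real.exp (-y))
      ≤ 1 / 2 * (heatExp / τ ^ 2 * (2 * torusWeight x))
        * (kern (heatExp / 2) τ x ^ 2 * Real.exp (-y)) := by gcongr
    _ = τ⁻¹ * kern (heatExp / 2) τ x ^ 2 * (y * Real.exp (-y)) := by
        rw [hy]; field_simp
    _ ≤ τ⁻¹ * kern (heatExp / 2) τ x ^ 2 * 1 := by gcongr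
    _ = _ := by ring

/-- Comparison with a Gaussian integral, by `1 - cos 2πr ≥ 8 r²` for `|r| ≤ 1/2`. -/
lemma integral_circle_le {β : ℝ} (hβ : 0 < β) :
    ∫ z : UnitAddCircle, Real.exp (-(β * (1 - circCos z))) ≤ √(Real.pi / (8 * β)) := by
  rw [← UnitAddCircle.integral_preimage (-(1 / 2)), ← integral_gaussian (8 * β)]
  refine (setIntegral_mono_on ?_ ?_ measurableSet_Ioc fun r hr => ?_).trans
    (setIntegral_le_integral (integrable_exp_neg_mul_sq (by positivity))
      (Eventually.of_forall fun r => (Real.exp_pos _).le))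
  · refine Continuous.integrableOn_Ioc ?_
    have := continuous_circCos.comp (AddCircle.continuous_mk' 1)
    exact Real.continuous_exp.comp ((continuous_const.mul (continuous_const.sub this)).neg)
  · exact (integrable_exp_neg_mul_sq (by positivity)).integrableOn
  · rw [circCos_coe]
    have hr' : |2 * Real.pi * r| ≤ Real.pi := by
      have h1 : |r| ≤ 1 / 2 := abs_le.2 ⟨hr.1.le, by linarith [hr.2]⟩
      rw [abs_mul, abs_of_pos (by positivity)]
      nlinarith [Real.pi_pos]
    have h2 := Real.cos_le_one_sub_mul_cos_sq hr'
    have h3 : 2 / Real.pi ^ 2 * (2 * Real.pi * r) ^ 2 = 8 * r ^ 2 := by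
      have := Real.pi_pos.ne'
      field_simp; ring
    rw [h3] at h2
    gcongr
    nlinarith

/-- A bound for the mass of the kernels, uniform in `τ`. -/
lemma exists_integral_kern_le {α : ℝ} (hα : 0 < α) :
    ∃ C : ℝ, 0 < C ∧ ∀ τ : ℝ, 0 < τ → ∫ x, kern α τ x ≤ C := by
  refine ⟨√(Real.pi / (8 * α)) ^ 3, by positivity, fun τ hτ => ?_⟩
  have e : ∀ x, kern α τ x
      = ∏ i, (τ ^ (-(1 / 2) : ℝ) * Real.exp (-(α / τ * (1 - circCos (x i))))) := by
    intro x
    rw [Finset.prod_mul_distrib, ← Real.exp_sum, kern, torusWeight, Finset.mul_sum,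
      Finset.sum_neg_distrib]
    congr 1
    rw [Finset.prod_const, ← Real.rpow_natCast, ← Real.rpow_mul hτ.le]
    norm_num
  simp_rw [e]
  rw [integral_fintype_prod_volume_eq_prod (ι := Fin 3) (E := fun _ => UnitAddCircle)
    (fun i (z : UnitAddCircle) => τ ^ (-(1 / 2) : ℝ) * Real.exp (-(α / τ * (1 - circCos z))))]
  rw [Finset.prod_const, Finset.card_univ, Fintype.card_fin]
  refine pow_le_pow_left₀ (integral_nonneg fun z => ?_) ?_ 3
  · exact mul_nonneg (Real.rpow_nonneg hτ.le _) (Real.exp_pos _).le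
  rw [integral_const_mul]
  calc _ ≤ τ ^ (-(1 / 2) : ℝ) * √(Real.pi / (8 * (α / τ))) := by
        gcongr; exact integral_circle_le (by positivity)
    _ = √(Real.pi / (8 * α)) := by
        rw [Real.rpow_neg hτ.le, ← Real.sqrt_eq_rpow, show Real.pi / (8 * (α / τ))
          = τ * (Real.pi / (8 * α)) by field_simp, Real.sqrt_mul hτ.le]
        have := Real.sqrt_ne_zero'.2 hτ
        field_simp

/-- The kernel concentrates at the origin with mass at least one: at time `ρ²` the ball of radius
`ρ`, of volume `8 ρ³`, already carries the mass `8 e^(-3/4) ≥ 1`. -/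
lemma le_of_integral_kern_le {f : Torus → ℝ} (hf : Continuous f) (h0 : ∀ x, 0 ≤ f x) (x₀ : Torus)
    {B : ℝ} (hB : ∀ ε : ℝ, 0 < ε → ∫ x, f x * kern heatExp ε (x - x₀) ≤ B) : f x₀ ≤ B := by
  refine le_of_forall_pos_sub_le fun η hη => ?_
  by_cases hneg : f x₀ - η ≤ 0
  · exact hneg.trans ((integral_nonneg fun x => mul_nonneg (h0 x) (kern_pos _ one_pos _).le).trans
      (hB 1 one_pos))
  push Not at hneg
  obtain ⟨δ, hδ, hball⟩ := Metric.continuous_iff.1 hf x₀ η hη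
  set ρ := min (δ / 2) (1 / 4) with hρ
  have hρ0 : 0 < ρ := by positivity
  have hkc : Continuous fun x => kern heatExp (ρ ^ 2) (x - x₀) :=
    (continuous_kern _ _).comp (continuous_id.sub continuous_const)
  have hvol : volume.real (Metric.closedBall x₀ ρ) = (2 * ρ) ^ 3 := by
    rw [measureReal_def, volume_pi, Measure.pi_closedBall _ _ hρ0.le]
    have : ∀ z : UnitAddCircle,
        volume (Metric.closedBall z ρ) = ENNReal.ofReal (2 * ρ) := fun z => by
      rw [AddCircle.volume_closedBall, min_eq_right]
      have : ρ ≤ 1 / 4 := min_le_right _ _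
      linarith
    simp only [this, Finset.prod_const, Finset.card_univ, Fintype.card_fin]
    rw [ENNReal.toReal_pow, ENNReal.toReal_ofReal (by positivity)]
  have hlow : ∀ x ∈ Metric.closedBall x₀ ρ,
      (f x₀ - η) * (ρ ^ (-3 : ℝ) * Real.exp (-(3 / 4))) ≤ f x * kern heatExp (ρ ^ 2) (x - x₀) := by
    intro x hx
    have hdist : dist x x₀ ≤ ρ := hx
    have h1 : f x₀ - η ≤ f x := by
      have hlt : dist x x₀ < δ := hdist.trans_lt (by
        have : ρ ≤ δ / 2 := min_le_left _ _
        linarith)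
      have := hball x hlt
      rw [Real.dist_eq, abs_lt] at this
      linarith [this.1]
    have hW : torusWeight (x - x₀) ≤ 6 * Real.pi ^ 2 * ρ ^ 2 := by
      have hc : ∀ i, 1 - circCos ((x - x₀) i) ≤ 2 * Real.pi ^ 2 * ρ ^ 2 := fun i => by
        refine (circCos_ge _).trans ?_
        have : ‖(x - x₀) i‖ ≤ ρ := (norm_le_pi_norm (x - x₀) i).trans (by rwa [← dist_eq_norm])
        gcongr
      rw [torusWeight, Fin.sum_univ_three]
      linarith [hc 0, hc 1, hc 2]
    have h2 : ρ ^ (-3 : ℝ) * Real.exp (-(3 / 4)) ≤ kern heatExp (ρ ^ 2) (x - x₀) := by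
      unfold kern
      have e1 : (ρ ^ 2) ^ (-(3 / 2) : ℝ) = ρ ^ (-3 : ℝ) := by
        rw [← Real.rpow_natCast, ← Real.rpow_mul hρ0.le]; norm_num
      rw [e1]
      gcongr
      calc heatExp / ρ ^ 2 * torusWeight (x - x₀)
          ≤ heatExp / ρ ^ 2 * (6 * Real.pi ^ 2 * ρ ^ 2) := by
            have := heatExp_pos
            gcongr
        _ = 3 / 2 * (4 * Real.pi ^ 2 * heatExp) := by field_simp; ring
        _ = 3 / 4 := by rw [heatExp_mul]; norm_num
    exact mul_le_mul h1 h2 (by positivity) (h0 x)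
  have hint : Integrable fun x => f x * kern heatExp (ρ ^ 2) (x - x₀) :=
    continuous_integrable (hf.mul hkc)
  have h1 : (f x₀ - η) * (ρ ^ (-3 : ℝ) * Real.exp (-(3 / 4))) * (2 * ρ) ^ 3
      ≤ ∫ x, f x * kern heatExp (ρ ^ 2) (x - x₀) := by
    rw [← hvol]
    calc _ = ∫ x in Metric.closedBall x₀ ρ, (f x₀ - η) * (ρ ^ (-3 : ℝ) * Real.exp (-(3 / 4))) := by
          rw [setIntegral_const, smul_eq_mul, mul_comm]
      _ ≤ ∫ x in Metric.closedBall x₀ ρ, f x * kern heatExp (ρ ^ 2) (x - x₀) :=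
          setIntegral_mono_on (integrable_const _) hint.integrableOn
            Metric.isClosed_closedBall.measurableSet hlow
      _ ≤ _ := setIntegral_le_integral hint (Eventually.of_forall fun x =>
          mul_nonneg (h0 x) (kern_pos _ (by positivity) _).le)
  have h2 := h1.trans (hB (ρ ^ 2) (by positivity))
  have e3 : ρ ^ (-3 : ℝ) * (2 * ρ) ^ 3 = 8 := by
    rw [show (-3 : ℝ) = -((3 : ℕ) : ℝ) by norm_num, Real.rpow_neg hρ0.le, Real.rpow_natCast]
    field_simp; norm_num
  have hexp : 1 ≤ Real.exp (-(3 / 4)) * 8 := by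
    linarith [Real.add_one_le_exp (-(3 / 4) : ℝ)]
  calc f x₀ - η ≤ (f x₀ - η) * (Real.exp (-(3 / 4)) * 8) := le_mul_of_one_le_right hneg.le hexp
    _ = (f x₀ - η) * (ρ ^ (-3 : ℝ) * Real.exp (-(3 / 4))) * (2 * ρ) ^ 3 := by rw [← e3]; ring
    _ ≤ B := h2

section

/-! ### Pointwise bounds by duality with the kernel -/

lemma shift_sub (i : Fin 3) (s : ℝ) (x x₀ : Torus) : shift i s x - x₀ = shift i s (x - x₀) := by
  simp only [shift]; abel

lemma lineDeriv_kern (α τ : ℝ) (x₀ : Torus) (i : Fin 3) (c : ℝ) :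
    LineDeriv i (fun x => c * kern α τ (x - x₀)) (fun x => c * kern₁ α τ i (x - x₀)) :=
  lineDeriv_of_hasDerivAt (fun x s => by
    simp only [shift_sub]; exact (hasDerivAt_kern α τ i (x - x₀) s).const_mul c)
    (continuous_const.mul ((continuous_kern₁ α τ i).comp (continuous_id.sub continuous_const)))

lemma lineDeriv_kern₁ (α τ : ℝ) (x₀ : Torus) (i : Fin 3) (c : ℝ) :
    LineDeriv i (fun x => c * kern₁ α τ i (x - x₀)) (fun x => c * kern₂ α τ i (x - x₀)) :=
  lineDeriv_of_hasDerivAt (fun x s => by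
    simp only [shift_sub]; exact (hasDerivAt_kern₁ α τ i (x - x₀) s).const_mul c)
    (continuous_const.mul ((continuous_kern₂ α τ i).comp (continuous_id.sub continuous_const)))

lemma integral_sub_right (f : Torus → ℝ) (x₀ : Torus) : ∫ x, f (x - x₀) = ∫ x, f x :=
  integral_sub_right_eq_self f x₀

lemma abs_apply_le_norm (v : Vec) (i : Fin 3) : |v i| ≤ ‖v‖ := by
  simpa using PiLp.norm_apply_le v i

variable {γ T : ℝ} {ϱ : ℝ → Torus → ℝ} {v : ℝ → Torus → Vec} {ϱt : ℝ → Torus → ℝ}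
  {vt : ℝ → Torus → Vec} {a : ℝ → Fin 3 → Torus → ℝ} {b : ℝ → Fin 3 → Fin 3 → Torus → ℝ}

/-- Pointwise estimate for `G(ϱ)` at time `T`, by testing the renormalised mass equation with
`e^(-3π²s)` times the kernel at time `T + ε - s` and letting `ε` tend to zero. The transport term is
estimated with the wider kernel, the gradient of `ϱ` is absorbed by the convexity of `G`. -/
lemma Evolution.comp_density_le (h : Evolution γ T ϱ v ϱt vt a b) (hT : 0 < T)
    {G G' G'' H : ℝ → ℝ} {c R C₀ M₀ : ℝ} {B : ℝ → ℝ}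
    (hG : ∀ y ∈ Ioi (0 : ℝ), HasDerivAt G (G' y) y)
    (hG' : ∀ y ∈ Ioi (0 : ℝ), HasDerivAt G' (G'' y) y) (hG'' : ContinuousOn G'' (Ioi 0))
    (hR : ∀ s ∈ Icc (0 : ℝ) T, ∀ x, ϱ s x ≤ R) (hG0 : ∀ y ∈ Ioc 0 R, 0 ≤ G y) (hc : 0 ≤ c)
    (hconv : ∀ y ∈ Ioc 0 R, ∀ A V : ℝ, G'' y * (A * (y * V - A)) ≤ c * V ^ 2)
    (hH : ∀ y ∈ Ioc 0 R, |G' y * y| ≤ H y) (hHc : ContinuousOn H (Ioi 0))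
    (hC₀ : ∀ τ : ℝ, 0 < τ → ∫ x, kern (heatExp / 2) τ x ≤ C₀)
    (hM₀ : ∀ x, G (ϱ 0 x) ≤ M₀) (hBi : IntervalIntegrable B volume 0 T)
    (hB : ∀ r ∈ Ico 0 T, ∀ τ : ℝ, T - r ≤ τ → ∀ x₀ : Torus,
      ∫ x, (c * ‖v r x‖ ^ 2 + 3 * τ ^ (-(1 / 2) : ℝ) * (H (ϱ r x) * ‖v r x‖))
        * kern (heatExp / 2) τ (x - x₀) ≤ B r) (x₀ : Torus) :
    G (ϱ T x₀) ≤ Real.exp (3 * Real.pi ^ 2 * T) * (C₀ * M₀ + ∫ r in (0 : ℝ)..T, B r) := by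
  set κ := 3 * Real.pi ^ 2 with hκ
  have hκ0 : 0 ≤ κ := by positivity
  have h0T : (0 : ℝ) ∈ Icc 0 T := ⟨le_rfl, hT.le⟩
  have hTT : T ∈ Icc 0 T := ⟨hT.le, le_rfl⟩
  have cG : ContinuousOn G (Ioi 0) := fun y hy => (hG y hy).continuousAt.continuousWithinAt
  have cG' : ContinuousOn G' (Ioi 0) := fun y hy => (hG' y hy).continuousAt.continuousWithinAt
  have hϱ : ∀ s ∈ Icc (0 : ℝ) T, ∀ x, ϱ s x ∈ Ioc 0 R := fun s hs x =>
    ⟨(h.state s hs).pos x, hR s hs x⟩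
  refine le_of_integral_kern_le ((h.state T hTT).cont_comp cG)
    (fun x => hG0 _ (hϱ T hTT x)) x₀ fun ε hε => ?_
  have hτ : ∀ s ∈ Icc (0 : ℝ) T, 0 < T + ε - s := fun s hs => by linarith [hs.2]
  have hmap : MapsTo (fun p : ℝ × Torus => (T + ε - p.1, p.2 - x₀)) (Icc (0 : ℝ) T ×ˢ univ)
      (Ioi 0 ×ˢ univ) := fun p hp => ⟨hτ p.1 hp.1, mem_univ _⟩
  have hmapc : Continuous fun p : ℝ × Torus => (T + ε - p.1, p.2 - x₀) := by fun_prop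
  have hexpc : Continuous fun p : ℝ × Torus => Real.exp (-(κ * p.1)) := by fun_prop
  have hψc := hexpc.continuousOn.mul ((continuousOn_kern heatExp).comp hmapc.continuousOn hmap)
  have hψtc : ContinuousOn (Function.uncurry fun s x =>
      -(κ * (Real.exp (-(κ * s)) * kern heatExp (T + ε - s) (x - x₀))) -
        Real.exp (-(κ * s)) * kernTime heatExp (T + ε - s) (x - x₀)) (Icc (0 : ℝ) T ×ˢ univ) :=
    ((continuousOn_const.mul hψc).neg).sub
      (hexpc.continuousOn.mul ((continuousOn_kernTime heatExp).comp hmapc.continuousOn hmap))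
  have hx₀ : Continuous fun x : Torus => x - x₀ := continuous_id.sub continuous_const
  obtain ⟨F, hFi, hF, hFr⟩ := h.renormalized_sub_eq hG hG' hG''
    (ψ := fun s x => Real.exp (-(κ * s)) * kern heatExp (T + ε - s) (x - x₀))
    (ψ₁ := fun s i x => Real.exp (-(κ * s)) * kern₁ heatExp (T + ε - s) i (x - x₀))
    (ψ₂ := fun s i x => Real.exp (-(κ * s)) * kern₂ heatExp (T + ε - s) i (x - x₀))
    hψc hψtc (fun x s hs => by
      have h1 : HasDerivAt (fun s => Real.exp (-(κ * s))) (Real.exp (-(κ * s)) * -κ) s := by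
        have := ((hasDerivAt_id s).const_mul κ).neg.exp
        simpa using this
      have h2 : HasDerivAt (fun s => kern heatExp (T + ε - s) (x - x₀))
          (kernTime heatExp (T + ε - s) (x - x₀) * -1) s :=
        HasDerivAt.comp s (hasDerivAt_kern_time heatExp (hτ s hs) (x - x₀))
          ((hasDerivAt_id s).const_sub (T + ε))
      refine (h1.mul h2).congr_deriv ?_
      ring)
    (fun s _ i => continuous_const.mul ((continuous_kern₁ _ _ i).comp hx₀))
    (fun s _ i => continuous_const.mul ((continuous_kern₂ _ _ i).comp hx₀))
    (fun s _ i => lineDeriv_kern _ _ x₀ i _) (fun s _ i => lineDeriv_kern₁ _ _ x₀ i _) hTT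
  have hFB : ∀ᵐ r ∂(volume.restrict (Icc (0 : ℝ) T)), F r ≤ B r := by
    have hne : ∀ᵐ r ∂(volume.restrict (Icc (0 : ℝ) T)), r ≠ T :=
      ae_restrict_of_ae (by simp [ae_iff])
    filter_upwards [hFr, ae_restrict_mem measurableSet_Icc, hne] with r hr hrm hrT
    have hst := h.state r hrm
    have hτr := hτ r hrm
    set τ := T + ε - r with hτdef
    refine le_trans ?_ (hB r ⟨hrm.1, lt_of_le_of_ne hrm.2 hrT⟩ τ (by linarith) x₀)
    have he0 : 0 ≤ Real.exp (-(κ * r)) := (Real.exp_pos _).le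
    have he1 : Real.exp (-(κ * r)) ≤ 1 := Real.exp_le_one_iff.2 (by
      have := mul_nonneg hκ0 hrm.1; linarith)
    set e := Real.exp (-(κ * r)) with hedef
    have hk : Continuous fun x => e * kern heatExp τ (x - x₀) :=
      continuous_const.mul ((continuous_kern _ _).comp hx₀)
    have hk₁ : ∀ i, Continuous fun x => e * kern₁ heatExp τ i (x - x₀) := fun i =>
      continuous_const.mul ((continuous_kern₁ _ _ i).comp hx₀)
    have hk₂ : ∀ i, Continuous fun x => e * kern₂ heatExp τ i (x - x₀) := fun i =>
      continuous_const.mul ((continuous_kern₂ _ _ i).comp hx₀)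
    have hv := hst.contv_apply
    have i1 : Integrable fun x => ∑ i, (G'' (ϱ r x) * (e * kern heatExp τ (x - x₀)) *
        (a r i x * (ϱ r x * v r x i - a r i x))
        + G' (ϱ r x) * (ϱ r x * v r x i) * (e * kern₁ heatExp τ i (x - x₀))
        + G (ϱ r x) * (e * kern₂ heatExp τ i (x - x₀))) := by
      refine integrable_finsetSum _ fun i _ => Integrable.add (Integrable.add ?_ ?_) ?_
      · exact integrable_continuous_mul ((hst.cont_comp hG'').mul hk)
          (integrable_mul_of_memLp_two (hst.a2 i)
            ((continuous_memLp (hst.cont.mul (hv i)) 2).sub (hst.a2 i)))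
      · exact continuous_integrable (((hst.cont_comp cG').mul (hst.cont.mul (hv i))).mul (hk₁ i))
      · exact continuous_integrable ((hst.cont_comp cG).mul (hk₂ i))
    have i2 : Integrable fun x => G (ϱ r x) * (-(κ * (e * kern heatExp τ (x - x₀))) -
        e * kernTime heatExp τ (x - x₀)) := by
      refine continuous_integrable ((hst.cont_comp cG).mul ?_)
      refine hψtc.comp_continuous (f := fun x => (r, x)) (by fun_prop) fun x => ⟨hrm, mem_univ x⟩
    rw [hr, ← integral_add i1 i2]
    refine integral_mono (i1.add i2) ?_ fun x => ?_
    · refine continuous_integrable (((continuous_const.mul (hst.contv.norm.pow 2)).add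
        (continuous_const.mul ((hst.cont_comp hHc).mul hst.contv.norm))).mul
        ((continuous_kern _ _).comp hx₀))
    · have hy := hϱ r hrm x
      have hkp := kern_pos heatExp hτr (x - x₀)
      have hkm := kern_mono (show heatExp / 2 ≤ heatExp by linarith [heatExp_pos]) hτr (x - x₀)
      have hkt := kern_pos (heatExp / 2) hτr (x - x₀)
      set K := kern heatExp τ (x - x₀)
      set Kt := kern (heatExp / 2) τ (x - x₀)
      have hH0 : 0 ≤ H (ϱ r x) := (abs_nonneg _).trans (hH _ hy)
      -- the terms with `G` have a sign, since the kernel is a supersolution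
      have s1 : G (ϱ r x) * (∑ i, e * kern₂ heatExp τ i (x - x₀) + (-(κ * (e * K)) -
          e * kernTime heatExp τ (x - x₀))) ≤ 0 := by
        refine mul_nonpos_of_nonneg_of_nonpos (hG0 _ hy) ?_
        have := mul_le_mul_of_nonneg_left (sum_kern₂_le hτr (x - x₀)) he0
        rw [← Finset.mul_sum]
        linarith
      have s2 : ∀ i, G'' (ϱ r x) * (e * K) * (a r i x * (ϱ r x * v r x i - a r i x))
          ≤ c * v r x i ^ 2 * Kt := fun i => by
        have h1 := mul_le_mul_of_nonneg_right (hconv _ hy (a r i x) (v r x i))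
          (mul_nonneg he0 hkp.le)
        have h2 : e * K ≤ Kt := (mul_le_of_le_one_left hkp.le he1).trans hkm
        have h3 := mul_le_mul_of_nonneg_left h2 (show 0 ≤ c * v r x i ^ 2 by positivity)
        linarith
      have s3 : ∀ i, G' (ϱ r x) * (ϱ r x * v r x i) * (e * kern₁ heatExp τ i (x - x₀))
          ≤ H (ϱ r x) * ‖v r x‖ * (τ ^ (-(1 / 2) : ℝ) * Kt) := fun i => by
        refine (le_abs_self _).trans ?_
        rw [← mul_assoc (G' (ϱ r x)), abs_mul, abs_mul, abs_mul e, abs_of_nonneg he0]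
        have h1 := hH _ hy
        have h2 := abs_apply_le_norm (v r x) i
        have h3 : e * |kern₁ heatExp τ i (x - x₀)| ≤ τ ^ (-(1 / 2) : ℝ) * Kt :=
          (mul_le_of_le_one_left (abs_nonneg _) he1).trans (abs_kern₁_le hτr i (x - x₀))
        gcongr
      have hnorm : ‖v r x‖ ^ 2 = ∑ i, v r x i ^ 2 := by
        simp [EuclideanSpace.norm_sq_eq]
      have t0 := s2 0; have t1 := s2 1; have t2 := s2 2
      have u0 := s3 0; have u1 := s3 1; have u2 := s3 2
      simp only [Fin.sum_univ_three] at s1 ⊢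
      rw [hnorm, Fin.sum_univ_three]
      linarith
  have hmono := intervalIntegral.integral_mono_ae_restrict hT.le hFi hBi hFB
  have e1 : ∫ x, G (ϱ T x) * (Real.exp (-(κ * T)) * kern heatExp (T + ε - T) (x - x₀))
      = Real.exp (-(κ * T)) * ∫ x, G (ϱ T x) * kern heatExp ε (x - x₀) := by
    rw [← integral_const_mul]
    congr 1; ext x
    rw [show T + ε - T = ε by ring]; ring
  have e2 : ∫ x, G (ϱ 0 x) * (Real.exp (-(κ * 0)) * kern heatExp (T + ε - 0) (x - x₀))
      ≤ C₀ * M₀ := by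
    have hM0 : 0 ≤ M₀ := (hG0 _ (hϱ 0 h0T x₀)).trans (hM₀ x₀)
    have hTε : 0 < T + ε - 0 := hτ 0 h0T
    calc _ ≤ ∫ x, M₀ * kern (heatExp / 2) (T + ε - 0) (x - x₀) := by
          refine integral_mono (continuous_integrable (((h.state 0 h0T).cont_comp cG).mul
            (continuous_const.mul ((continuous_kern _ _).comp hx₀))))
            (continuous_integrable (continuous_const.mul ((continuous_kern _ _).comp hx₀)))
            fun x => ?_
          have hkm := kern_mono (show heatExp / 2 ≤ heatExp by linarith [heatExp_pos]) hTε (x - x₀)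
          have hkp := kern_pos heatExp hTε (x - x₀)
          simp only [mul_zero, neg_zero, Real.exp_zero, one_mul]
          exact mul_le_mul (hM₀ x) hkm hkp.le hM0
      _ ≤ C₀ * M₀ := by
          rw [integral_const_mul, integral_sub_right (kern (heatExp / 2) (T + ε - 0)), mul_comm]
          exact mul_le_mul_of_nonneg_right (hC₀ _ hTε) hM0
  have e3 : Real.exp (-(κ * T)) * (∫ x, G (ϱ T x) * kern heatExp ε (x - x₀))
      ≤ C₀ * M₀ + ∫ r in (0 : ℝ)..T, B r := by
    rw [← e1]; linarith
  have e4 : Real.exp (κ * T) * Real.exp (-(κ * T)) = 1 := by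
    rw [← Real.exp_add]; simp
  calc ∫ x, G (ϱ T x) * kern heatExp ε (x - x₀)
      = Real.exp (κ * T) * (Real.exp (-(κ * T)) * ∫ x, G (ϱ T x) * kern heatExp ε (x - x₀)) := by
        rw [← mul_assoc, e4, one_mul]
    _ ≤ _ := mul_le_mul_of_nonneg_left e3 (Real.exp_pos _).le

end

section

/-! ### Hölder and Sobolev inequalities on the torus -/

lemma memLp_rpow_of_integrable {f : Torus → ℝ} (hf : Integrable f) (f0 : ∀ x, 0 ≤ f x) {θ : ℝ}
    (h0 : 0 < θ) : MemLp (fun x => f x ^ θ) (ENNReal.ofReal (1 / θ)) volume := by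
  have := (memLp_one_iff_integrable.2 hf).norm_rpow_div (ENNReal.ofReal θ)
  rw [ENNReal.toReal_ofReal h0.le, ← ENNReal.ofReal_one, ← ENNReal.ofReal_div_of_pos h0] at this
  refine this.congr_norm ?_ ?_
  · exact this.1.congr (Eventually.of_forall fun x => by simp [abs_of_nonneg (f0 x)])
  · exact Eventually.of_forall fun x => by simp [abs_of_nonneg (f0 x)]

/-- Hölder's inequality in the form of an interpolation inequality. -/
lemma integral_rpow_mul_rpow_le {f g : Torus → ℝ} (hf : Integrable f) (hg : Integrable g)
    (f0 : ∀ x, 0 ≤ f x) (g0 : ∀ x, 0 ≤ g x) {θ : ℝ} (h0 : 0 < θ) (h1 : θ < 1) :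
    ∫ x, f x ^ θ * g x ^ (1 - θ) ≤ (∫ x, f x) ^ θ * (∫ x, g x) ^ (1 - θ) := by
  have h2 : 0 < 1 - θ := by linarith
  have hpq : (1 / θ).HolderConjugate (1 / (1 - θ)) := by
    rw [Real.holderConjugate_iff]
    refine ⟨by rw [lt_div_iff₀ h0]; linarith, by simp⟩
  have := integral_mul_le_Lp_mul_Lq_of_nonneg hpq
    (Eventually.of_forall fun x => Real.rpow_nonneg (f0 x) θ)
    (Eventually.of_forall fun x => Real.rpow_nonneg (g0 x) (1 - θ))
    (memLp_rpow_of_integrable hf f0 h0) (memLp_rpow_of_integrable hg g0 h2)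
  have e1 : ∀ x, (f x ^ θ) ^ (1 / θ) = f x := fun x => by
    rw [← Real.rpow_mul (f0 x), mul_one_div_cancel h0.ne', Real.rpow_one]
  have e2 : ∀ x, (g x ^ (1 - θ)) ^ (1 / (1 - θ)) = g x := fun x => by
    rw [← Real.rpow_mul (g0 x), mul_one_div_cancel h2.ne', Real.rpow_one]
  simpa only [e1, e2, one_div_one_div] using this

/-- The integral along a closed line is the integral over one coordinate. -/
lemma lintegral_line_eq (i : Fin 3) (x : Torus) (h : Torus → ℝ≥0∞) :
    ∫⁻ s in Ioc (0 : ℝ) 1, h (shift i s x) = ∫⁻ y : UnitAddCircle, h (Function.update x i y) := by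
  have e : ∀ s : ℝ, shift i s x = Function.update x i (x i + (s : UnitAddCircle)) := fun s => by
    ext j
    by_cases hj : j = i
    · subst hj; simp [shift]
    · simp [shift, hj]
  have := UnitAddCircle.lintegral_preimage 0 fun b => h (Function.update x i (x i + b))
  simp only [e]
  rw [zero_add] at this
  rw [this, lintegral_add_left_eq_self (fun b => h (Function.update x i b)) (x i)]

/-- On almost every line, a function is at most the mean of itself plus its total variation. -/
lemma LineDeriv.le_lintegral_line {i : Fin 3} {f g : Torus → ℝ} (h : LineDeriv i f g)
    (hf : Continuous f) :
    ∀ᵐ x : Torus, ENNReal.ofReal (f x)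
      ≤ ∫⁻ y : UnitAddCircle, (ENNReal.ofReal (f (Function.update x i y))
          + ‖g (Function.update x i y)‖ₑ) := by
  filter_upwards [h.isPrim_line hf] with x hx
  rw [← lintegral_line_eq i x fun z => ENNReal.ofReal (f z) + ‖g z‖ₑ]
  have hfm : Measurable fun s : ℝ => ENNReal.ofReal (f (shift i s x)) :=
    (ENNReal.continuous_ofReal.comp (hf.comp (continuous_shift_left i x))).measurable
  set D := ∫⁻ r in Ioc (0 : ℝ) 1, ‖g (shift i r x)‖ₑ with hD
  have key : ∀ s ∈ Ioc (0 : ℝ) 1,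
      ENNReal.ofReal (f x) ≤ ENNReal.ofReal (f (shift i s x)) + D := fun s hs => by
    have h1 := hx.2 s ⟨hs.1.le, by linarith [hs.2]⟩
    simp only [shift_zero] at h1
    have h2 : f x = f (shift i s x) + -∫ r in (0 : ℝ)..s, g (shift i r x) := by linarith
    rw [h2]
    refine ENNReal.ofReal_add_le.trans (add_le_add le_rfl ?_)
    calc ENNReal.ofReal (-∫ r in (0 : ℝ)..s, g (shift i r x))
        ≤ ‖∫ r in (0 : ℝ)..s, g (shift i r x)‖ₑ := by
          rw [← ofReal_norm]
          exact ENNReal.ofReal_le_ofReal (neg_le_abs _)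
      _ ≤ ∫⁻ r in Ioc (0 : ℝ) s, ‖g (shift i r x)‖ₑ := by
          rw [intervalIntegral.integral_of_le hs.1.le]
          exact enorm_integral_le_lintegral_enorm _
      _ ≤ D := lintegral_mono_set (Ioc_subset_Ioc_right hs.2)
  calc ENNReal.ofReal (f x) = ∫⁻ _ in Ioc (0 : ℝ) 1, ENNReal.ofReal (f x) := by simp
    _ ≤ ∫⁻ s in Ioc (0 : ℝ) 1, (ENNReal.ofReal (f (shift i s x)) + D) :=
        setLIntegral_mono' measurableSet_Ioc key
    _ = _ := by
        rw [lintegral_add_left hfm, lintegral_add_left hfm, hD]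
        simp

/-- The Gagliardo–Nirenberg–Sobolev inequality `W^{1,1} ⊂ L^{3/2}` on the torus. -/
lemma integral_rpow_le_of_lineDeriv {f : Torus → ℝ} {g : Fin 3 → Torus → ℝ} (hf : Continuous f)
    (f0 : ∀ x, 0 ≤ f x) (hg : ∀ i, LineDeriv i f (g i)) (hgi : ∀ i, Integrable (g i)) :
    ∫ x, f x ^ (3 / 2 : ℝ) ≤ (∫ x, (f x + ∑ i, |g i x|)) ^ (3 / 2 : ℝ) := by
  set g' : Fin 3 → Torus → ℝ := fun i => (hgi i).1.mk (g i) with hg'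
  have hgm : ∀ i, Measurable (g' i) := fun i => (hgi i).1.stronglyMeasurable_mk.measurable
  have hgg : ∀ i, g i =ᵐ[volume] g' i := fun i => (hgi i).1.ae_eq_mk
  have hg2 : ∀ i, LineDeriv i f (g' i) := fun i => by
    have := ((hg i).hasWeakPartial (continuous_integrable hf) (hgi i))
    refine HasWeakPartial.lineDeriv ⟨this.1, (hgi i).congr (hgg i), fun φ hφ => ?_⟩
    rw [this.2.2 φ hφ]
    congr 1
    refine integral_congr_ae ?_
    filter_upwards [hgg i] with x hx
    rw [hx]
  set F : Torus → ℝ≥0∞ := fun x => ENNReal.ofReal (f x) + ∑ i, ‖g' i x‖ₑ with hF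
  have hFm : Measurable F := (ENNReal.continuous_ofReal.comp hf).measurable.add
    (Finset.measurable_sum _ fun i _ => (hgm i).enorm)
  have hle : ∀ᵐ x : Torus, ∀ i, ENNReal.ofReal (f x)
      ≤ ∫⁻ y : UnitAddCircle, F (Function.update x i y) := by
    refine ae_all_iff.2 fun i => ?_
    filter_upwards [(hg2 i).le_lintegral_line hf] with x hx
    refine hx.trans (lintegral_mono fun y => add_le_add le_rfl ?_)
    exact Finset.single_le_sum (f := fun j => ‖g' j (Function.update x i y)‖ₑ)
      (fun _ _ => zero_le) (Finset.mem_univ i)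
  have hgrid := lintegral_prod_lintegral_pow_le (fun _ : Fin 3 => (volume : Measure UnitAddCircle))
    (p := 3 / 2) (by rw [Real.holderConjugate_iff]; norm_num) hFm
  have hpow : ∫⁻ x : Torus, ENNReal.ofReal (f x ^ (3 / 2 : ℝ))
      ≤ (∫⁻ x : Torus, F x) ^ (3 / 2 : ℝ) := by
    refine le_trans (lintegral_mono_ae ?_) hgrid
    filter_upwards [hle] with x hx
    have e : (1 : ℝ) / ((Fintype.card (Fin 3) : ℝ) - 1) = 1 / 2 := by norm_num
    rw [e, ← ENNReal.ofReal_rpow_of_nonneg (f0 x) (by norm_num)]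
    calc ENNReal.ofReal (f x) ^ (3 / 2 : ℝ)
        = ∏ _i : Fin 3, ENNReal.ofReal (f x) ^ (1 / 2 : ℝ) := by
          rw [Finset.prod_const, Finset.card_univ, Fintype.card_fin, ← ENNReal.rpow_natCast,
            ← ENNReal.rpow_mul]
          norm_num
      _ ≤ _ := Finset.prod_le_prod' fun i _ => ENNReal.rpow_le_rpow (hx i) (by norm_num)
  have hFi : Integrable fun x => f x + ∑ i, |g i x| :=
    (continuous_integrable hf).add (integrable_finsetSum _ fun i _ => (hgi i).abs)
  have hFe : ∫⁻ x : Torus, F x = ENNReal.ofReal (∫ x, (f x + ∑ i, |g i x|)) := by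
    rw [ofReal_integral_eq_lintegral_ofReal hFi (Eventually.of_forall fun x =>
      add_nonneg (f0 x) (Finset.sum_nonneg fun i _ => abs_nonneg _))]
    refine lintegral_congr_ae ?_
    filter_upwards [ae_all_iff.2 hgg] with x hx
    rw [ENNReal.ofReal_add (f0 x) (Finset.sum_nonneg fun i _ => abs_nonneg _),
      ENNReal.ofReal_sum_of_nonneg fun i _ => abs_nonneg _]
    simp only [hF, hx, ← ofReal_norm, Real.norm_eq_abs]
  have hI : 0 ≤ ∫ x, (f x + ∑ i, |g i x|) := integral_nonneg fun x =>
    add_nonneg (f0 x) (Finset.sum_nonneg fun i _ => abs_nonneg _)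
  rw [hFe, ENNReal.ofReal_rpow_of_nonneg hI (by norm_num),
    ← ofReal_integral_eq_lintegral_ofReal (continuous_integrable
      (hf.rpow_const fun x => Or.inr (by norm_num)))
      (Eventually.of_forall fun x => Real.rpow_nonneg (f0 x) _)] at hpow
  exact (ENNReal.ofReal_le_ofReal_iff (Real.rpow_nonneg hI _)).1 hpow

variable {ϱ : Torus → ℝ} {v : Torus → Vec} {a : Fin 3 → Torus → ℝ} {b : Fin 3 → Fin 3 → Torus → ℝ}

lemma State.integrable_dissipation (h : State ϱ v a b) (c : ℝ) :
    Integrable fun x => ϱ x ^ c * ∑ i, a i x ^ 2 := by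
  refine integrable_continuous_mul (h.cont_comp (continuousOn_rpow_Ioi c)) ?_
  exact integrable_finsetSum _ fun i _ => (h.a2 i).integrable_sq

/-- The embedding `H¹ ⊂ L⁶`, applied to `ϱ ^ (γ / 2)`. -/
lemma State.rpow_integral_le (h : State ϱ v a b) {γ : ℝ} (hγ : 0 < γ) :
    (∫ x, ϱ x ^ (3 * γ)) ^ (1 / 3 : ℝ)
      ≤ 2 * (∫ x, ϱ x ^ γ) + 24 * γ ^ 2 * dissipation γ ϱ a := by
  set E := ∫ x, ϱ x ^ γ with hE
  set D := dissipation γ ϱ a with hD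
  set X := ∫ x, ϱ x ^ (3 * γ) with hX
  have hc : ∀ c : ℝ, Continuous fun x => ϱ x ^ c := fun c => h.cont_comp (continuousOn_rpow_Ioi c)
  have hp : ∀ (c : ℝ) x, 0 < ϱ x ^ c := fun c x => Real.rpow_pos_of_pos (h.pos x) c
  have hi : ∀ c : ℝ, Integrable fun x => ϱ x ^ c := fun c => continuous_integrable (hc c)
  have hs0 : ∀ x, 0 ≤ ∑ i, a i x ^ 2 := fun x => Finset.sum_nonneg fun i _ => sq_nonneg _
  have hE0 : 0 ≤ E := integral_nonneg fun x => (hp γ x).le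
  have hD0 : 0 ≤ D := integral_nonneg fun x => mul_nonneg (hp _ x).le (hs0 x)
  have hX0 : 0 ≤ X := integral_nonneg fun x => (hp _ x).le
  -- the inequality `W^{1,1} ⊂ L^{3/2}` for `ϱ^(2γ)`, whose gradient is a product of `ϱ^(3γ/2)`
  -- and a multiple of `∇ϱ^(γ/2)`
  rcases hX0.eq_or_lt with hX00 | hXpos
  · rw [← hX00, Real.zero_rpow (by norm_num)]; positivity
  have hdi := h.integrable_dissipation (γ - 2)
  have hsob := integral_rpow_le_of_lineDeriv (hc (2 * γ)) (fun x => (hp _ x).le)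
    (fun i => h.lineDeriv_comp i (F := fun y => y ^ (2 * γ))
      (fun y hy => hasDerivAt_rpow_of_pos (2 * γ) y hy)
      (continuousOn_const.mul (continuousOn_rpow_Ioi (2 * γ - 1))))
    (fun i => memLp_two_integrable (MemLp.continuous_mul (h.a2 i)
      (continuous_const.mul (hc (2 * γ - 1)))))
  have e1 : ∀ x, (ϱ x ^ (2 * γ)) ^ (3 / 2 : ℝ) = ϱ x ^ (3 * γ) := fun x => by
    rw [← Real.rpow_mul (h.pos x).le]; ring_nf
  simp only [e1, ← hX] at hsob
  have i1 : ∫ x, ϱ x ^ (2 * γ) ≤ E ^ (1 / 2 : ℝ) * X ^ (1 / 2 : ℝ) := by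
    have := integral_rpow_mul_rpow_le (hi γ) (hi (3 * γ)) (fun x => (hp _ x).le)
      (fun x => (hp _ x).le) (θ := 1 / 2) (by norm_num) (by norm_num)
    norm_num only at this ⊢
    refine le_of_eq_of_le (integral_congr_ae (Eventually.of_forall fun x => ?_)) this
    simp only
    rw [← Real.rpow_mul (h.pos x).le, ← Real.rpow_mul (h.pos x).le, ← Real.rpow_add (h.pos x)]
    ring_nf
  have e2 : ∀ x, ∑ i, |2 * γ * ϱ x ^ (2 * γ - 1) * a i x| ≤ 2 * γ * 3 ^ (1 / 2 : ℝ) *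
      ((ϱ x ^ (γ - 2) * ∑ i, a i x ^ 2) ^ (1 / 2 : ℝ) *
        (ϱ x ^ (3 * γ)) ^ (1 / 2 : ℝ)) := fun x => by
    have h1 : ∑ i, |a i x| ≤ 3 ^ (1 / 2 : ℝ) * (∑ i, a i x ^ 2) ^ (1 / 2 : ℝ) := by
      rw [← Real.mul_rpow (by norm_num) (hs0 x), ← Real.sqrt_eq_rpow]
      refine Real.le_sqrt_of_sq_le ?_
      have := sq_sum_le_card_mul_sum_sq (s := Finset.univ) (f := fun i => |a i x|)
      simpa using this
    have h2 : (ϱ x ^ (γ - 2)) ^ (1 / 2 : ℝ) * (ϱ x ^ (3 * γ)) ^ (1 / 2 : ℝ)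
        = ϱ x ^ (2 * γ - 1) := by
      rw [← Real.rpow_mul (h.pos x).le, ← Real.rpow_mul (h.pos x).le, ← Real.rpow_add (h.pos x)]
      ring_nf
    simp only [abs_mul, abs_of_pos (hp (2 * γ - 1) x), abs_of_pos hγ, abs_two]
    rw [← Finset.mul_sum, Real.mul_rpow (hp _ x).le (hs0 x), ← h2]
    have h3 : 0 ≤ 2 * γ * ((ϱ x ^ (γ - 2)) ^ (1 / 2 : ℝ) * (ϱ x ^ (3 * γ)) ^ (1 / 2 : ℝ)) := by
      rw [h2]; have := (hp (2 * γ - 1) x).le; positivity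
    calc _ ≤ 2 * γ * ((ϱ x ^ (γ - 2)) ^ (1 / 2 : ℝ) * (ϱ x ^ (3 * γ)) ^ (1 / 2 : ℝ)) *
          (3 ^ (1 / 2 : ℝ) * (∑ i, a i x ^ 2) ^ (1 / 2 : ℝ)) := mul_le_mul_of_nonneg_left h1 h3
      _ = _ := by ring
  have hnn : ∀ x, 0 ≤ ϱ x ^ (γ - 2) * ∑ i, a i x ^ 2 := fun x => mul_nonneg (hp _ x).le (hs0 x)
  have i3 : Integrable fun x =>
      (ϱ x ^ (γ - 2) * ∑ i, a i x ^ 2) ^ (1 / 2 : ℝ) * (ϱ x ^ (3 * γ)) ^ (1 / 2 : ℝ) := by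
    have m1 := memLp_rpow_of_integrable hdi hnn (θ := 1 / 2) (by norm_num)
    have m2 := memLp_rpow_of_integrable (hi (3 * γ)) (fun x => (hp _ x).le) (θ := 1 / 2)
      (by norm_num)
    norm_num only [ENNReal.ofReal_ofNat] at m1 m2
    convert integrable_mul_of_memLp_two m1 m2 using 1
  have i2 : ∫ x, (ϱ x ^ (γ - 2) * ∑ i, a i x ^ 2) ^ (1 / 2 : ℝ) * (ϱ x ^ (3 * γ)) ^ (1 / 2 : ℝ)
      ≤ D ^ (1 / 2 : ℝ) * X ^ (1 / 2 : ℝ) := by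
    have := integral_rpow_mul_rpow_le hdi (hi (3 * γ)) hnn
      (fun x => (hp _ x).le) (θ := 1 / 2) (by norm_num) (by norm_num)
    norm_num only at this ⊢
    exact this
  set k := 2 * γ * (3 : ℝ) ^ (1 / 2 : ℝ) with hk
  have hk0 : 0 ≤ k := by positivity
  have hk2 : k ^ 2 = 12 * γ ^ 2 := by
    rw [hk, ← Real.sqrt_eq_rpow, mul_pow, Real.sq_sqrt (by norm_num)]; ring
  have i4 : ∫ x, (ϱ x ^ (2 * γ) + ∑ i, |2 * γ * ϱ x ^ (2 * γ - 1) * a i x|)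
      ≤ X ^ (1 / 2 : ℝ) * (E ^ (1 / 2 : ℝ) + k * D ^ (1 / 2 : ℝ)) := by
    calc _ ≤ ∫ x, (ϱ x ^ (2 * γ) + k * ((ϱ x ^ (γ - 2) * ∑ i, a i x ^ 2) ^ (1 / 2 : ℝ) *
          (ϱ x ^ (3 * γ)) ^ (1 / 2 : ℝ))) := by
          refine integral_mono_of_nonneg (Eventually.of_forall fun x => ?_)
            ((hi _).add (i3.const_mul k))
            (Eventually.of_forall fun x => add_le_add le_rfl (e2 x))
          exact add_nonneg (hp _ x).le (Finset.sum_nonneg fun i _ => abs_nonneg _)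
      _ ≤ _ := by
          rw [integral_add (hi _) (i3.const_mul k), integral_const_mul]
          have := mul_le_mul_of_nonneg_left i2 hk0
          linarith
  have hI0 : 0 ≤ ∫ x, (ϱ x ^ (2 * γ) + ∑ i, |2 * γ * ϱ x ^ (2 * γ - 1) * a i x|) :=
    integral_nonneg fun x => add_nonneg (hp _ x).le (Finset.sum_nonneg fun i _ => abs_nonneg _)
  have j1 : X ^ (2 / 3 : ℝ) ≤ X ^ (1 / 2 : ℝ) * (E ^ (1 / 2 : ℝ) + k * D ^ (1 / 2 : ℝ)) := by
    have := Real.rpow_le_rpow hX0 hsob (show (0 : ℝ) ≤ 2 / 3 by norm_num)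
    rw [← Real.rpow_mul hI0] at this
    norm_num only [Real.rpow_one] at this ⊢
    exact this.trans (by norm_num only at i4; exact i4)
  have j2 : X ^ (2 / 3 : ℝ) = X ^ (1 / 2 : ℝ) * X ^ (1 / 6 : ℝ) := by
    rw [← Real.rpow_add hXpos]; norm_num
  rw [j2] at j1
  have j3 := le_of_mul_le_mul_left j1 (Real.rpow_pos_of_pos hXpos _)
  have j4 : X ^ (1 / 3 : ℝ) = (X ^ (1 / 6 : ℝ)) ^ 2 := by
    rw [← Real.rpow_natCast, ← Real.rpow_mul hX0]; norm_num
  rw [j4]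
  have j5 := pow_le_pow_left₀ (Real.rpow_nonneg hX0 _) j3 2
  have hE2 : (E ^ (1 / 2 : ℝ)) ^ 2 = E := by rw [← Real.sqrt_eq_rpow, Real.sq_sqrt hE0]
  have hD2 : (D ^ (1 / 2 : ℝ)) ^ 2 = D := by rw [← Real.sqrt_eq_rpow, Real.sq_sqrt hD0]
  have j6 := add_sq_le (a := E ^ (1 / 2 : ℝ)) (b := k * D ^ (1 / 2 : ℝ))
  rw [mul_pow, hE2, hD2, hk2] at j6
  linarith

end

/-! ### Upper bounds for the density and the moments of the velocity -/

/-- On every interval `[0, t]` with `t < Ts`, the pair `(ϱ, v)` evolves by the system. -/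
def Solves (γ Ts : ℝ) (ϱ : ℝ → Torus → ℝ) (v : ℝ → Torus → Vec) : Prop :=
  ∀ t, 0 < t → t < Ts → ∃ ϱt vt a b, Evolution γ t ϱ v ϱt vt a b

section Snapshot

variable {ϱ : Torus → ℝ} {v : Torus → Vec} {a : Fin 3 → Torus → ℝ} {b : Fin 3 → Fin 3 → Torus → ℝ}

lemma State.continuous_moment (h : State ϱ v a b) (m : ℝ) {δ : ℝ} (hδ : 0 < δ) :
    Continuous fun x => ϱ x * sqSpeed δ (v x) ^ (m / 2) :=
  h.cont.mul (h.cont_sqSpeed_rpow hδ _)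

lemma sqSpeed_pos {δ : ℝ} (hδ : 0 < δ) (v : Vec) : 0 < sqSpeed δ v := hδ.trans_le (le_sqSpeed δ v)

lemma State.moment_integrand_pos (h : State ϱ v a b) (m : ℝ) {δ : ℝ} (hδ : 0 < δ) (x : Torus) :
    0 < ϱ x * sqSpeed δ (v x) ^ (m / 2) :=
  mul_pos (h.pos x) (Real.rpow_pos_of_pos (sqSpeed_pos hδ _) _)

lemma State.moment_nonneg (h : State ϱ v a b) (m : ℝ) {δ : ℝ} (hδ : 0 < δ) :
    0 ≤ moment m δ ϱ v := integral_nonneg fun x => (h.moment_integrand_pos m hδ x).le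

lemma State.dissipation_nonneg (h : State ϱ v a b) (γ : ℝ) : 0 ≤ dissipation γ ϱ a :=
  integral_nonneg fun x => mul_nonneg (Real.rpow_nonneg (h.pos x).le _)
    (Finset.sum_nonneg fun _ _ => sq_nonneg _)

lemma State.integral_rpow_nonneg (h : State ϱ v a b) (c : ℝ) : 0 ≤ ∫ x, ϱ x ^ c :=
  integral_nonneg fun x => Real.rpow_nonneg (h.pos x).le _

lemma norm_le_sqSpeed_rpow (v : Vec) : ‖v‖ ≤ sqSpeed 1 v ^ (1 / 2 : ℝ) := by
  rw [sqSpeed_eq, ← Real.sqrt_eq_rpow]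
  exact Real.le_sqrt_of_sq_le (by linarith)

/-- The momentum density, averaged with the kernel: Hölder's inequality between the moment of order
`p` and the mass. -/
lemma State.integral_momentum_kern_le (h : State ϱ v a b) {p R S C₀ τ : ℝ} (hp : 1 < p)
    (hR : ∀ x, ϱ x ≤ R) (hS : moment p 1 ϱ v ≤ S) (hτ : 0 < τ)
    (hC₀ : ∫ x, kern (heatExp / 2) τ x ≤ C₀) (x₀ : Torus) :
    ∫ x, ϱ x * ‖v x‖ * kern (heatExp / 2) τ (x - x₀)
      ≤ (τ ^ (-(3 / 2) : ℝ) * S) ^ (1 / p) * (R * C₀) ^ (1 - 1 / p) := by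
  have hp0 : 0 < p := by linarith
  have hθ : 1 / p < 1 := by rw [div_lt_one hp0]; exact hp
  have hk : Continuous fun x => kern (heatExp / 2) τ (x - x₀) :=
    (continuous_kern _ _).comp (continuous_id.sub continuous_const)
  have hkp : ∀ x, 0 < kern (heatExp / 2) τ (x - x₀) := fun x => kern_pos _ hτ _
  have hm := h.continuous_moment p one_pos
  have hmp := h.moment_integrand_pos p one_pos
  have hR0 : 0 ≤ R := (h.pos 0).le.trans (hR 0)
  have hw : ∀ x, 0 < sqSpeed 1 (v x) := fun x => sqSpeed_pos one_pos _
  calc ∫ x, ϱ x * ‖v x‖ * kern (heatExp / 2) τ (x - x₀)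
      ≤ ∫ x, (ϱ x * sqSpeed 1 (v x) ^ (p / 2) * kern (heatExp / 2) τ (x - x₀)) ^ (1 / p) *
          (ϱ x * kern (heatExp / 2) τ (x - x₀)) ^ (1 - 1 / p) := by
        refine integral_mono (continuous_integrable ((h.cont.mul h.contv.norm).mul hk))
          (continuous_integrable (((hm.mul hk).rpow_const fun x => Or.inr (by positivity)).mul
          ((h.cont.mul hk).rpow_const fun x => Or.inr (by linarith)))) fun x => ?_
        simp only
        rw [Real.mul_rpow (hmp x).le (hkp x).le, Real.mul_rpow (h.pos x).le
          (Real.rpow_nonneg (hw x).le _), Real.mul_rpow (h.pos x).le (hkp x).le,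
          ← Real.rpow_mul (hw x).le, show p / 2 * (1 / p) = 1 / 2 by field_simp]
        calc ϱ x * ‖v x‖ * kern (heatExp / 2) τ (x - x₀)
            ≤ ϱ x * sqSpeed 1 (v x) ^ (1 / 2 : ℝ) * kern (heatExp / 2) τ (x - x₀) := by
              have := norm_le_sqSpeed_rpow (v x)
              have := (h.pos x).le
              have := (hkp x).le
              gcongr
          _ = (ϱ x ^ (1 / p) * ϱ x ^ (1 - 1 / p)) * sqSpeed 1 (v x) ^ (1 / 2 : ℝ) *
              (kern (heatExp / 2) τ (x - x₀) ^ (1 / p) *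
              kern (heatExp / 2) τ (x - x₀) ^ (1 - 1 / p)) := by
              rw [← Real.rpow_add (h.pos x), ← Real.rpow_add (hkp x)]; simp
          _ = _ := by ring
    _ ≤ _ := integral_rpow_mul_rpow_le (continuous_integrable (hm.mul hk))
        (continuous_integrable (h.cont.mul hk)) (fun x => (mul_pos (hmp x) (hkp x)).le)
        (fun x => (mul_pos (h.pos x) (hkp x)).le) (by positivity) hθ
    _ ≤ _ := by
        have h1 : ∫ x, ϱ x * sqSpeed 1 (v x) ^ (p / 2) * kern (heatExp / 2) τ (x - x₀)
            ≤ τ ^ (-(3 / 2) : ℝ) * S := by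
          refine le_trans ?_ (mul_le_mul_of_nonneg_left hS (Real.rpow_nonneg hτ.le _))
          rw [moment, ← integral_const_mul]
          refine integral_mono (continuous_integrable (hm.mul hk))
            (continuous_integrable (continuous_const.mul hm)) fun x => ?_
          simp only
          rw [mul_comm]
          exact mul_le_mul_of_nonneg_right (kern_le (by linarith [heatExp_pos]) hτ _) (hmp x).le
        have h2 : ∫ x, ϱ x * kern (heatExp / 2) τ (x - x₀) ≤ R * C₀ := by
          refine le_trans ?_ (mul_le_mul_of_nonneg_left hC₀ hR0)
          rw [← integral_sub_right (kern (heatExp / 2) τ) x₀, ← integral_const_mul]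
          exact integral_mono (continuous_integrable (h.cont.mul hk))
            (continuous_integrable (continuous_const.mul hk)) fun x =>
              mul_le_mul_of_nonneg_right (hR x) (hkp x).le
        have h3 : 0 ≤ ∫ x, ϱ x * sqSpeed 1 (v x) ^ (p / 2) * kern (heatExp / 2) τ (x - x₀) :=
          integral_nonneg fun x => (mul_pos (hmp x) (hkp x)).le
        have h4 : 0 ≤ ∫ x, ϱ x * kern (heatExp / 2) τ (x - x₀) :=
          integral_nonneg fun x => (mul_pos (h.pos x) (hkp x)).le
        exact mul_le_mul (Real.rpow_le_rpow h3 h1 (by positivity))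
          (Real.rpow_le_rpow h4 h2 (by linarith)) (Real.rpow_nonneg h4 _)
          (Real.rpow_nonneg (h3.trans h1) _)

/-- Control of the source of the moments by the density in `L^∞` and `ϱ ^ (γ / 2)` in `L⁶`. -/
lemma State.source_le (h : State ϱ v a b) {γ p R S E : ℝ} (hγ : 1 < γ) (hp : 3 < p) (hp' : p < 6)
    (hγp : γ * (2 * p / 3 - 1) ≤ p - 1 / 2) (hR : ∀ x, ϱ x ≤ R) (hS : moment p 1 ϱ v ≤ S)
    (hE : ∫ x, ϱ x ^ γ ≤ E) :
    ∫ x, ϱ x ^ (2 * γ - 1) * sqSpeed 1 (v x) ^ (p / 2 - 1)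
      ≤ S ^ (1 - 2 / p) * (R ^ (1 / 2 : ℝ) *
        (1 + E ^ (1 - p / 6) * (∫ x, ϱ x ^ (3 * γ)) ^ (p / 6))) ^ (2 / p) := by
  have hp0 : 0 < p := by linarith
  have hθ : 0 < 2 / p := by positivity
  have hθ1 : 2 / p < 1 := by rw [div_lt_one hp0]; linarith
  have hc : ∀ c : ℝ, Continuous fun x => ϱ x ^ c := fun c => h.cont_comp (continuousOn_rpow_Ioi c)
  have hpos : ∀ (c : ℝ) x, 0 < ϱ x ^ c := fun c x => Real.rpow_pos_of_pos (h.pos x) c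
  have hi : ∀ c : ℝ, Integrable fun x => ϱ x ^ c := fun c => continuous_integrable (hc c)
  have hmp := h.moment_integrand_pos p one_pos
  have hw : ∀ x, 0 < sqSpeed 1 (v x) := fun x => sqSpeed_pos one_pos _
  have hR0 : 0 ≤ R := (h.pos 0).le.trans (hR 0)
  have hM0 := h.moment_nonneg p one_pos
  -- `s` is determined by the homogeneity in `ϱ`: `(1 - 2 / p) + s (2 / p) = 2 γ - 1`
  set s := (γ - 1) * p + 1 with hs
  have h1 := integral_rpow_mul_rpow_le (continuous_integrable (h.continuous_moment p one_pos))
    (hi s) (fun x => (hmp x).le) (fun x => (hpos s x).le) (θ := 1 - 2 / p) (by linarith)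
    (by linarith)
  have e1 : ∀ x, (ϱ x * sqSpeed 1 (v x) ^ (p / 2)) ^ (1 - 2 / p) * (ϱ x ^ s) ^ (1 - (1 - 2 / p))
      = ϱ x ^ (2 * γ - 1) * sqSpeed 1 (v x) ^ (p / 2 - 1) := fun x => by
    rw [Real.mul_rpow (h.pos x).le (Real.rpow_nonneg (hw x).le _), ← Real.rpow_mul (h.pos x).le,
      ← Real.rpow_mul (hw x).le, mul_right_comm, ← Real.rpow_add (h.pos x)]
    congr 2
    · rw [hs]; field_simp; ring
    · field_simp
  simp only [e1] at h1
  rw [show 1 - (1 - 2 / p) = 2 / p by ring] at h1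
  -- one half power of `ϱ` is given to `L^∞`; the condition on `γ` and `p` says that the remaining
  -- exponent is at most that of the interpolation between `ϱ^γ` and `ϱ^(3γ)`
  have h2 : ∫ x, ϱ x ^ s ≤ R ^ (1 / 2 : ℝ) *
      (1 + ∫ x, (ϱ x ^ (3 * γ)) ^ (p / 6) * (ϱ x ^ γ) ^ (1 - p / 6)) := by
    have i1 : Integrable fun x => (ϱ x ^ (3 * γ)) ^ (p / 6) * (ϱ x ^ γ) ^ (1 - p / 6) := by
      refine continuous_integrable (((hc _).rpow_const fun x => ?_).mul
        ((hc _).rpow_const fun x => ?_))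
      · exact Or.inl (hpos _ x).ne'
      · exact Or.inl (hpos _ x).ne'
    have e : ∫ x, (1 + (ϱ x ^ (3 * γ)) ^ (p / 6) * (ϱ x ^ γ) ^ (1 - p / 6))
        = 1 + ∫ x, (ϱ x ^ (3 * γ)) ^ (p / 6) * (ϱ x ^ γ) ^ (1 - p / 6) := by
      rw [integral_add (integrable_const _) i1]; simp
    rw [← e, ← integral_const_mul]
    refine integral_mono (hi s) (((integrable_const _).add i1).const_mul _) fun x => ?_
    have hx := h.pos x
    simp only
    rw [← Real.rpow_mul hx.le, ← Real.rpow_mul hx.le, ← Real.rpow_add hx,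
      show s = 1 / 2 + (s - 1 / 2) by ring, Real.rpow_add hx]
    refine mul_le_mul (Real.rpow_le_rpow hx.le (hR x) (by norm_num)) ?_ (hpos _ x).le
      (Real.rpow_nonneg hR0 _)
    rcases le_total (ϱ x) 1 with hx1 | hx1
    · have h3 : ϱ x ^ (s - 1 / 2) ≤ 1 := Real.rpow_le_one hx.le hx1 (by
        have : 0 < (γ - 1) * p := mul_pos (by linarith) hp0
        linarith)
      have := hpos (3 * γ * (p / 6) + γ * (1 - p / 6)) x
      linarith
    · have h3 := Real.rpow_le_rpow_of_exponent_le hx1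
        (show s - 1 / 2 ≤ 3 * γ * (p / 6) + γ * (1 - p / 6) by rw [hs]; linarith)
      linarith
  -- the exponent `p / 6` is chosen so that the result is linear in `(∫ ϱ^(3γ))^(1/3)` after the
  -- power `2 / p`
  have h3 := integral_rpow_mul_rpow_le (hi (3 * γ)) (hi γ) (fun x => (hpos _ x).le)
    (fun x => (hpos _ x).le) (θ := p / 6) (by positivity) (by linarith)
  have hX0 := h.integral_rpow_nonneg (3 * γ)
  have hE0 := h.integral_rpow_nonneg γ
  have h4 : ∫ x, ϱ x ^ s ≤ R ^ (1 / 2 : ℝ) *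
      (1 + E ^ (1 - p / 6) * (∫ x, ϱ x ^ (3 * γ)) ^ (p / 6)) := by
    refine h2.trans (mul_le_mul_of_nonneg_left ?_ (Real.rpow_nonneg hR0 _))
    have h5 : (∫ x, ϱ x ^ γ) ^ (1 - p / 6) ≤ E ^ (1 - p / 6) :=
      Real.rpow_le_rpow hE0 hE (by linarith)
    have h6 := mul_le_mul_of_nonneg_left h5 (Real.rpow_nonneg hX0 (p / 6))
    linarith
  refine h1.trans (mul_le_mul ?_ ?_ ?_ ?_)
  · exact Real.rpow_le_rpow hM0 hS (by linarith)
  · exact Real.rpow_le_rpow (h.integral_rpow_nonneg s) h4 hθ.le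
  · exact Real.rpow_nonneg (h.integral_rpow_nonneg s) _
  · exact Real.rpow_nonneg (hM0.trans hS) _

end Snapshot

lemma intervalIntegrable_sub_rpow {T β : ℝ} (hβ : β < 1) :
    IntervalIntegrable (fun r => (T - r) ^ (-β)) volume 0 T := by
  have := (intervalIntegral.intervalIntegrable_rpow' (a := T) (b := 0) (r := -β)
    (by linarith)).comp_sub_left T
  simpa using this

lemma integral_sub_rpow {T β : ℝ} (hβ : β < 1) :
    ∫ r in (0 : ℝ)..T, (T - r) ^ (-β) = T ^ (1 - β) / (1 - β) := by
  rw [intervalIntegral.integral_comp_sub_left (fun r => r ^ (-β)) T,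
    integral_rpow (Or.inl (by linarith))]
  rw [sub_self, sub_zero, Real.zero_rpow (by linarith), sub_zero, neg_add_eq_sub]

section

variable {γ T : ℝ} {ϱ : ℝ → Torus → ℝ} {v : ℝ → Torus → Vec} {ϱt : ℝ → Torus → ℝ}
  {vt : ℝ → Torus → Vec} {a : ℝ → Fin 3 → Torus → ℝ} {b : ℝ → Fin 3 → Fin 3 → Torus → ℝ}

/-- The density at time `T` in terms of bounds for the density and a moment on `[0, T]`. -/
lemma Evolution.density_le (h : Evolution γ T ϱ v ϱt vt a b) (hT : 0 < T) {p R S C₀ M : ℝ}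
    (hp : 3 < p) (hR : ∀ s ∈ Icc (0 : ℝ) T, ∀ x, ϱ s x ≤ R)
    (hS : ∀ s ∈ Icc (0 : ℝ) T, moment p 1 (ϱ s) (v s) ≤ S)
    (hC₀ : ∀ τ : ℝ, 0 < τ → ∫ x, kern (heatExp / 2) τ x ≤ C₀) (hM : ∀ x, ϱ 0 x ≤ M) (x₀ : Torus) :
    ϱ T x₀ ≤ Real.exp (3 * Real.pi ^ 2 * T) * (C₀ * M +
      3 * (S ^ (1 / p) * (R * C₀) ^ (1 - 1 / p)) *
        (T ^ (1 - (1 / 2 + 3 / 2 / p)) / (1 - (1 / 2 + 3 / 2 / p)))) := by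
  have hp0 : 0 < p := by linarith
  have hβ : 1 / 2 + 3 / 2 / p < 1 := by
    have : 3 / 2 / p < 1 / 2 := by rw [div_lt_iff₀ hp0]; linarith
    linarith
  set β := 1 / 2 + 3 / 2 / p with hβd
  have hS0 : 0 ≤ S := ((h.state T ⟨hT.le, le_rfl⟩).moment_nonneg p one_pos).trans
    (hS T ⟨hT.le, le_rfl⟩)
  have hR0 : 0 ≤ R := ((h.state T ⟨hT.le, le_rfl⟩).pos x₀).le.trans (hR T ⟨hT.le, le_rfl⟩ x₀)
  have hC0 : 0 ≤ C₀ := (integral_nonneg fun x => (kern_pos _ one_pos x).le).trans (hC₀ 1 one_pos)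
  set D := S ^ (1 / p) * (R * C₀) ^ (1 - 1 / p) with hD
  have hD0 : 0 ≤ D := by positivity
  rw [← integral_sub_rpow hβ, ← intervalIntegral.integral_const_mul]
  refine h.comp_density_le hT (G := fun y => y) (G' := fun _ => 1) (G'' := fun _ => 0)
    (H := fun y => y) (c := 0) (fun y _ => hasDerivAt_id y) (fun y _ => hasDerivAt_const y 1)
    continuousOn_const hR (fun y hy => hy.1.le) le_rfl (fun y _ A V => by simp)
    (fun y hy => by simp [abs_of_pos hy.1]) continuousOn_id hC₀ hM
    ((intervalIntegrable_sub_rpow hβ).const_mul _) ?_ x₀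
  intro r hr τ hτ x
  have hrI : r ∈ Icc (0 : ℝ) T := ⟨hr.1, hr.2.le⟩
  have hst := h.state r hrI
  have hTr : 0 < T - r := by linarith [hr.2]
  have hτ0 : 0 < τ := hTr.trans_le hτ
  have e : ∀ y, (0 * ‖v r y‖ ^ 2 + 3 * τ ^ (-(1 / 2) : ℝ) * (ϱ r y * ‖v r y‖)) *
      kern (heatExp / 2) τ (y - x) = 3 * τ ^ (-(1 / 2) : ℝ) *
      (ϱ r y * ‖v r y‖ * kern (heatExp / 2) τ (y - x)) := fun y => by ring
  simp only [e]
  rw [integral_const_mul]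
  have h1 := hst.integral_momentum_kern_le (by linarith) (hR r hrI) (hS r hrI) hτ0 (hC₀ τ hτ0) x
  have h2 : τ ^ (-β) ≤ (T - r) ^ (-β) :=
    Real.rpow_le_rpow_of_nonpos hTr hτ (by rw [hβd, neg_nonpos]; positivity)
  calc 3 * τ ^ (-(1 / 2) : ℝ) * ∫ y, ϱ r y * ‖v r y‖ * kern (heatExp / 2) τ (y - x)
      ≤ 3 * τ ^ (-(1 / 2) : ℝ) * ((τ ^ (-(3 / 2) : ℝ) * S) ^ (1 / p) * (R * C₀) ^ (1 - 1 / p)) :=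
        mul_le_mul_of_nonneg_left h1 (by positivity)
    _ = 3 * (τ ^ (-(1 / 2) : ℝ) * τ ^ (-(3 / 2) * (1 / p) : ℝ)) * D := by
        rw [Real.mul_rpow (by positivity) hS0, ← Real.rpow_mul hτ0.le, hD]; ring
    _ = 3 * D * τ ^ (-β) := by
        rw [← Real.rpow_add hτ0, show -(1 / 2) + -(3 / 2) * (1 / p) = -β by rw [hβd]; ring]; ring
    _ ≤ 3 * D * (T - r) ^ (-β) := mul_le_mul_of_nonneg_left h2 (by positivity)

lemma Evolution.exists_moment_bound (h : Evolution γ T ϱ v ϱt vt a b) (m : ℝ) {δ : ℝ}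
    (hδ : 0 < δ) : ∃ B, ∀ s ∈ Icc (0 : ℝ) T, moment m δ (ϱ s) (v s) ≤ B := by
  obtain ⟨B, hB⟩ := exists_bound_of_continuousOn_strip
    (c := fun s x => ϱ s x * sqSpeed δ (v s x) ^ (m / 2))
    (h.contϱ.mul (h.continuousOn_comp_velocity (continuous_sqSpeed_rpow hδ _)))
  refine ⟨B, fun s hs => ?_⟩
  have := integral_mono (continuous_integrable ((h.state s hs).continuous_moment m hδ))
    (integrable_const B) fun x => (le_abs_self _).trans (hB s hs x)
  simpa [moment] using this

/-- A bound that is linear in the largest moment of order `p > 3`. -/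
lemma exists_density_le {p Ts : ℝ} (M : ℝ) (hp : 3 < p) (hTs : 0 < Ts) :
    ∃ K : ℝ, 1 ≤ K ∧ ∀ (γ : ℝ) (ϱ : ℝ → Torus → ℝ) (v : ℝ → Torus → Vec), Solves γ Ts ϱ v →
      (∀ x, ϱ 0 x ≤ M) → ∀ T, 0 < T → T < Ts → ∀ S : ℝ,
      (∀ s ∈ Icc (0 : ℝ) T, moment p 1 (ϱ s) (v s) ≤ S) →
      ∀ s ∈ Icc (0 : ℝ) T, ∀ x, ϱ s x ≤ K * (1 + S) := by
  have hp0 : 0 < p := by linarith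
  have hβ : 0 < 1 - (1 / 2 + 3 / 2 / p) := by
    have : 3 / 2 / p < 1 / 2 := by rw [div_lt_iff₀ hp0]; linarith
    linarith
  obtain ⟨C₁, -, hC₁'⟩ := exists_integral_kern_le (α := heatExp / 2) (by linarith [heatExp_pos])
  set C₀ := max C₁ 1 with hC₀d
  have hC₀ : ∀ τ : ℝ, 0 < τ → ∫ x, kern (heatExp / 2) τ x ≤ C₀ := fun τ hτ =>
    (hC₁' τ hτ).trans (le_max_left _ _)
  have hC1 : 1 ≤ C₀ := le_max_right _ _
  set M' := max M 1 with hM'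
  have hM1 : 1 ≤ M' := le_max_right _ _
  set θ := 1 - (1 / 2 + 3 / 2 / p) with hθ
  set e := Real.exp (3 * Real.pi ^ 2 * Ts) with he
  have he1 : 1 ≤ e := Real.one_le_exp (by positivity)
  set c := 3 * C₀ ^ (1 - 1 / p) * (Ts ^ θ / θ) with hc
  have hc0 : 0 ≤ c := by positivity
  set K₀ := e * (C₀ * M' + c) with hK₀
  have hCM : M' ≤ C₀ * M' := le_mul_of_one_le_left (by linarith) hC1
  have hK0 : M' ≤ K₀ := by
    have : C₀ * M' + c ≤ K₀ := le_mul_of_one_le_left (by linarith) he1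
    linarith
  refine ⟨2 * K₀ + (2 * K₀) ^ p, ?_, fun γ ϱ v hs hM T hT hTTs S hS => ?_⟩
  · have : 0 ≤ (2 * K₀) ^ p := Real.rpow_nonneg (by linarith) _
    linarith
  obtain ⟨ϱt, vt, a, b, h⟩ := hs T hT hTTs
  obtain ⟨⟨t, x₀⟩, ⟨ht, -⟩, hmax⟩ := (isCompact_Icc.prod isCompact_univ).exists_isMaxOn
    ⟨((0 : ℝ), (0 : Torus)), ⟨left_mem_Icc.2 hT.le, mem_univ _⟩⟩ h.contϱ
  change t ∈ Icc (0 : ℝ) T at ht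
  set R := ϱ t x₀ with hR
  have hRmax : ∀ s ∈ Icc (0 : ℝ) T, ∀ x, ϱ s x ≤ R := fun s hs x =>
    hmax (show (s, x) ∈ Icc (0 : ℝ) T ×ˢ univ from ⟨hs, mem_univ _⟩)
  have hRpos : 0 < R := (h.state t ht).pos x₀
  have hS0 : 0 ≤ S := ((h.state t ht).moment_nonneg p one_pos).trans (hS t ht)
  have hpow0 : 0 ≤ (2 * K₀) ^ p := Real.rpow_nonneg (by linarith) _
  intro s hsI x
  refine (hRmax s hsI x).trans ?_
  set X := S ^ (1 / p) * R ^ (1 - 1 / p) with hX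
  have hX0 : 0 ≤ X := by positivity
  -- the estimate for the density at the time where the maximum is attained
  have key : R ≤ K₀ * (1 + X) := by
    rcases ht.1.eq_or_lt with h0 | h0
    · have : R ≤ M := by rw [hR, ← h0]; exact hM x₀
      have h1 : M ≤ M' := le_max_left _ _
      nlinarith
    · obtain ⟨ϱt', vt', a', b', h'⟩ := hs t h0 (ht.2.trans_lt hTTs)
      have hsub : ∀ s ∈ Icc (0 : ℝ) t, s ∈ Icc (0 : ℝ) T := fun s hs => ⟨hs.1, hs.2.trans ht.2⟩
      refine (h'.density_le h0 hp (fun s hs => hRmax s (hsub s hs))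
        (fun s hs => hS s (hsub s hs)) hC₀ hM x₀).trans ?_
      have h1 : Real.exp (3 * Real.pi ^ 2 * t) ≤ e := by
        have := ht.2.trans hTTs.le
        rw [he]; gcongr
      have h2 : t ^ θ / θ ≤ Ts ^ θ / θ := by
        have := ht.2.trans hTTs.le
        gcongr
      have h3 : C₀ * M ≤ C₀ * M' := mul_le_mul_of_nonneg_left (le_max_left _ _) (by linarith)
      have h4 : 3 * (S ^ (1 / p) * (R * C₀) ^ (1 - 1 / p)) * (t ^ θ / θ) ≤ c * X := by
        rw [Real.mul_rpow hRpos.le (by linarith)]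
        calc _ = 3 * X * C₀ ^ (1 - 1 / p) * (t ^ θ / θ) := by rw [hX]; ring
          _ ≤ 3 * X * C₀ ^ (1 - 1 / p) * (Ts ^ θ / θ) :=
            mul_le_mul_of_nonneg_left h2 (by positivity)
          _ = c * X := by rw [hc]; ring
      calc _ ≤ Real.exp (3 * Real.pi ^ 2 * t) * ((C₀ * M' + c) * (1 + X)) := by
            refine mul_le_mul_of_nonneg_left ?_ (Real.exp_pos _).le
            have : 0 ≤ C₀ * M' * X := by positivity
            nlinarith
        _ ≤ e * ((C₀ * M' + c) * (1 + X)) :=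
            mul_le_mul_of_nonneg_right h1 (by positivity)
        _ = K₀ * (1 + X) := by rw [hK₀]; ring
  -- the power of `R` on the right is less than one
  have hfin : R ≤ 2 * K₀ ∨ R ≤ (2 * K₀) ^ p * S := by
    rcases le_total X 1 with h1 | h1
    · left; nlinarith
    · right
      have h2 : R ≤ 2 * K₀ * X := by nlinarith
      have h3 : R ^ (1 / p) ≤ 2 * K₀ * S ^ (1 / p) := by
        have e1 : R = R ^ (1 / p) * R ^ (1 - 1 / p) := by
          rw [← Real.rpow_add hRpos]; simp
        have h4 : R ^ (1 / p) * R ^ (1 - 1 / p) ≤ (2 * K₀ * S ^ (1 / p)) * R ^ (1 - 1 / p) := by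
          rw [← e1, mul_assoc]; exact h2
        exact le_of_mul_le_mul_right h4 (Real.rpow_pos_of_pos hRpos _)
      have h5 := Real.rpow_le_rpow (Real.rpow_nonneg hRpos.le _) h3 hp0.le
      rw [Real.mul_rpow (by linarith) (by positivity), ← Real.rpow_mul hRpos.le,
        ← Real.rpow_mul hS0, one_div_mul_cancel hp0.ne', Real.rpow_one, Real.rpow_one] at h5
      exact h5
  have h6 : 0 ≤ 2 * K₀ * S := by
    have : 0 ≤ K₀ := by linarith
    positivity
  have h7 : 0 ≤ (2 * K₀) ^ p * S := mul_nonneg hpow0 hS0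
  rcases hfin with h1 | h1 <;> nlinarith

end

section

lemma State.moment_le_of_bounds {ϱ : Torus → ℝ} {v : Torus → Vec} {a : Fin 3 → Torus → ℝ}
    {b : Fin 3 → Fin 3 → Torus → ℝ} (h : State ϱ v a b) {m δ M N : ℝ} (hm : 0 ≤ m) (hδ : 0 < δ)
    (hM : ∀ x, ϱ x ≤ M) (hN : ∀ x, ‖v x‖ ≤ N) : moment m δ ϱ v ≤ M * (δ + N ^ 2) ^ (m / 2) := by
  have hM0 : 0 ≤ M := (h.pos 0).le.trans (hM 0)
  have := integral_mono (continuous_integrable (h.continuous_moment m hδ))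
    (integrable_const (M * (δ + N ^ 2) ^ (m / 2))) fun x => by
      have h1 : sqSpeed δ (v x) ≤ δ + N ^ 2 := by
        rw [sqSpeed_eq]; have := hN x; gcongr
      exact mul_le_mul (hM x) (Real.rpow_le_rpow (sqSpeed_pos hδ _).le h1 (by linarith))
        (Real.rpow_nonneg (sqSpeed_pos hδ _).le _) hM0
  simpa [moment] using this

variable {γ T : ℝ} {ϱ : ℝ → Torus → ℝ} {v : ℝ → Torus → Vec} {ϱt : ℝ → Torus → ℝ}
  {vt : ℝ → Torus → Vec} {a : ℝ → Fin 3 → Torus → ℝ} {b : ℝ → Fin 3 → Fin 3 → Torus → ℝ}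

/-- The energy inequality for data bounded in `L^∞`. -/
lemma Evolution.energy_bounds (h : Evolution γ T ϱ v ϱt vt a b) (hγ : 1 < γ) (hT : 0 ≤ T)
    {M N : ℝ} (hM : ∀ x, ϱ 0 x ≤ M) (hN : ∀ x, ‖v 0 x‖ ≤ N) {I : ℝ}
    (hI : I = M * (1 + N ^ 2) + 2 / (γ - 1) * M ^ γ) {t : ℝ} (ht : t ∈ Icc (0 : ℝ) T) :
    ∫ x, ϱ t x ^ γ ≤ (γ - 1) / 2 * I ∧
      2 * γ * (∫ r in (0 : ℝ)..t, dissipation γ (ϱ r) (a r)) ≤ I := by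
  have h0 := h.state 0 ⟨le_rfl, hT⟩
  have hst := h.state t ht
  have h1 := (h.energy_le hγ hT).2 t ht
  have h2 := h0.moment_le_of_bounds (m := 2) (δ := 1) (by norm_num) one_pos hM hN
  rw [div_self two_ne_zero, Real.rpow_one] at h2
  have h3 : ∫ x, ϱ 0 x ^ γ ≤ M ^ γ := by
    have := integral_mono (continuous_integrable (h0.cont_comp (continuousOn_rpow_Ioi γ)))
      (integrable_const (M ^ γ)) fun x => Real.rpow_le_rpow (h0.pos x).le (hM x) (by linarith)
    simpa using this
  have h4 := hst.moment_nonneg 2 one_pos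
  have hγ1 : 0 < γ - 1 := by linarith
  have hk : 0 < 2 / (γ - 1) := by positivity
  have h5 : 0 ≤ ∫ r in (0 : ℝ)..t, dissipation γ (ϱ r) (a r) :=
    intervalIntegral.integral_nonneg ht.1 fun r hr =>
      (h.state r ⟨hr.1, hr.2.trans ht.2⟩).dissipation_nonneg γ
  have h6 := mul_le_mul_of_nonneg_left h3 hk.le
  have h7 : 0 ≤ 2 * γ * ∫ r in (0 : ℝ)..t, dissipation γ (ϱ r) (a r) := by positivity
  have h8 : 0 ≤ 2 / (γ - 1) * ∫ x, ϱ t x ^ γ := mul_nonneg hk.le (hst.integral_rpow_nonneg γ)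
  constructor
  · have h9 : 2 / (γ - 1) * (∫ x, ϱ t x ^ γ) ≤ I := by rw [hI]; linarith
    calc ∫ x, ϱ t x ^ γ = (γ - 1) / 2 * (2 / (γ - 1) * ∫ x, ϱ t x ^ γ) := by field_simp
      _ ≤ _ := mul_le_mul_of_nonneg_left h9 (by positivity)
  · rw [hI]; linarith

/-- The growth rate of the moment of order `p` is an integrable function of time times a power less
than one of the quantity `Y` that controls the density and the moment. -/
lemma State.source_le_dissipation {ϱ : Torus → ℝ} {v : Torus → Vec} {a : Fin 3 → Torus → ℝ}
    {b : Fin 3 → Fin 3 → Torus → ℝ} (h : State ϱ v a b) {p R S E Y : ℝ} (hγ : 1 < γ) (hp : 3 < p)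
    (hp' : p < 6) (hγp : γ * (2 * p / 3 - 1) ≤ p - 1 / 2) (hR : ∀ x, ϱ x ≤ R * Y)
    (hS : moment p 1 ϱ v ≤ S) (hE : ∫ x, ϱ x ^ γ ≤ E) (hR0 : 0 ≤ R) (hY : 0 < Y) (hSY : S ≤ Y) :
    ∫ x, ϱ x ^ (2 * γ - 1) * sqSpeed 1 (v x) ^ (p / 2 - 1)
      ≤ Y ^ (1 - 1 / p) * (R ^ (1 / p) * (1 + E ^ (1 - p / 6)) ^ (2 / p)) *
        (1 + 2 * E + 24 * γ ^ 2 * dissipation γ ϱ a) := by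
  have hp0 : 0 < p := by linarith
  have h1 := h.source_le hγ hp hp' hγp hR hS hE
  have h2 := h.rpow_integral_le (show 0 < γ by linarith)
  have hD := h.dissipation_nonneg γ
  have hE0 : 0 ≤ E := (h.integral_rpow_nonneg γ).trans hE
  have hS0 : 0 ≤ S := (h.moment_nonneg p one_pos).trans hS
  have hX0 := h.integral_rpow_nonneg (3 * γ)
  have hθ : 2 / p ≤ 1 := by rw [div_le_one hp0]; linarith
  set X := ∫ x, ϱ x ^ (3 * γ)
  set A := 1 + 2 * E + 24 * γ ^ 2 * dissipation γ ϱ a with hA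
  have hA1 : 1 ≤ A := by
    have : 0 ≤ 24 * γ ^ 2 * dissipation γ ϱ a := by positivity
    linarith
  have hXA : X ^ (p / 6) ≤ A ^ (p / 2) := by
    have e : X ^ (p / 6) = (X ^ (1 / 3 : ℝ)) ^ (p / 2) := by
      rw [← Real.rpow_mul hX0]; ring_nf
    rw [e]
    refine Real.rpow_le_rpow (Real.rpow_nonneg hX0 _) ?_ (by positivity)
    linarith
  have h1A : 1 ≤ A ^ (p / 2) := Real.one_le_rpow hA1 (by positivity)
  set e := E ^ (1 - p / 6) with he
  have he0 : 0 ≤ e := Real.rpow_nonneg hE0 _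
  have h3 : 1 + e * X ^ (p / 6) ≤ (1 + e) * A ^ (p / 2) := by
    have := mul_le_mul_of_nonneg_left hXA he0
    linarith
  have hRY : 0 ≤ R * Y := by positivity
  calc _ ≤ _ := h1
    _ ≤ Y ^ (1 - 2 / p) * ((R * Y) ^ (1 / 2 : ℝ) * ((1 + e) * A ^ (p / 2))) ^ (2 / p) := by
        refine mul_le_mul (Real.rpow_le_rpow hS0 hSY (by linarith)) (Real.rpow_le_rpow
          (mul_nonneg (Real.rpow_nonneg hRY _) (by positivity))
          (mul_le_mul_of_nonneg_left h3 (Real.rpow_nonneg hRY _)) (by positivity))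
          (by positivity) (by positivity)
    _ = Y ^ (1 - 2 / p) * (Y ^ (1 / p) * R ^ (1 / p) * ((1 + e) ^ (2 / p) * A)) := by
        rw [Real.mul_rpow (Real.rpow_nonneg hRY _) (by positivity),
          Real.mul_rpow (x := 1 + e) (by positivity) (by positivity), ← Real.rpow_mul hRY,
          ← Real.rpow_mul (by linarith),
          show 1 / 2 * (2 / p) = 1 / p by ring, show p / 2 * (2 / p) = 1 by field_simp,
          Real.rpow_one, Real.mul_rpow hR0 hY.le, mul_comm (R ^ (1 / p))]
    _ = (Y ^ (1 - 2 / p) * Y ^ (1 / p)) * (R ^ (1 / p) * (1 + e) ^ (2 / p)) * A := by ring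
    _ = _ := by
        rw [← Real.rpow_add hY, show 1 - 2 / p + 1 / p = 1 - 1 / p by ring]

/-- A priori bound for the moment of order `p`, in terms of the data in `L^∞`. -/
lemma exists_moment_le {p Ts : ℝ} (M N : ℝ) (hγ : 1 < γ) (hp : 3 < p) (hp' : p < 6)
    (hγp : γ * (2 * p / 3 - 1) ≤ p - 1 / 2) (hTs : 0 < Ts) :
    ∃ B : ℝ, 0 ≤ B ∧ ∀ (ϱ : ℝ → Torus → ℝ) (v : ℝ → Torus → Vec), Solves γ Ts ϱ v →
      (∀ x, ϱ 0 x ≤ M) → (∀ x, ‖v 0 x‖ ≤ N) → ∀ T, 0 < T → T < Ts →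
      ∀ s ∈ Icc (0 : ℝ) T, moment p 1 (ϱ s) (v s) ≤ B := by
  have hp0 : 0 < p := by linarith
  have hγ1 : 0 < γ - 1 := by linarith
  obtain ⟨K, hK1, hK⟩ := exists_density_le M hp hTs
  set I := M * (1 + N ^ 2) + 2 / (γ - 1) * M ^ γ with hI
  set E := (γ - 1) / 2 * I with hE
  set c := p * (p + 1) / 4 * (K ^ (1 / p) * (1 + E ^ (1 - p / 6)) ^ (2 / p)) with hc
  set J := (1 + 2 * E) * Ts + 12 * γ * I with hJ
  set S₀ := M * (1 + N ^ 2) ^ (p / 2) with hS₀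
  refine ⟨|1 + S₀ + c * J| ^ p, by positivity, fun ϱ v hs hM hN T hT hTTs => ?_⟩
  obtain ⟨ϱt, vt, a, b, h⟩ := hs T hT hTTs
  have hst0 := h.state 0 ⟨le_rfl, hT.le⟩
  have hM0 : 0 ≤ M := (hst0.pos 0).le.trans (hM 0)
  have hI0 : 0 ≤ I := by positivity
  have hE0 : 0 ≤ E := by positivity
  have hc0 : 0 ≤ c := by positivity
  have hJ0 : 0 ≤ J := by positivity
  have hS₀0 : 0 ≤ S₀ := by positivity
  obtain ⟨B, hB⟩ := h.exists_moment_bound p one_pos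
  set F : ℝ → ℝ := fun s => moment p 1 (ϱ s) (v s) with hF
  have hbdd : BddAbove (F '' Icc 0 T) := ⟨B, by rintro _ ⟨s, hs, rfl⟩; exact hB s hs⟩
  set S := sSup (F '' Icc 0 T) with hS
  have hFS : ∀ s ∈ Icc (0 : ℝ) T, F s ≤ S := fun s hs => le_csSup hbdd (mem_image_of_mem F hs)
  have hS0 : 0 ≤ S := (hst0.moment_nonneg p one_pos).trans (hFS 0 ⟨le_rfl, hT.le⟩)
  have hR := hK γ ϱ v hs hM T hT hTTs S hFS
  set Y := 1 + S with hY
  have hY1 : 1 ≤ Y := by linarith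
  have hdi := (h.energy_le hγ hT.le).1
  have hFle : ∀ t ∈ Icc (0 : ℝ) T, F t ≤ S₀ + c * J * Y ^ (1 - 1 / p) := fun t ht => by
    have h1 := h.moment_le (m := p) (by linarith) one_pos ht
    have h2 := hst0.moment_le_of_bounds (m := p) (δ := 1) hp0.le one_pos hM hN
    have h3 : ∫ r in (0 : ℝ)..t, p * (p + 1) / 4 *
        ∫ x, ϱ r x ^ (2 * γ - 1) * sqSpeed 1 (v r x) ^ (p / 2 - 1)
        ≤ ∫ r in (0 : ℝ)..t, c * Y ^ (1 - 1 / p) *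
          (1 + 2 * E + 24 * γ ^ 2 * dissipation γ (ϱ r) (a r)) := by
      refine intervalIntegral.integral_mono_on ht.1 ((IntegrableOn.intervalIntegrable_of_le
        (h.integrableOn_source _ _ one_pos) ht).const_mul _) (((intervalIntegrable_const).add
        ((IntegrableOn.intervalIntegrable_of_le hdi ht).const_mul _)).const_mul _) fun r hr => ?_
      have hrT : r ∈ Icc (0 : ℝ) T := ⟨hr.1, hr.2.trans ht.2⟩
      have h4 := (h.state r hrT).source_le_dissipation hγ hp hp' hγp (hR r hrT) (hFS r hrT)
        (h.energy_bounds hγ hT.le hM hN hI hrT).1 (by linarith) (by linarith) (by linarith)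
      refine (mul_le_mul_of_nonneg_left h4 (by positivity)).trans (le_of_eq ?_)
      rw [hc]; ring
    have h5 : ∫ r in (0 : ℝ)..t, c * Y ^ (1 - 1 / p) *
          (1 + 2 * E + 24 * γ ^ 2 * dissipation γ (ϱ r) (a r))
        ≤ c * Y ^ (1 - 1 / p) * J := by
      rw [intervalIntegral.integral_const_mul,
        intervalIntegral.integral_add intervalIntegrable_const
        ((IntegrableOn.intervalIntegrable_of_le hdi ht).const_mul _),
        intervalIntegral.integral_const_mul, intervalIntegral.integral_const]
      refine mul_le_mul_of_nonneg_left ?_ (by positivity)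
      have h6 := (h.energy_bounds hγ hT.le hM hN hI ht).2
      have h7 : 24 * γ ^ 2 * (∫ r in (0 : ℝ)..t, dissipation γ (ϱ r) (a r)) ≤ 12 * γ * I := by
        have := mul_le_mul_of_nonneg_left h6 (show 0 ≤ 12 * γ by linarith)
        linarith
      have h8 : (t - 0) • (1 + 2 * E) ≤ (1 + 2 * E) * Ts := by
        rw [sub_zero, smul_eq_mul, mul_comm]
        exact mul_le_mul_of_nonneg_left (ht.2.trans hTTs.le) (by positivity)
      linarith
    have h9 : F t ≤ F 0 + _ := h1
    have h10 : F 0 ≤ S₀ := h2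
    linarith
  have hSle : S ≤ S₀ + c * J * Y ^ (1 - 1 / p) :=
    csSup_le ⟨_, mem_image_of_mem F ⟨le_rfl, hT.le⟩⟩ (by rintro _ ⟨t, ht, rfl⟩; exact hFle t ht)
  have hθ : 0 ≤ 1 - 1 / p := by
    have : 1 / p ≤ 1 := by rw [div_le_one hp0]; linarith
    linarith
  have hYle : Y ≤ (1 + S₀ + c * J) * Y ^ (1 - 1 / p) := by
    have := Real.one_le_rpow hY1 hθ
    nlinarith
  -- absorption of the power `1 - 1 / p` of `Y`
  have hY2 : Y ^ (1 / p) ≤ 1 + S₀ + c * J := by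
    have e1 : Y = Y ^ (1 / p) * Y ^ (1 - 1 / p) := by
      rw [← Real.rpow_add (by linarith)]; simp
    have h4 : Y ^ (1 / p) * Y ^ (1 - 1 / p) ≤ (1 + S₀ + c * J) * Y ^ (1 - 1 / p) := by
      rw [← e1]; exact hYle
    exact le_of_mul_le_mul_right h4 (Real.rpow_pos_of_pos (by linarith) _)
  have hY3 : Y ≤ |1 + S₀ + c * J| ^ p := by
    rw [abs_of_nonneg (by positivity)]
    have := Real.rpow_le_rpow (by positivity) hY2 hp0.le
    rwa [← Real.rpow_mul (by linarith), one_div_mul_cancel hp0.ne', Real.rpow_one] at this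
  intro s hsI
  have := hFS s hsI
  simp only [hF] at this
  linarith

end

section

/-! ### Moments of all orders -/

/-- An abstract Gronwall lemma: an a priori bound `Z e ^ (l t)` that always improves to
`(A + Z / 2) e ^ (l t)` holds with `Z = 2 A`. -/
lemma le_of_forall_improve {ι : Type*} {Y : ℝ → ι → ℝ} {T l A B : ℝ} (hl : 0 ≤ l) (hA : 0 ≤ A)
    (hB : ∀ s ∈ Icc (0 : ℝ) T, ∀ x, Y s x ≤ B)
    (h : ∀ Z : ℝ, 0 ≤ Z → (∀ s ∈ Icc (0 : ℝ) T, ∀ x, Y s x ≤ Z * Real.exp (l * s)) →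
      ∀ t ∈ Icc (0 : ℝ) T, ∀ x, Y t x ≤ (A + Z / 2) * Real.exp (l * t)) :
    ∀ t ∈ Icc (0 : ℝ) T, ∀ x, Y t x ≤ 2 * A * Real.exp (l * t) := by
  set W : Set ℝ := {w | ∃ s ∈ Icc (0 : ℝ) T, ∃ x, w = max 0 (Real.exp (-(l * s)) * Y s x)} with hW
  have hinv : ∀ s, Real.exp (-(l * s)) * Real.exp (l * s) = 1 := fun s => by
    rw [← Real.exp_add]; simp
  have hbdd : BddAbove W := by
    refine ⟨max 0 B, ?_⟩
    rintro _ ⟨s, hs, x, rfl⟩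
    refine max_le (le_max_left _ _) ?_
    have h1 : Real.exp (-(l * s)) ≤ 1 := Real.exp_le_one_iff.2 (by
      have := mul_nonneg hl hs.1; linarith)
    calc Real.exp (-(l * s)) * Y s x ≤ Real.exp (-(l * s)) * max 0 B :=
          mul_le_mul_of_nonneg_left ((hB s hs x).trans (le_max_right _ _)) (Real.exp_pos _).le
      _ ≤ max 0 B := mul_le_of_le_one_left (le_max_left _ _) h1
  intro t ht x
  have hmem : ∀ s ∈ Icc (0 : ℝ) T, ∀ x, max 0 (Real.exp (-(l * s)) * Y s x) ≤ sSup W :=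
    fun s hs x => le_csSup hbdd ⟨s, hs, x, rfl⟩
  have hZ0 : 0 ≤ sSup W := (le_max_left _ _).trans (hmem t ht x)
  have hback : ∀ s y z, Real.exp (-(l * s)) * y ≤ z → y ≤ z * Real.exp (l * s) :=
    fun s y z hyz => by
    have := mul_le_mul_of_nonneg_right hyz (Real.exp_pos (l * s)).le
    rwa [mul_right_comm, hinv, one_mul] at this
  have hbound : ∀ s ∈ Icc (0 : ℝ) T, ∀ x, Y s x ≤ sSup W * Real.exp (l * s) := fun s hs x =>
    hback s _ _ ((le_max_right _ _).trans (hmem s hs x))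
  have himp := h (sSup W) hZ0 hbound
  have hle : sSup W ≤ A + sSup W / 2 := by
    refine csSup_le ⟨_, t, ht, x, rfl⟩ ?_
    rintro _ ⟨s, hs, y, rfl⟩
    refine max_le (by positivity) ?_
    have := mul_le_mul_of_nonneg_left (himp s hs y) (Real.exp_pos (-(l * s))).le
    rwa [mul_left_comm, hinv, mul_one] at this
  exact (hbound t ht x).trans (mul_le_mul_of_nonneg_right (by linarith) (Real.exp_pos _).le)

lemma integral_exp_mul_le {l t : ℝ} (hl : 0 < l) :
    ∫ s in (0 : ℝ)..t, Real.exp (l * s) ≤ Real.exp (l * t) / l := by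
  rw [intervalIntegral.integral_comp_mul_left (fun s => Real.exp s) hl.ne', integral_exp,
    smul_eq_mul, mul_zero, Real.exp_zero, div_eq_inv_mul]
  exact mul_le_mul_of_nonneg_left (by linarith) (by positivity)

variable {γ T : ℝ} {ϱ : ℝ → Torus → ℝ} {v : ℝ → Torus → Vec} {ϱt : ℝ → Torus → ℝ}
  {vt : ℝ → Torus → Vec} {a : ℝ → Fin 3 → Torus → ℝ} {b : ℝ → Fin 3 → Fin 3 → Torus → ℝ}

/-- Growth of the moments with the shift `δ = m`, for which the growth rate is linear in `m`. -/
lemma Evolution.moment_le_exp (h : Evolution γ T ϱ v ϱt vt a b) (hγ : 1 < γ) {m R : ℝ}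
    (hm : 2 ≤ m) (hR : ∀ s ∈ Icc (0 : ℝ) T, ∀ x, ϱ s x ≤ R) (hT : 0 ≤ T) :
    ∀ t ∈ Icc (0 : ℝ) T, moment m m (ϱ t) (v t)
      ≤ 2 * moment m m (ϱ 0) (v 0) * Real.exp (2 * R ^ (2 * γ - 2) * m * t) := by
  have hm0 : 0 < m := by linarith
  have h0T : (0 : ℝ) ∈ Icc 0 T := ⟨le_rfl, hT⟩
  have hR0 : 0 < R := ((h.state 0 h0T).pos 0).trans_le (hR 0 h0T 0)
  set k := R ^ (2 * γ - 2) with hk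
  have hk0 : 0 < k := Real.rpow_pos_of_pos hR0 _
  obtain ⟨B, hB⟩ := h.exists_moment_bound m hm0
  have hA0 := (h.state 0 h0T).moment_nonneg m hm0
  intro t ht
  refine le_of_forall_improve (ι := Unit) (Y := fun s _ => moment m m (ϱ s) (v s))
    (by positivity) hA0 (fun s hs _ => hB s hs) (fun Z hZ hY t ht _ => ?_) t ht ()
  have h1 := h.moment_le hm hm0 ht
  have hsrc : ∀ r ∈ Icc (0 : ℝ) T, ∫ x, ϱ r x ^ (2 * γ - 1) * sqSpeed m (v r x) ^ (m / 2 - 1)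
      ≤ k / m * moment m m (ϱ r) (v r) := fun r hr => by
    have hst := h.state r hr
    rw [moment, ← integral_const_mul]
    refine integral_mono (continuous_integrable ((hst.cont_comp (continuousOn_rpow_Ioi _)).mul
      (hst.cont_sqSpeed_rpow hm0 _))) (continuous_integrable (continuous_const.mul
      (hst.continuous_moment m hm0))) fun x => ?_
    have hx := hst.pos x
    have hw := sqSpeed_pos hm0 (v r x)
    have e1 : ϱ r x ^ (2 * γ - 1) ≤ k * ϱ r x := by
      rw [show 2 * γ - 1 = 2 * γ - 2 + 1 by ring, Real.rpow_add hx, Real.rpow_one]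
      exact mul_le_mul_of_nonneg_right (Real.rpow_le_rpow hx.le (hR r hr x) (by linarith)) hx.le
    have e2 : sqSpeed m (v r x) ^ (m / 2 - 1) ≤ sqSpeed m (v r x) ^ (m / 2) / m := by
      rw [Real.rpow_sub hw, Real.rpow_one]
      exact div_le_div_of_nonneg_left (Real.rpow_nonneg hw.le _) hm0 (le_sqSpeed _ _)
    calc _ ≤ (k * ϱ r x) * (sqSpeed m (v r x) ^ (m / 2) / m) :=
          mul_le_mul e1 e2 (Real.rpow_nonneg hw.le _) (by positivity)
      _ = _ := by ring
  have h2 : ∫ r in (0 : ℝ)..t, m * (m + 1) / 4 *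
        ∫ x, ϱ r x ^ (2 * γ - 1) * sqSpeed m (v r x) ^ (m / 2 - 1)
      ≤ ∫ r in (0 : ℝ)..t, k * m * Z * Real.exp (2 * k * m * r) := by
    refine intervalIntegral.integral_mono_on ht.1 ((IntegrableOn.intervalIntegrable_of_le
        (h.integrableOn_source _ _ hm0) ht).const_mul _)
        (Continuous.intervalIntegrable (by fun_prop) _ _) fun r hr => ?_
    have hrT : r ∈ Icc (0 : ℝ) T := ⟨hr.1, hr.2.trans ht.2⟩
    have h3 := hY r hrT ()
    have h4 : 0 ≤ Z * Real.exp (2 * k * m * r) := by positivity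
    calc _ ≤ m * (m + 1) / 4 * (k / m * (Z * Real.exp (2 * k * m * r))) :=
          mul_le_mul_of_nonneg_left ((hsrc r hrT).trans
            (mul_le_mul_of_nonneg_left h3 (by positivity))) (by positivity)
      _ = (m + 1) / 4 * (k * (Z * Real.exp (2 * k * m * r))) := by field_simp
      _ ≤ m * (k * (Z * Real.exp (2 * k * m * r))) :=
          mul_le_mul_of_nonneg_right (by linarith) (by positivity)
      _ = _ := by ring
  have h3 := mul_le_mul_of_nonneg_left
    (integral_exp_mul_le (t := t) (show 0 < 2 * k * m by positivity))
    (show 0 ≤ k * m * Z by positivity)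
  rw [← intervalIntegral.integral_const_mul] at h3
  have h4 : k * m * Z * (Real.exp (2 * k * m * t) / (2 * k * m))
      = Z / 2 * Real.exp (2 * k * m * t) := by field_simp
  have h5 : 1 ≤ Real.exp (2 * k * m * t) := Real.one_le_exp (by
    have := ht.1; positivity)
  have h6 : moment m m (ϱ 0) (v 0) ≤ moment m m (ϱ 0) (v 0) * Real.exp (2 * k * m * t) :=
    le_mul_of_one_le_right hA0 h5
  linarith

/-- The moments grow with the order at most like those of a Gaussian. -/
lemma Evolution.integral_density_mul_norm_rpow_le (h : Evolution γ T ϱ v ϱt vt a b) (hγ : 1 < γ)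
    {m R M N Ts D : ℝ} (hm : 2 ≤ m) (hR : ∀ s ∈ Icc (0 : ℝ) T, ∀ x, ϱ s x ≤ R) (hT : 0 ≤ T)
    (hTs : T ≤ Ts) (hM1 : 1 ≤ M) (hM : ∀ x, ϱ 0 x ≤ M) (hN : ∀ x, ‖v 0 x‖ ≤ N)
    (hD : D = 2 * M * (1 + N ^ 2) ^ (1 / 2 : ℝ) * Real.exp (2 * R ^ (2 * γ - 2) * Ts)) :
    ∀ t ∈ Icc (0 : ℝ) T, ∫ x, ϱ t x * ‖v t x‖ ^ m ≤ D ^ m * m ^ (m / 2) := by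
  have hm0 : 0 < m := by linarith
  have h0T : (0 : ℝ) ∈ Icc 0 T := ⟨le_rfl, hT⟩
  have hR0 : 0 < R := ((h.state 0 h0T).pos 0).trans_le (hR 0 h0T 0)
  intro t ht
  have hst := h.state t ht
  have h1 : ∫ x, ϱ t x * ‖v t x‖ ^ m ≤ moment m m (ϱ t) (v t) := by
    refine integral_mono (continuous_integrable (hst.cont.mul (hst.contv.norm.rpow_const
      fun x => Or.inr hm0.le))) (continuous_integrable (hst.continuous_moment m hm0)) fun x => ?_
    refine mul_le_mul_of_nonneg_left ?_ (hst.pos x).le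
    rw [sqSpeed_eq]
    have e : ‖v t x‖ ^ m = (‖v t x‖ ^ 2) ^ (m / 2) := by
      rw [← Real.rpow_natCast, ← Real.rpow_mul (norm_nonneg _)]; congr 1; push_cast; ring
    rw [e]
    exact Real.rpow_le_rpow (sq_nonneg _) (by linarith) (by positivity)
  have h2 := h.moment_le_exp hγ hm hR hT t ht
  have h3 := (h.state 0 h0T).moment_le_of_bounds hm0.le hm0 hM hN
  have h4 : m + N ^ 2 ≤ m * (1 + N ^ 2) := by nlinarith [sq_nonneg N]
  have h5 : (m + N ^ 2) ^ (m / 2) ≤ m ^ (m / 2) * (1 + N ^ 2) ^ (m / 2) := by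
    rw [← Real.mul_rpow hm0.le (by positivity)]
    exact Real.rpow_le_rpow (by positivity) h4 (by positivity)
  have h6 : Real.exp (2 * R ^ (2 * γ - 2) * m * t)
      ≤ Real.exp (2 * R ^ (2 * γ - 2) * Ts) ^ m := by
    rw [← Real.exp_mul]
    refine Real.exp_le_exp.2 ?_
    have := mul_le_mul_of_nonneg_left (ht.2.trans hTs)
      (show 0 ≤ 2 * R ^ (2 * γ - 2) * m by positivity)
    linarith
  have h7 : 2 * M ≤ (2 * M) ^ m := by
    have := Real.rpow_le_rpow_of_exponent_le (show 1 ≤ 2 * M by linarith)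
      (show 1 ≤ m by linarith)
    rwa [Real.rpow_one] at this
  have h8 : ((1 + N ^ 2) ^ (1 / 2 : ℝ)) ^ m = (1 + N ^ 2) ^ (m / 2) := by
    rw [← Real.rpow_mul (by positivity)]; ring_nf
  calc _ ≤ _ := h1
    _ ≤ _ := h2
    _ ≤ 2 * (M * (m ^ (m / 2) * (1 + N ^ 2) ^ (m / 2))) *
        Real.exp (2 * R ^ (2 * γ - 2) * Ts) ^ m := by
        have := h3.trans (mul_le_mul_of_nonneg_left h5 (by linarith))
        gcongr
    _ = (2 * M) * ((1 + N ^ 2) ^ (m / 2) * Real.exp (2 * R ^ (2 * γ - 2) * Ts) ^ m *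
        m ^ (m / 2)) := by ring
    _ ≤ (2 * M) ^ m * ((1 + N ^ 2) ^ (m / 2) * Real.exp (2 * R ^ (2 * γ - 2) * Ts) ^ m *
        m ^ (m / 2)) := mul_le_mul_of_nonneg_right h7 (by positivity)
    _ = D ^ m * m ^ (m / 2) := by
        rw [hD, Real.mul_rpow (by positivity) (Real.exp_pos _).le, Real.mul_rpow (x := 2 * M)
          (by linarith) (by positivity), h8]
        ring

end

/-! ### Lower bound for the density -/

section Snapshot

variable {ϱ : Torus → ℝ} {v : Torus → Vec} {a : Fin 3 → Torus → ℝ} {b : Fin 3 → Fin 3 → Torus → ℝ}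

/-- If `ϱ ≥ e ^ (-L)`, the local kinetic energy grows only linearly in `L`: the moment of order
`6 + L` costs a factor `e ^ (2 L / (6 + L)) ≤ e ^ 2`. -/
lemma State.integral_norm_sq_kern_le (h : State ϱ v a b) {L D C₀ τ : ℝ} (hL : 0 ≤ L)
    (hϱ : ∀ x, Real.exp (-L) ≤ ϱ x) (hD : 0 ≤ D)
    (hm : ∫ x, ϱ x * ‖v x‖ ^ (6 + L) ≤ D ^ (6 + L) * (6 + L) ^ ((6 + L) / 2))
    (hτ : 0 < τ) (hC1 : 1 ≤ C₀) (hC₀ : ∫ x, kern (heatExp / 2) τ x ≤ C₀) (x₀ : Torus) :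
    ∫ x, ‖v x‖ ^ 2 * kern (heatExp / 2) τ (x - x₀)
      ≤ 6 * Real.exp 2 * D ^ 2 * C₀ * (1 + τ ^ (-(1 / 2) : ℝ)) * (1 + L) := by
  set m := 6 + L with hmd
  have hm0 : 0 < m := by linarith
  have hθ0 : 0 < 2 / m := by positivity
  have hθ : 2 / m < 1 := by rw [div_lt_one hm0]; linarith
  have hk : Continuous fun x => kern (heatExp / 2) τ (x - x₀) :=
    (continuous_kern _ _).comp (continuous_id.sub continuous_const)
  have hkp : ∀ x, 0 < kern (heatExp / 2) τ (x - x₀) := fun x => kern_pos _ hτ _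
  have hvm : Continuous fun x => ‖v x‖ ^ m := h.contv.norm.rpow_const fun x => Or.inr hm0.le
  have hv0 : ∀ x, 0 ≤ ‖v x‖ ^ m := fun x => Real.rpow_nonneg (norm_nonneg _) _
  have h1 := integral_rpow_mul_rpow_le (continuous_integrable (hvm.mul hk))
    (continuous_integrable hk) (fun x => mul_nonneg (hv0 x) (hkp x).le) (fun x => (hkp x).le)
    hθ0 hθ
  have e1 : ∀ x, (‖v x‖ ^ m * kern (heatExp / 2) τ (x - x₀)) ^ (2 / m) *
      kern (heatExp / 2) τ (x - x₀) ^ (1 - 2 / m)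
      = ‖v x‖ ^ 2 * kern (heatExp / 2) τ (x - x₀) := fun x => by
    rw [Real.mul_rpow (hv0 x) (hkp x).le, ← Real.rpow_mul (norm_nonneg _), mul_assoc,
      ← Real.rpow_add (hkp x), mul_div_cancel₀ _ hm0.ne', Real.rpow_two]
    simp
  simp only [Pi.mul_apply, e1] at h1
  have h2 : ∫ x, ‖v x‖ ^ m * kern (heatExp / 2) τ (x - x₀)
      ≤ τ ^ (-(3 / 2) : ℝ) * (Real.exp L * (D ^ m * m ^ (m / 2))) := by
    refine le_trans ?_ (mul_le_mul_of_nonneg_left (mul_le_mul_of_nonneg_left hm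
      (Real.exp_pos L).le) (Real.rpow_nonneg hτ.le _))
    rw [← integral_const_mul, ← integral_const_mul]
    refine integral_mono (continuous_integrable (hvm.mul hk)) (continuous_integrable
      (continuous_const.mul (continuous_const.mul (h.cont.mul hvm)))) fun x => ?_
    simp only
    have h3 : 1 ≤ Real.exp L * ϱ x := by
      have := mul_le_mul_of_nonneg_left (hϱ x) (Real.exp_pos L).le
      rwa [← Real.exp_add, add_neg_cancel, Real.exp_zero] at this
    have h4 := kern_le (show 0 ≤ heatExp / 2 by linarith [heatExp_pos]) hτ (x - x₀)
    calc ‖v x‖ ^ m * kern (heatExp / 2) τ (x - x₀) ≤ ‖v x‖ ^ m * τ ^ (-(3 / 2) : ℝ) :=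
          mul_le_mul_of_nonneg_left h4 (hv0 x)
      _ ≤ (‖v x‖ ^ m * τ ^ (-(3 / 2) : ℝ)) * (Real.exp L * ϱ x) :=
          le_mul_of_one_le_right (mul_nonneg (hv0 x) (Real.rpow_nonneg hτ.le _)) h3
      _ = _ := by ring
  have hI0 : 0 ≤ ∫ x, ‖v x‖ ^ m * kern (heatExp / 2) τ (x - x₀) :=
    integral_nonneg fun x => mul_nonneg (hv0 x) (hkp x).le
  have hJ0 : 0 ≤ ∫ x, kern (heatExp / 2) τ (x - x₀) := integral_nonneg fun x => (hkp x).le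
  have h3 : (∫ x, ‖v x‖ ^ m * kern (heatExp / 2) τ (x - x₀)) ^ (2 / m)
      ≤ τ ^ (-(3 / m)) * (Real.exp 2 * (D ^ 2 * m)) := by
    refine (Real.rpow_le_rpow hI0 h2 hθ0.le).trans ?_
    rw [Real.mul_rpow (by positivity) (by positivity), Real.mul_rpow (by positivity)
      (by positivity), Real.mul_rpow (by positivity) (by positivity), ← Real.rpow_mul hτ.le,
      ← Real.rpow_mul hD, ← Real.rpow_mul hm0.le, ← Real.exp_mul, mul_div_cancel₀ _ hm0.ne',
      Real.rpow_two, show m / 2 * (2 / m) = 1 by field_simp, Real.rpow_one,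
      show -(3 / 2) * (2 / m) = -(3 / m) by ring]
    have : L * (2 / m) ≤ 2 := by
      rw [mul_div_assoc', div_le_iff₀ hm0]; linarith
    gcongr
  have h4 : (∫ x, kern (heatExp / 2) τ (x - x₀)) ^ (1 - 2 / m) ≤ C₀ := by
    rw [integral_sub_right (kern (heatExp / 2) τ) x₀] at hJ0 ⊢
    calc _ ≤ C₀ ^ (1 - 2 / m) := Real.rpow_le_rpow hJ0 hC₀ (by linarith)
      _ ≤ C₀ ^ (1 : ℝ) := Real.rpow_le_rpow_of_exponent_le hC1 (by linarith)
      _ = C₀ := Real.rpow_one _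
  have h5 : τ ^ (-(3 / m)) ≤ 1 + τ ^ (-(1 / 2) : ℝ) := by
    have hp := Real.rpow_pos_of_pos hτ (-(1 / 2) : ℝ)
    rcases le_total τ 1 with h | h
    · have : 3 / m ≤ 1 / 2 := by rw [div_le_iff₀ hm0]; linarith
      have := Real.rpow_le_rpow_of_exponent_ge hτ h (show -(1 / 2) ≤ -(3 / m) by linarith)
      linarith
    · have := Real.rpow_le_one_of_one_le_of_nonpos h (show -(3 / m) ≤ 0 by
        rw [neg_nonpos]; positivity)
      linarith
  calc _ ≤ _ := h1
    _ ≤ ((1 + τ ^ (-(1 / 2) : ℝ)) * (Real.exp 2 * (D ^ 2 * m))) * C₀ := by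
        refine mul_le_mul (h3.trans (mul_le_mul_of_nonneg_right h5 (by positivity))) h4
          (Real.rpow_nonneg hJ0 _) (by positivity)
    _ = (1 + τ ^ (-(1 / 2) : ℝ)) * Real.exp 2 * D ^ 2 * C₀ * m := by ring
    _ ≤ (1 + τ ^ (-(1 / 2) : ℝ)) * Real.exp 2 * D ^ 2 * C₀ * (6 * (1 + L)) :=
        mul_le_mul_of_nonneg_left (by linarith) (by positivity)
    _ = _ := by ring

/-- The source in the equation of `-log ϱ`, averaged with the kernel. -/
lemma State.integral_log_source_le (h : State ϱ v a b) {L D C₀ τ : ℝ} (hL : 0 ≤ L)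
    (hϱ : ∀ x, Real.exp (-L) ≤ ϱ x) (hD : 0 ≤ D)
    (hm : ∫ x, ϱ x * ‖v x‖ ^ (6 + L) ≤ D ^ (6 + L) * (6 + L) ^ ((6 + L) / 2))
    (hτ : 0 < τ) (hC1 : 1 ≤ C₀) (hC₀ : ∫ x, kern (heatExp / 2) τ x ≤ C₀) (x₀ : Torus) :
    ∫ x, (1 / 4 * ‖v x‖ ^ 2 + 3 * τ ^ (-(1 / 2) : ℝ) * (1 * ‖v x‖)) *
        kern (heatExp / 2) τ (x - x₀)
      ≤ (3 * C₀ + 42 * Real.exp 2 * D ^ 2 * C₀) * (1 + τ ^ (-(3 / 4) : ℝ)) * (1 + L) := by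
  have hQ := h.integral_norm_sq_kern_le hL hϱ hD hm hτ hC1 hC₀ x₀
  have hk : Continuous fun x => kern (heatExp / 2) τ (x - x₀) :=
    (continuous_kern _ _).comp (continuous_id.sub continuous_const)
  have hkp : ∀ x, 0 < kern (heatExp / 2) τ (x - x₀) := fun x => kern_pos _ hτ _
  -- powers of `σ = τ ^ (-1/4)`
  set σ := τ ^ (-(1 / 4) : ℝ) with hσ
  have hσ0 : 0 < σ := Real.rpow_pos_of_pos hτ _
  have e2 : τ ^ (-(1 / 2) : ℝ) = σ ^ 2 := by
    rw [hσ, ← Real.rpow_natCast, ← Real.rpow_mul hτ.le]; norm_num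
  have e3 : τ ^ (-(3 / 4) : ℝ) = σ ^ 3 := by
    rw [hσ, ← Real.rpow_natCast, ← Real.rpow_mul hτ.le]; norm_num
  rw [e2] at hQ ⊢
  rw [e3]
  set q := Real.exp 2 * D ^ 2 * C₀ with hq
  have hq0 : 0 ≤ q := by positivity
  have hQ0 : ∫ x, ‖v x‖ ^ 2 * kern (heatExp / 2) τ (x - x₀) ≤ 6 * q * (1 + σ ^ 2) * (1 + L) := by
    refine hQ.trans (le_of_eq ?_); rw [hq]; ring
  have hK : ∫ x, kern (heatExp / 2) τ (x - x₀) ≤ C₀ := by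
    rwa [integral_sub_right (kern (heatExp / 2) τ) x₀]
  have i1 : Integrable fun x => ‖v x‖ ^ 2 * kern (heatExp / 2) τ (x - x₀) :=
    continuous_integrable ((h.contv.norm.pow 2).mul hk)
  have i2 := continuous_integrable hk
  -- Young's inequality `‖v‖ ≤ σ + ‖v‖² / σ`
  have h1 : ∫ x, (1 / 4 * ‖v x‖ ^ 2 + 3 * σ ^ 2 * (1 * ‖v x‖)) * kern (heatExp / 2) τ (x - x₀)
      ≤ (1 / 4 + 3 * σ) * (∫ x, ‖v x‖ ^ 2 * kern (heatExp / 2) τ (x - x₀))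
        + 3 * σ ^ 3 * ∫ x, kern (heatExp / 2) τ (x - x₀) := by
    rw [← integral_const_mul, ← integral_const_mul,
      ← integral_add (i1.const_mul _) (i2.const_mul _)]
    refine integral_mono (continuous_integrable (((continuous_const.mul (h.contv.norm.pow 2)).add
      (continuous_const.mul (continuous_const.mul h.contv.norm))).mul hk))
      ((i1.const_mul _).add (i2.const_mul _)) fun x => ?_
    simp only
    have h2 : σ ^ 2 * ‖v x‖ ≤ σ ^ 3 + σ * ‖v x‖ ^ 2 := by
      nlinarith [mul_nonneg hσ0.le (sq_nonneg (σ - ‖v x‖)), norm_nonneg (v x),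
        mul_nonneg (mul_nonneg hσ0.le hσ0.le) (norm_nonneg (v x))]
    have h3 := mul_le_mul_of_nonneg_right h2 (hkp x).le
    linarith
  have h2 : (1 / 4 + 3 * σ) * (∫ x, ‖v x‖ ^ 2 * kern (heatExp / 2) τ (x - x₀))
      ≤ (1 / 4 + 3 * σ) * (6 * q * (1 + σ ^ 2) * (1 + L)) :=
    mul_le_mul_of_nonneg_left hQ0 (by positivity)
  have h3 : 3 * σ ^ 3 * (∫ x, kern (heatExp / 2) τ (x - x₀)) ≤ 3 * σ ^ 3 * C₀ :=
    mul_le_mul_of_nonneg_left hK (by positivity)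
  have h4 : (1 / 4 + 3 * σ) * (1 + σ ^ 2) ≤ 7 * (1 + σ ^ 3) := by
    nlinarith [mul_nonneg (by positivity : (0 : ℝ) ≤ 1 + σ) (sq_nonneg (σ - 1)),
      pow_pos hσ0 3]
  have h5 := mul_le_mul_of_nonneg_left h4 (show 0 ≤ 6 * q * (1 + L) by positivity)
  have h6 : 3 * σ ^ 3 * C₀ ≤ 3 * C₀ * (1 + σ ^ 3) * (1 + L) := by
    have : 0 ≤ 3 * C₀ * L * (1 + σ ^ 3) := by positivity
    nlinarith
  calc _ ≤ _ := h1
    _ ≤ 6 * q * (1 + L) * (7 * (1 + σ ^ 3)) + 3 * C₀ * (1 + σ ^ 3) * (1 + L) := by linarith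
    _ = _ := by rw [hq]; ring

end Snapshot

section

/-- Decay of the exponential, traded for a small loss of integrability at zero. -/
lemma exp_neg_le_rpow {x : ℝ} (hx : 0 < x) : Real.exp (-x) ≤ x ^ (-(1 / 8) : ℝ) := by
  rw [Real.exp_neg, Real.rpow_neg hx.le]
  refine inv_anti₀ (Real.rpow_pos_of_pos hx _) ?_
  rcases le_total x 1 with h | h
  · exact (Real.rpow_le_one hx.le h (by norm_num)).trans (Real.one_le_exp hx.le)
  · have h1 := Real.rpow_le_rpow_of_exponent_le h (show (1 / 8 : ℝ) ≤ 1 by norm_num)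
    rw [Real.rpow_one] at h1
    linarith [Real.add_one_le_exp x]

variable {γ T : ℝ} {ϱ : ℝ → Torus → ℝ} {v : ℝ → Torus → Vec} {ϱt : ℝ → Torus → ℝ}
  {vt : ℝ → Torus → Vec} {a : ℝ → Fin 3 → Torus → ℝ} {b : ℝ → Fin 3 → Fin 3 → Torus → ℝ}

/-- A bound `Z e ^ (l s)` for `-log ϱ` on `[0, T]` reproduces itself at time `T`, with a factor
that is small for large `l`. -/
lemma Evolution.neg_log_density_le (h : Evolution γ T ϱ v ϱt vt a b) (hT : 0 < T)
    {R D C₀ M₀ l Z : ℝ} (hR : ∀ s ∈ Icc (0 : ℝ) T, ∀ x, ϱ s x ≤ R) (hR1 : 1 ≤ R) (hD : 0 ≤ D)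
    (hm : ∀ m : ℝ, 2 ≤ m → ∀ s ∈ Icc (0 : ℝ) T, ∫ x, ϱ s x * ‖v s x‖ ^ m ≤ D ^ m * m ^ (m / 2))
    (hC1 : 1 ≤ C₀) (hC₀ : ∀ τ : ℝ, 0 < τ → ∫ x, kern (heatExp / 2) τ x ≤ C₀)
    (hM₀ : ∀ x, Real.log R - Real.log (ϱ 0 x) ≤ M₀) (hl : 0 < l) (hZ : 0 ≤ Z)
    (hlog : ∀ s ∈ Icc (0 : ℝ) T, ∀ x, -Real.log (ϱ s x) ≤ Z * Real.exp (l * s)) (x₀ : Torus) :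
    -Real.log (ϱ T x₀) ≤ Real.exp (3 * Real.pi ^ 2 * T) * (C₀ * M₀ +
      (3 * C₀ + 42 * Real.exp 2 * D ^ 2 * C₀) * (1 + Z) * Real.exp (l * T) * l ^ (-(1 / 8) : ℝ) *
        (T ^ (1 - 1 / 8 : ℝ) / (1 - 1 / 8) + T ^ (1 - 7 / 8 : ℝ) / (1 - 7 / 8))) := by
  set C := 3 * C₀ + 42 * Real.exp 2 * D ^ 2 * C₀ with hC
  have hCpos : 0 ≤ C := by positivity
  have b1 : (1 / 8 : ℝ) < 1 := by norm_num
  have b2 : (7 / 8 : ℝ) < 1 := by norm_num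
  rw [← integral_sub_rpow b1, ← integral_sub_rpow b2, ← intervalIntegral.integral_add
    (intervalIntegrable_sub_rpow b1) (intervalIntegrable_sub_rpow b2),
    ← intervalIntegral.integral_const_mul]
  have hlogR : 0 ≤ Real.log R := Real.log_nonneg hR1
  have key := h.comp_density_le hT (G := fun y => Real.log R - Real.log y) (G' := fun y => -y⁻¹)
    (G'' := fun y => (y ^ 2)⁻¹) (H := fun _ => 1) (c := 1 / 4) (R := R) (C₀ := C₀) (M₀ := M₀)
    (B := fun r => C * (1 + Z) * Real.exp (l * T) * l ^ (-(1 / 8) : ℝ) *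
      ((T - r) ^ (-(1 / 8) : ℝ) + (T - r) ^ (-(7 / 8) : ℝ)))
    (fun y hy => (Real.hasDerivAt_log (ne_of_gt hy)).const_sub _)
    (fun y hy => (hasDerivAt_inv (mem_Ioi.1 hy).ne').neg.congr_deriv (by simp))
    (ContinuousOn.inv₀ (by fun_prop) fun y hy => pow_ne_zero 2 (ne_of_gt hy)) hR
    (fun y hy => sub_nonneg.2 (Real.log_le_log hy.1 hy.2)) (by norm_num)
    (fun y hy A V => by
      have hy0 := hy.1.ne'
      have : (y ^ 2)⁻¹ * (A * (y * V - A)) = 1 / 4 * V ^ 2 - (A / y - V / 2) ^ 2 := by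
        field_simp; ring
      rw [this]
      linarith [sq_nonneg (A / y - V / 2)])
    (fun y hy => by simp [inv_mul_cancel₀ hy.1.ne']) continuousOn_const hC₀ hM₀
    (((intervalIntegrable_sub_rpow b1).add (intervalIntegrable_sub_rpow b2)).const_mul _) ?_ x₀
  · linarith
  -- the weight at time `r` is `e^(l T) e^(-l (T - r))`, and the last factor is small unless `r` is
  -- close to `T`
  intro r hr τ hτ x
  have hrI : r ∈ Icc (0 : ℝ) T := ⟨hr.1, hr.2.le⟩
  have hst := h.state r hrI
  have hTr : 0 < T - r := by linarith [hr.2]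
  have hτ0 : 0 < τ := hTr.trans_le hτ
  set L := Z * Real.exp (l * r) with hLd
  have hL0 : 0 ≤ L := by positivity
  have h1 := hst.integral_log_source_le hL0 (fun y => by
      rw [← Real.le_log_iff_exp_le (hst.pos y)]
      linarith [hlog r hrI y]) hD (hm (6 + L) (by linarith) r hrI) hτ0 hC1 (hC₀ τ hτ0) x
  refine h1.trans ?_
  have h2 : τ ^ (-(3 / 4) : ℝ) ≤ (T - r) ^ (-(3 / 4) : ℝ) :=
    Real.rpow_le_rpow_of_nonpos hTr hτ (by norm_num)
  have hexp1 : 1 ≤ Real.exp (l * r) := Real.one_le_exp (mul_nonneg hl.le hr.1)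
  have h3 : 1 + L ≤ (1 + Z) * Real.exp (l * r) := by rw [hLd]; linarith
  have h4 : Real.exp (l * r)
      ≤ Real.exp (l * T) * (l ^ (-(1 / 8) : ℝ) * (T - r) ^ (-(1 / 8) : ℝ)) := by
    have := exp_neg_le_rpow (mul_pos hl hTr)
    rw [Real.mul_rpow hl.le hTr.le] at this
    calc Real.exp (l * r) = Real.exp (l * T) * Real.exp (-(l * (T - r))) := by
          rw [← Real.exp_add]; ring_nf
      _ ≤ _ := mul_le_mul_of_nonneg_left this (Real.exp_pos _).le
  have h5 : (T - r) ^ (-(1 / 8) : ℝ) * (1 + (T - r) ^ (-(3 / 4) : ℝ))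
      = (T - r) ^ (-(1 / 8) : ℝ) + (T - r) ^ (-(7 / 8) : ℝ) := by
    rw [mul_add, ← Real.rpow_add hTr]; norm_num
  have hp := Real.rpow_pos_of_pos hTr (-(3 / 4))
  calc C * (1 + τ ^ (-(3 / 4) : ℝ)) * (1 + L)
      ≤ C * (1 + (T - r) ^ (-(3 / 4) : ℝ)) * ((1 + Z) *
        (Real.exp (l * T) * (l ^ (-(1 / 8) : ℝ) * (T - r) ^ (-(1 / 8) : ℝ)))) := by
        have := h3.trans (mul_le_mul_of_nonneg_left h4 (by linarith))
        gcongr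
    _ = C * (1 + Z) * Real.exp (l * T) * l ^ (-(1 / 8) : ℝ) *
        ((T - r) ^ (-(1 / 8) : ℝ) * (1 + (T - r) ^ (-(3 / 4) : ℝ))) := by ring
    _ = _ := by rw [h5]

/-- A density that is bounded above stays away from zero, uniformly up to the time `Ts`. -/
lemma exists_neg_log_density_le {Ts : ℝ} (hγ : 1 < γ) (hTs : 0 < Ts) (R M N M' : ℝ) :
    ∃ C : ℝ, ∀ (ϱ : ℝ → Torus → ℝ) (v : ℝ → Torus → Vec), Solves γ Ts ϱ v →
      (∀ x, ϱ 0 x ≤ M) → (∀ x, ‖v 0 x‖ ≤ N) → (∀ x, (ϱ 0 x)⁻¹ ≤ M') →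
      (∀ T, 0 < T → T < Ts → ∀ s ∈ Icc (0 : ℝ) T, ∀ x, ϱ s x ≤ R) →
      ∀ T, 0 < T → T < Ts → ∀ t ∈ Icc (0 : ℝ) T, ∀ x, -Real.log (ϱ t x) ≤ C := by
  obtain ⟨C₁, -, hC₁'⟩ := exists_integral_kern_le (α := heatExp / 2) (by linarith [heatExp_pos])
  set C₀ := max C₁ 1 with hC₀d
  have hC₀ : ∀ τ : ℝ, 0 < τ → ∫ x, kern (heatExp / 2) τ x ≤ C₀ := fun τ hτ =>
    (hC₁' τ hτ).trans (le_max_left _ _)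
  have hC1 : 1 ≤ C₀ := le_max_right _ _
  set R₁ := max R 1 with hR₁
  have hR1 : 1 ≤ R₁ := le_max_right _ _
  set D := 2 * max M 1 * (1 + N ^ 2) ^ (1 / 2 : ℝ) * Real.exp (2 * R₁ ^ (2 * γ - 2) * Ts) with hD
  have hD0 : 0 ≤ D := by
    have : 0 ≤ max M 1 := zero_le_one.trans (le_max_right _ _)
    positivity
  set M₀ := Real.log R₁ + Real.log (max M' 1) with hM₀
  have hlogR : 0 ≤ Real.log R₁ := Real.log_nonneg hR1
  have hM₀0 : 0 ≤ Real.log (max M' 1) := Real.log_nonneg (le_max_right _ _)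
  set e := Real.exp (3 * Real.pi ^ 2 * Ts) with he
  have he1 : 1 ≤ e := Real.one_le_exp (by positivity)
  set J := Ts ^ (1 - 1 / 8 : ℝ) / (1 - 1 / 8) + Ts ^ (1 - 7 / 8 : ℝ) / (1 - 7 / 8) with hJ
  have hJ0 : 0 ≤ J := add_nonneg (div_nonneg (Real.rpow_nonneg hTs.le _) (by norm_num))
    (div_nonneg (Real.rpow_nonneg hTs.le _) (by norm_num))
  set CB := 3 * C₀ + 42 * Real.exp 2 * D ^ 2 * C₀ with hCB
  have hCB0 : 0 ≤ CB := by positivity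
  set W := e * (CB * J) with hW
  have hW0 : 0 ≤ W := by positivity
  -- the rate for which the factor in `neg_log_density_le` is at most `1 / 2`
  set l := (2 * W + 1) ^ (8 : ℝ) with hl
  have hl0 : 0 < l := by positivity
  have hlW : W * l ^ (-(1 / 8) : ℝ) ≤ 1 / 2 := by
    rw [hl, ← Real.rpow_mul (by positivity), show (8 : ℝ) * -(1 / 8) = -1 by norm_num,
      Real.rpow_neg_one, ← div_eq_mul_inv, div_le_iff₀ (by positivity)]
    linarith
  set A := e * (C₀ * M₀) + 1 / 2 with hA
  have hCM : M₀ ≤ e * (C₀ * M₀) :=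
    (le_mul_of_one_le_left (by positivity) hC1).trans (le_mul_of_one_le_left (by positivity) he1)
  have hA0 : 0 ≤ A := by positivity
  refine ⟨2 * A * Real.exp (l * Ts), fun ϱ v hs hM hN hM' hR T hT hTTs => ?_⟩
  obtain ⟨ϱt, vt, a, b, h⟩ := hs T hT hTTs
  have h0T : (0 : ℝ) ∈ Icc 0 T := ⟨le_rfl, hT.le⟩
  have hpos0 := (h.state 0 h0T).pos
  have hinit : ∀ x, -Real.log (ϱ 0 x) ≤ Real.log (max M' 1) := fun x => by
    rw [← Real.log_inv]
    exact Real.log_le_log (inv_pos.2 (hpos0 x)) ((hM' x).trans (le_max_left _ _))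
  obtain ⟨B, hB⟩ := exists_bound_of_continuousOn_strip (h.continuousOn_comp
    (F := Real.log) (Real.continuousOn_log.mono fun y hy => ne_of_gt hy))
  have hR' : ∀ s ∈ Icc (0 : ℝ) T, ∀ x, ϱ s x ≤ R₁ := fun s hs x =>
    (hR T hT hTTs s hs x).trans (le_max_left _ _)
  intro t ht x
  have main := le_of_forall_improve (Y := fun s x => -Real.log (ϱ s x)) (T := T) (A := A) hl0.le
    hA0 (fun s hs x => (neg_le_abs _).trans (hB s hs x)) (fun Z hZ hY t ht x => by
      rcases ht.1.eq_or_lt with h0 | h0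
      · subst h0
        have := hinit x
        rw [mul_zero, Real.exp_zero, mul_one]
        linarith
      · obtain ⟨ϱt', vt', a', b', h'⟩ := hs t h0 (ht.2.trans_lt hTTs)
        have hsub : ∀ s ∈ Icc (0 : ℝ) t, s ∈ Icc (0 : ℝ) T := fun s hs => ⟨hs.1, hs.2.trans ht.2⟩
        have htTs : t ≤ Ts := ht.2.trans hTTs.le
        have h1 := h'.neg_log_density_le h0 (M₀ := M₀) (fun s hs => hR' s (hsub s hs)) hR1 hD0
          (fun m hm => h'.integral_density_mul_norm_rpow_le hγ hm
            (fun s hs => hR' s (hsub s hs)) h0.le htTs (le_max_right M 1)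
            (fun x => (hM x).trans (le_max_left _ _)) hN hD) hC1 hC₀
          (fun x => by linarith [hinit x]) hl0 hZ (fun s hs => hY s (hsub s hs)) x
        refine h1.trans ?_
        have h2 : Real.exp (3 * Real.pi ^ 2 * t) ≤ e := by rw [he]; gcongr
        have h3 : t ^ (1 - 1 / 8 : ℝ) / (1 - 1 / 8) + t ^ (1 - 7 / 8 : ℝ) / (1 - 7 / 8) ≤ J :=
          add_le_add
            (div_le_div_of_nonneg_right (Real.rpow_le_rpow h0.le htTs (by norm_num)) (by norm_num))
            (div_le_div_of_nonneg_right (Real.rpow_le_rpow h0.le htTs (by norm_num)) (by norm_num))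
        have hE1 : 1 ≤ Real.exp (l * t) := Real.one_le_exp (mul_nonneg hl0.le ht.1)
        have h4 : 0 ≤ CB * (1 + Z) * Real.exp (l * t) * l ^ (-(1 / 8) : ℝ) := by positivity
        have hM₀nn : 0 ≤ M₀ := by positivity
        have h5 : 0 ≤ C₀ * M₀ := by positivity
        calc _ ≤ Real.exp (3 * Real.pi ^ 2 * t) * (C₀ * M₀ +
                CB * (1 + Z) * Real.exp (l * t) * l ^ (-(1 / 8) : ℝ) * J) :=
              mul_le_mul_of_nonneg_left (by linarith [mul_le_mul_of_nonneg_left h3 h4])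
                (Real.exp_pos _).le
          _ ≤ e * (C₀ * M₀ + CB * (1 + Z) * Real.exp (l * t) * l ^ (-(1 / 8) : ℝ) * J) :=
              mul_le_mul_of_nonneg_right h2 (add_nonneg h5 (mul_nonneg h4 hJ0))
          _ = e * (C₀ * M₀) + (W * l ^ (-(1 / 8) : ℝ)) * ((1 + Z) * Real.exp (l * t)) := by
              rw [hW]; ring
          _ ≤ e * (C₀ * M₀) * Real.exp (l * t) + 1 / 2 * ((1 + Z) * Real.exp (l * t)) :=
              add_le_add (le_mul_of_one_le_right (by positivity) hE1)
                (mul_le_mul_of_nonneg_right hlW (by positivity))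
          _ = (A + Z / 2) * Real.exp (l * t) := by rw [hA]; ring) t ht x
  refine main.trans (mul_le_mul_of_nonneg_left (Real.exp_le_exp.2 ?_) (by positivity))
  exact mul_le_mul_of_nonneg_left (ht.2.trans hTTs.le) hl0.le

/-- Bounds for the initial data hold everywhere for the continuous representatives. -/
lemma norm_le_of_eLpNorm_top_le {F : Type*} [NormedAddCommGroup F] {f g : Torus → F} {M : ℝ}
    (hf : Continuous f) (hfg : f =ᵐ[volume] g) (h : eLpNorm g ∞ volume ≤ ENNReal.ofReal M)
    (x : Torus) : ‖f x‖ ≤ max M 0 := by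
  rw [← eLpNorm_congr_ae hfg, eLpNorm_exponent_top] at h
  have h1 : ∀ᵐ x : Torus, ‖f x‖ ≤ max M 0 := by
    filter_upwards [ae_le_eLpNormEssSup (f := f) (μ := volume)] with x hx
    have := hx.trans h
    rw [← ofReal_norm] at this
    have h2 := (ENNReal.ofReal_le_ofReal_iff' ).1 this
    rcases h2 with h2 | h2
    · exact h2.trans (le_max_left _ _)
    · exact h2.trans (le_max_right _ _)
  have hopen : IsOpen {x | max M 0 < ‖f x‖} := isOpen_lt continuous_const hf.norm
  have hnull : volume {x : Torus | max M 0 < ‖f x‖} = 0 := by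
    simpa [ae_iff] using h1
  have := hopen.eq_empty_of_measure_zero hnull
  by_contra hx
  exact (this ▸ (show x ∈ {x | max M 0 < ‖f x‖} from not_le.1 hx) : x ∈ (∅ : Set Torus))

end

end NSK

end

theorem mainTheorem3 (γ q Ts : ℝ) (hγ : 1 < γ) (hγ' : γ < 7 / 3) (hq : 1 < q) (hq' : q < 4)
    (hγq : γ < 1 + 4 / (q + 2)) (hTs : 0 < Ts) (M₀ M₁ M₂ M₃ M₄ : ℝ) :
    ∃ C : ℝ, 0 < C ∧
      ∀ (ϱ₀ : NSK.Torus → ℝ) (u₀ : NSK.Torus → NSK.Vec)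
        (ϱ : ℝ → NSK.Torus → ℝ) (v : ℝ → NSK.Torus → NSK.Vec),
        NSK.IsInitialData ϱ₀ u₀ →
        NSK.IsStrongSolution γ Ts ϱ₀ (NSK.effVelocity ϱ₀ u₀) ϱ v →
        NSK.initialEnergy γ ϱ₀ u₀ ≤ M₀ →
        eLpNorm (fun x => (ϱ₀ x ^ (1 / (q + 2))) • NSK.effVelocity ϱ₀ u₀ x)
          (ENNReal.ofReal (q + 2)) volume ≤ ENNReal.ofReal M₁ →
        eLpNorm ϱ₀ ∞ volume ≤ ENNReal.ofReal M₂ →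
        eLpNorm (NSK.effVelocity ϱ₀ u₀) ∞ volume ≤ ENNReal.ofReal M₃ →
        eLpNorm (fun x => (ϱ₀ x)⁻¹) ∞ volume ≤ ENNReal.ofReal M₄ →
        ∀ T : ℝ, 0 < T → T < Ts →
          (⨆ t ∈ Icc (0 : ℝ) T, eLpNorm (fun x => (ϱ t x)⁻¹) ∞ volume) ≤ ENNReal.ofReal C := by
  have hp : 3 < q + 2 := by linarith
  have hγp : γ * (2 * (q + 2) / 3 - 1) ≤ (q + 2) - 1 / 2 := by
    have h1 : γ * (2 * (q + 2) / 3 - 1) ≤ (1 + 4 / (q + 2)) * (2 * (q + 2) / 3 - 1) :=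
      mul_le_mul_of_nonneg_right hγq.le (by linarith)
    have h2 : (1 + 4 / (q + 2)) * (2 * (q + 2) / 3 - 1)
        = 2 * (q + 2) / 3 + 5 / 3 - 4 / (q + 2) := by
      have : q + 2 ≠ 0 := by linarith
      field_simp; ring
    -- equivalent to `2 p² - 13 p + 24 ≥ 0` for `p = q + 2`, which has no real root
    have h3 : 13 / 6 - (q + 2) / 3 ≤ 4 / (q + 2) := by
      rw [le_div_iff₀ (by linarith)]; nlinarith [sq_nonneg (q + 2 - 13 / 4)]
    linarith
  obtain ⟨B, hB0, hB⟩ := NSK.exists_moment_le (γ := γ) (p := q + 2) (Ts := Ts) (max M₂ 0)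
    (max M₃ 0) hγ hp (by linarith) hγp hTs
  obtain ⟨K, hK1, hK⟩ := NSK.exists_density_le (p := q + 2) (Ts := Ts) (max M₂ 0) hp hTs
  obtain ⟨C, hC⟩ := NSK.exists_neg_log_density_le (γ := γ) (Ts := Ts) hγ hTs (K * (1 + B))
    (max M₂ 0) (max M₃ 0) (max M₄ 0)
  refine ⟨Real.exp C, Real.exp_pos C, fun ϱ₀ u₀ ϱ v _ h _ _ hM₂ hM₃ hM₄ T hT hTTs => ?_⟩
  have hs : NSK.Solves γ Ts ϱ v := fun t h0 h1 => h.exists_evolution h0 h1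
  obtain ⟨ϱt, vt, a, b, hev⟩ := hs T hT hTTs
  have hst := hev.state 0 ⟨le_rfl, hT.le⟩
  have hϱ0 : ∀ x, ϱ 0 x ≤ max M₂ 0 := fun x => (le_abs_self _).trans
    (NSK.norm_le_of_eLpNorm_top_le hst.cont h.initial_density hM₂ x)
  have hv0 : ∀ x, ‖v 0 x‖ ≤ max M₃ 0 :=
    NSK.norm_le_of_eLpNorm_top_le hst.contv h.initial_velocity hM₃
  have hinv : ∀ x, (ϱ 0 x)⁻¹ ≤ max M₄ 0 := fun x => (le_abs_self _).trans
    (NSK.norm_le_of_eLpNorm_top_le (f := fun x => (ϱ 0 x)⁻¹)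
      (hst.cont.inv₀ fun x => (hst.pos x).ne') (h.initial_density.fun_comp fun y => y⁻¹) hM₄ x)
  have hR : ∀ T, 0 < T → T < Ts → ∀ s ∈ Icc (0 : ℝ) T, ∀ x, ϱ s x ≤ K * (1 + B) :=
    fun T h0 h1 => hK γ ϱ v hs hϱ0 T h0 h1 B (hB ϱ v hs hϱ0 hv0 T h0 h1)
  refine iSup₂_le fun t ht => ?_
  rw [eLpNorm_exponent_top]
  refine eLpNormEssSup_le_of_ae_bound (Eventually.of_forall fun x => ?_)
  have hpos := (hev.state t ht).pos x
  have h1 := hC ϱ v hs hϱ0 hv0 hinv hR T hT hTTs t ht x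
  rw [Real.norm_eq_abs, abs_of_pos (inv_pos.2 hpos), ← Real.log_le_iff_le_exp (inv_pos.2 hpos),
    Real.log_inv]
  exact h1
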